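/- Let $T=(V,E)$ be a finite tree with at least two vertices, rooted at $v_0\in V$, and let $d_v$ denote the degree of $v$. Let $(X_s)_{s\ge 0}$ be the continuous-time simple random walk on $T$ started at $v_0$: it waits independent exponential times of mean $1$ between jumps, and each jump goes to a uniformly chosen neighbor. For $v\in V$ and $s,t\ge 0$ put $$L_s^v=\frac1{d_v}\int_0^s \mathbf 1_{\{X_r=v\}}\,dr,\qquad \tau(t)=\inf\{s\ge 0: L_s^{v_0}>t\}.$$ Let $\{\eta_v\}_{v\in V}$ be the Gaussian free field on $T$ with $\eta_{v_0}=0$, that is, $\eta_{v_0}=0$ almost surely and $(\eta_v)_{v\ne v_0}$ has density with respect to Lebesgue measure on $\mathbb R^{V\setminus\{v_0\}}$ proportional to $$\exp\Big(-\frac12\sum_{\{u,v\}\in E}(\eta_u-\eta_v)^2\Big).$$ Then for every $t>0$ the random variable $\min_{v\in V}\sqrt{L^v_{\tau(t)}}$ is stochastically dominated by $\frac1{\sqrt2}\max\{\min_{v\in V}\eta_v+\sqrt{2t},\,0\}$, i.e. for every $x\in\mathbb R$, $$\mathbb P\Big(\min_{v\in V}\sqrt{L^v_{\tau(t)}}>x\Big)\le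 \mathbb P\Big(\frac1{\sqrt2}\max\Big\{\min_{v\in V}\eta_v+\sqrt{2t},\,0\Big\}>x\Big).$$ -/

import Mathlib

open MeasureTheory ProbabilityTheory
open scoped ENNReal

noncomputable section

namespace GraphWalk

/-- A graph as an electric network: every edge carries a unit conductance `c_{uv}`. -/
def conductance {V : Type*} (G : SimpleGraph V) [DecidableRel G.Adj] (u v : V) : ℝ :=
  if G.Adj u v then 1 else 0

/-- The total conductance `c_u = ∑_v c_{uv}` (here, the degree of `u`). -/
def totalConductance {V : Type*} [Fintype V] (G : SimpleGraph V) [DecidableRel G.Adj]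
    (u : V) : ℝ :=
  ∑ v, conductance G u v

/-- The transition probabilities `p_{uv} = c_{uv} / c_u` of the random walk. -/
def transitionProb {V : Type*} [Fintype V] (G : SimpleGraph V) [DecidableRel G.Adj]
    (u v : V) : ℝ :=
  conductance G u v / totalConductance G u

/-- `S` is the discrete time random walk on `G` started at `v₀`: the Markov chain with transition
probabilities `p_{uv}`, given by its finite dimensional distributions. -/
structure IsDiscreteWalk {V Ω : Type*} [Fintype V] [DecidableEq V] [MeasurableSpace V]
    [MeasurableSpace Ω] (G : SimpleGraph V) [DecidableRel G.Adj] (v₀ : V)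
    (S : ℕ → Ω → V) (P : Measure Ω) : Prop where
  measurable : ∀ n, Measurable (S n)
  path_prob : ∀ (n : ℕ) (x : ℕ → V), P {ω | ∀ k ≤ n, S k ω = x k} =
    if x 0 = v₀ then ∏ k ∈ Finset.range n, ENNReal.ofReal (transitionProb G (x k) (x (k + 1)))
    else 0

/-- `J` is a sequence of i.i.d. exponential random variables with mean `1`. -/
structure IsHoldingTimes {Ω : Type*} [MeasurableSpace Ω] (J : ℕ → Ω → ℝ) (P : Measure Ω) :
    Prop where
  measurable : ∀ n, Measurable (J n)
  indep : iIndepFun J P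
  law : ∀ n, HasLaw (J n) (expMeasure 1) P

/-- The time `J_0 + ⋯ + J_{n-1}` of the `n`-th jump. -/
def jumpTime {Ω : Type*} (J : ℕ → Ω → ℝ) (n : ℕ) (ω : Ω) : ℝ :=
  ∑ i ∈ Finset.range n, J i ω

/-- `X` is the continuous-time random walk on `G` started at `v₀`: almost surely its path jumps
according to a discrete time random walk `S`, the times spent between jumps being i.i.d.
exponential with mean `1` and independent of `S`. (Almost surely the jump times tend to infinity,
so that this determines `X s` for all `s ≥ 0`; the values at negative times are irrelevant.) -/
def IsContinuousTimeWalk {V Ω : Type*} [Fintype V] [DecidableEq V] [MeasurableSpace V]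
    [MeasurableSpace Ω] (G : SimpleGraph V) [DecidableRel G.Adj] (v₀ : V)
    (X : ℝ → Ω → V) (P : Measure Ω) : Prop :=
  ∃ (S : ℕ → Ω → V) (J : ℕ → Ω → ℝ),
    IsDiscreteWalk G v₀ S P ∧ IsHoldingTimes J P ∧
    IndepFun (fun ω n => S n ω) (fun ω n => J n ω) P ∧
    ∀ᵐ ω ∂P, ∀ (n : ℕ) (s : ℝ), jumpTime J n ω ≤ s → s < jumpTime J (n + 1) ω → X s ω = S n ω

/-- The local time `L_s^v = (1 / c_v) ∫_0^s 1_{X_r = v} dr`. -/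
def localTime {V Ω : Type*} [Fintype V] (G : SimpleGraph V) [DecidableRel G.Adj]
    (X : ℝ → Ω → V) (v : V) (s : ℝ) (ω : Ω) : ℝ :=
  1 / totalConductance G v * ∫ r in (0 : ℝ)..s, Set.indicator {r | X r ω = v} (fun _ => (1 : ℝ)) r

/-- The inverse local time `τ(t) = inf {s ≥ 0 : L_s^{v₀} > t}`. (For the random walk on a finite
connected graph this set is almost surely nonempty.) -/
def inverseLocalTime {V Ω : Type*} [Fintype V] (G : SimpleGraph V) [DecidableRel G.Adj]
    (X : ℝ → Ω → V) (v₀ : V) (t : ℝ) (ω : Ω) : ℝ :=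
  sInf {s : ℝ | 0 ≤ s ∧ t < localTime G X v₀ s ω}

/-- Extend a function on `V \ {v₀}` to `V` by the value `0` at `v₀`. -/
def extendZero {V : Type*} [DecidableEq V] (v₀ : V) (x : {v : V // v ≠ v₀} → ℝ) (v : V) : ℝ :=
  if h : v ≠ v₀ then x ⟨v, h⟩ else 0

/-- The unnormalized density `exp (- (1/4) ∑_{u,v} c_{uv} |η_u - η_v|²)` of the Gaussian free
field with `η_{v₀} = 0`, the sum being over ordered pairs. -/
def gffDensity {V : Type*} [Fintype V] [DecidableEq V] (G : SimpleGraph V) [DecidableRel G.Adj]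
    (v₀ : V) (x : {v : V // v ≠ v₀} → ℝ) : ℝ :=
  Real.exp (-(1 / 4) * ∑ u, ∑ v,
    conductance G u v * |extendZero v₀ x u - extendZero v₀ x v| ^ 2)

/-- The probability measure on `ℝ^{V \ {v₀}}` whose density with respect to Lebesgue measure is
proportional to `gffDensity`. -/
def gffMeasure {V : Type*} [Fintype V] [DecidableEq V] (G : SimpleGraph V) [DecidableRel G.Adj]
    (v₀ : V) : Measure ({v : V // v ≠ v₀} → ℝ) :=
  (∫⁻ x, ENNReal.ofReal (gffDensity G v₀ x))⁻¹ •
    (volume : Measure ({v : V // v ≠ v₀} → ℝ)).withDensity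
      (fun x => ENNReal.ofReal (gffDensity G v₀ x))

/-- `η` is the Gaussian free field on `G` with `η_{v₀} = 0`. -/
structure IsGFF {V Ω : Type*} [Fintype V] [DecidableEq V] [MeasurableSpace Ω]
    (G : SimpleGraph V) [DecidableRel G.Adj] (v₀ : V) (η : V → Ω → ℝ) (P : Measure Ω) :
    Prop where
  measurable : ∀ v, Measurable (η v)
  root : ∀ᵐ ω ∂P, η v₀ ω = 0
  law : HasLaw (fun ω (v : {v : V // v ≠ v₀}) => η v ω) (gffMeasure G v₀) P

/-- The random variable `A` on `(Ω, P)` is stochastically dominated by the random variable `B` on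
`(Ω', P')`; that both are random variables is part of the assertion. -/
structure StochDominated {Ω Ω' : Type*} [MeasurableSpace Ω] [MeasurableSpace Ω']
    (A : Ω → ℝ) (P : Measure Ω) (B : Ω' → ℝ) (P' : Measure Ω') : Prop where
  left_aemeasurable : AEMeasurable A P
  right_aemeasurable : AEMeasurable B P'
  tail_le : ∀ x : ℝ, P {ω | x < A ω} ≤ P' {ω | x < B ω}

end GraphWalk

end

/-! Both the local times at τ(t) and the free field are Markov along the tree, so the comparison
reduces to a single edge, followed by an induction that removes the vertices farthest from the root.

Local times. If local time at each v is killed at rate l_v, then the subtree above v acts like one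
vertex killed at the rate a_v = l_v + Σ a_z/(1+a_z), summed over the children z (`effectiveRate`),
and E exp(-Σ l_v L^v) = exp(-t a_{v₀}) (`lintegral_exp_localField_tree`). This comes from a
discounted martingale for the walk (`lintegral_discountedValue_succ`), followed up to the holding
interval in which the time spent at v₀ passes t d_{v₀}. The function l/(1+l) is also the Laplace
exponent of a Poisson number of exponential variables. By uniqueness of Laplace transforms, given
the local times on a set closed under taking parents, the local time at a further child w of a
vertex u of this set is a sum of Poisson(L^u) many independent exponentials of mean 1
(`lintegral_localField_markov`). For the free field, η_w is η_u plus an independent standard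
Gaussian (`IsGFF.lintegral_markov`).

One edge. Let b = √(2L^u) and a ≥ 0. The compound Poisson tail beyond a²/2 is P(N' < N) = Σ_j P(N' =
j) P(N > j), with independent Poisson variables N' of mean a²/2 and N of mean b²/2. Here P(N > j) =
P(χ_{2j+2} < b) ≤ P(χ_{2j+1} < b), and the mixture of the χ_{2j+1} laws over N' is the law of |Z|
with Z ~ N(a,1). Hence the tail is at most P(|Z| < b) ≤ P(Z < b) = P(b + N(0,1) > a)
(`compoundPoissonAverage_Ioi_le_gaussianReal`).

Induction. `lintegral_prod_localField_le` tests both fields against products of increasing functions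
of one coordinate. The factor at the farthest vertex is averaged over its last step and absorbed
into the factor at its parent. The factors vanish below a nonnegative level, because √(2L) is never
negative and the one-edge bound fails at negative levels; the maximum with 0 in the theorem covers
those. -/

noncomputable section

set_option linter.unusedSectionVars false

namespace GraphWalk

/-! ### Integrals against the exponential law. -/

section

lemma lintegral_expMeasure_one (f : ℝ → ℝ≥0∞) (hf : Measurable f) :
    ∫⁻ y, f y ∂(expMeasure 1) = ∫⁻ y in Set.Ioi 0, ENNReal.ofReal (Real.exp (-y)) * f y := by
  have h : expMeasure 1 = volume.withDensity (exponentialPDF 1) := rfl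
  have hm : Measurable (exponentialPDF 1) :=
    (measurable_exponentialPDFReal 1).ennreal_ofReal
  rw [h, lintegral_withDensity_eq_lintegral_mul _ hm hf, ← setLIntegral_congr Ioi_ae_eq_Ici.symm,
    ← lintegral_indicator measurableSet_Ici]
  refine lintegral_congr fun y => ?_
  by_cases hy : 0 ≤ y
  · simp [Set.indicator, hy, exponentialPDF_of_nonneg hy]
  · simp [Set.indicator, hy, exponentialPDF_of_neg (not_le.1 hy)]

lemma lintegral_exp_neg_mul_Ioc {k b : ℝ} (hb : 0 ≤ b) (hk : 0 ≤ k) :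
    ENNReal.ofReal k * ∫⁻ y in Set.Ioc 0 b, ENNReal.ofReal (Real.exp (-(k * y))) =
      ENNReal.ofReal (1 - Real.exp (-(k * b))) := by
  have hd : ∀ y, HasDerivAt (fun y => -Real.exp (-(k * y))) (k * Real.exp (-(k * y))) y := by
    intro y
    have := (((hasDerivAt_id y).const_mul k).neg.exp).neg
    simp only [id, mul_one, mul_neg, neg_neg] at this
    rw [mul_comm]
    exact this
  have hi := intervalIntegral.integral_eq_sub_of_hasDerivAt (a := 0) (b := b)
    (fun y _ => hd y) (Continuous.intervalIntegrable (by fun_prop) _ _)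
  rw [← lintegral_const_mul _ (by fun_prop)]
  simp_rw [← ENNReal.ofReal_mul hk]
  rw [← ofReal_integral_eq_lintegral_ofReal, ← intervalIntegral.integral_of_le hb, hi]
  · simp; ring_nf
  · exact (Continuous.integrableOn_Icc (by fun_prop)).mono_set Set.Ioc_subset_Icc_self
  · exact Filter.Eventually.of_forall fun y => by positivity

lemma lintegral_exp_neg_mul_expMeasure {c : ℝ} (hc : 0 ≤ c) :
    ∫⁻ y, ENNReal.ofReal (Real.exp (-(c * y))) ∂(expMeasure 1) =
      ENNReal.ofReal (1 / (1 + c)) := by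
  rw [lintegral_expMeasure_one _ (by fun_prop)]
  have h := integral_exp_mul_Ioi (a := -(1 + c)) (by linarith) 0
  have h2 := integrableOn_exp_mul_Ioi (a := -(1 + c)) (by linarith) 0
  simp_rw [← ENNReal.ofReal_mul (Real.exp_pos _).le, ← Real.exp_add]
  rw [← ofReal_integral_eq_lintegral_ofReal]
  · congr 1
    rw [show 1 / (1 + c) = ∫ x in Set.Ioi 0, Real.exp (-(1 + c) * x) by
      rw [h]; simp only [mul_zero, Real.exp_zero]; rw [neg_div_neg_eq]]
    refine integral_congr_ae (Filter.Eventually.of_forall fun y => ?_)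
    ring_nf
  · refine h2.congr_fun (fun y _ => ?_) measurableSet_Ioi
    ring_nf
  · exact Filter.Eventually.of_forall fun y => by positivity

lemma expMeasure_one_Ioi {b : ℝ} (hb : 0 ≤ b) :
    ∫⁻ y, (if b < y then 1 else 0) ∂(expMeasure 1) = ENNReal.ofReal (Real.exp (-b)) := by
  have hm : Measurable (fun y : ℝ => if b < y then (1 : ℝ≥0∞) else 0) :=
    Measurable.ite measurableSet_Ioi measurable_const measurable_const
  rw [lintegral_expMeasure_one _ hm]
  have h := integral_exp_mul_Ioi (a := -1) (by norm_num) b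
  have h2 := integrableOn_exp_mul_Ioi (a := -1) (by norm_num) b
  have : ∀ y : ℝ, ENNReal.ofReal (Real.exp (-y)) * (if b < y then (1 : ℝ≥0∞) else 0) =
      (Set.Ioi b).indicator (fun y => ENNReal.ofReal (Real.exp (-1 * y))) y := by
    intro y; by_cases hy : b < y <;> simp [hy]
  simp_rw [this]
  rw [setLIntegral_indicator measurableSet_Ioi,
    Set.inter_eq_left.2 (Set.Ioi_subset_Ioi hb), ← ofReal_integral_eq_lintegral_ofReal h2, h]
  · simp
  · exact Filter.Eventually.of_forall fun y => by positivity

/-- For k in [0,1], suppose that excursions start at rate 1 and each fails with probability k.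
Either the first one starts at y ≤ b and succeeds, leaving the time b - y, or none starts before b;
both sides are the chance of no failure up to b. -/
lemma lintegral_renewal_expMeasure {b k : ℝ} (hb : 0 ≤ b) (hk1 : k ≤ 1) :
    ENNReal.ofReal (1 - k) *
        ∫⁻ y, (if y ≤ b then ENNReal.ofReal (Real.exp (-(k * (b - y)))) else 0) ∂(expMeasure 1) +
      ENNReal.ofReal (Real.exp (-b)) = ENNReal.ofReal (Real.exp (-(k * b))) := by
  have hm : Measurable
      (fun y : ℝ => if y ≤ b then ENNReal.ofReal (Real.exp (-(k * (b - y)))) else 0) :=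
    Measurable.ite measurableSet_Iic (by fun_prop) measurable_const
  rw [lintegral_expMeasure_one _ hm]
  have : ∀ y : ℝ, ENNReal.ofReal (Real.exp (-y)) *
      (if y ≤ b then ENNReal.ofReal (Real.exp (-(k * (b - y)))) else 0) =
      (Set.Iic b).indicator (fun y => ENNReal.ofReal (Real.exp (-(k * b))) *
        ENNReal.ofReal (Real.exp (-((1 - k) * y)))) y := by
    intro y; by_cases hy : y ≤ b
    · simp only [hy, if_true, Set.mem_Iic, Set.indicator_of_mem]
      rw [← ENNReal.ofReal_mul (Real.exp_pos _).le, ← ENNReal.ofReal_mul (Real.exp_pos _).le,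
        ← Real.exp_add, ← Real.exp_add]
      ring_nf
    · simp [hy]
  simp_rw [this]
  rw [setLIntegral_indicator measurableSet_Iic, Set.Iic_inter_Ioi,
    lintegral_const_mul _ (by fun_prop), mul_left_comm,
    lintegral_exp_neg_mul_Ioc hb (by linarith), ← ENNReal.ofReal_mul (Real.exp_pos _).le,
    ← ENNReal.ofReal_add _ (Real.exp_pos _).le]
  · congr 1
    rw [mul_sub, ← Real.exp_add]
    ring_nf
  · have : Real.exp (-((1 - k) * b)) ≤ 1 := by
      rw [Real.exp_le_one_iff]; nlinarith
    have := Real.exp_pos (-(k * b))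
    nlinarith

/-! ### The Markov property of the walk together with its holding times. -/

variable {V Ω : Type*} [Fintype V] [DecidableEq V] [MeasurableSpace V]
  [MeasurableSingletonClass V] [MeasurableSpace Ω] {G : SimpleGraph V} [DecidableRel G.Adj]
  {v₀ : V} {P : Measure Ω} [IsProbabilityMeasure P] {S : ℕ → Ω → V} {J : ℕ → Ω → ℝ}

/-- The extension of a finite path to an infinite one that stays at its end point. -/
def extendPath {n : ℕ} (x : Fin (n + 1) → V) (k : ℕ) : V :=
  x ⟨min k n, by omega⟩

/-- As V is finite, the first steps take finitely many values. On each piece the path is frozen;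
this replaces conditioning, and functionals need only be measurable in the holding times for each
fixed path. -/
lemma lintegral_eq_sum_prefix (hS : ∀ n, Measurable (S n)) (n : ℕ) (f : Ω → ℝ≥0∞) :
    ∫⁻ ω, f ω ∂P =
      ∑ x : Fin (n + 1) → V, ∫⁻ ω in {ω | ∀ k ≤ n, S k ω = extendPath x k}, f ω ∂P := by
  have hB : ∀ x : Fin (n + 1) → V, MeasurableSet {ω | ∀ k ≤ n, S k ω = extendPath x k} := by
    intro x
    simp_rw [Set.ofPred_forall]
    exact MeasurableSet.iInter fun k => MeasurableSet.iInter fun _ =>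
      hS k (measurableSet_singleton _)
  rw [← tsum_fintype (L := .unconditional _), ← lintegral_iUnion hB]
  · rw [show (⋃ x : Fin (n + 1) → V, {ω | ∀ k ≤ n, S k ω = extendPath x k}) = Set.univ from ?_]
    · simp
    · refine Set.eq_univ_of_forall fun ω => Set.mem_iUnion.2 ⟨fun i => S i ω, fun k hk => ?_⟩
      simp [extendPath, hk]
  · intro x y hxy
    refine Set.disjoint_left.2 fun ω hx hy => hxy (funext fun i => ?_)
    have h1 := hx i (by omega)
    have h2 := hy i (by omega)
    rw [h1] at h2
    simpa [extendPath, Nat.min_eq_left (Nat.le_of_lt_succ i.2)] using h2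

/-- `F` depends on its argument only through the coordinates in `s`. -/
def DependsOnly {α β : Type*} (F : (ℕ → α) → β) (s : Set ℕ) : Prop :=
  ∀ x x', (∀ k ∈ s, x k = x' k) → F x = F x'

lemma setLIntegral_eq_mul_of_indepFun (hS : ∀ n, Measurable (S n)) (hJ : ∀ n, Measurable (J n))
    (hSJ : IndepFun (fun ω n => S n ω) (fun ω n => J n ω) P) {C : Set (ℕ → V)}
    (hC : MeasurableSet C) {f : (ℕ → ℝ) → ℝ≥0∞} (hf : Measurable f) :
    ∫⁻ ω in {ω | (fun n => S n ω) ∈ C}, f (fun n => J n ω) ∂P =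
      P {ω | (fun n => S n ω) ∈ C} * ∫⁻ ω, f (fun n => J n ω) ∂P := by
  have hSm : Measurable fun ω n => S n ω := measurable_pi_lambda _ hS
  have hJm : Measurable fun ω n => J n ω := measurable_pi_lambda _ hJ
  have hB : MeasurableSet {ω | (fun n => S n ω) ∈ C} := hSm hC
  have h1 : Measurable (C.indicator (1 : (ℕ → V) → ℝ≥0∞)) := measurable_one.indicator hC
  have := lintegral_mul_eq_lintegral_mul_lintegral_of_indepFun'' (μ := P)
    (h1.comp hSm).aemeasurable (hf.comp hJm).aemeasurable (hSJ.comp h1 hf)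
  rw [← lintegral_indicator hB]
  rw [show P {ω | (fun n => S n ω) ∈ C} =
    ∫⁻ ω, (C.indicator (1 : (ℕ → V) → ℝ≥0∞) ∘ fun ω n => S n ω) ω ∂P from ?_]
  · simp only [Function.comp_def] at this ⊢
    rw [← this]
    refine lintegral_congr fun ω => ?_
    by_cases h : (fun n => S n ω) ∈ C <;> simp [Set.indicator, h]
  · rw [← lintegral_indicator_one hB]
    rfl

lemma measurableSet_prefix (n : ℕ) (x : ℕ → V) :
    MeasurableSet {s : ℕ → V | ∀ k ≤ n, s k = x k} := by
  simp_rw [Set.ofPred_forall]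
  exact MeasurableSet.iInter fun k => MeasurableSet.iInter fun _ =>
    measurable_pi_apply k (measurableSet_singleton _)

/-- The Markov property of the discrete walk, jointly with independent holding times. -/
lemma lintegral_next_step (hS : IsDiscreteWalk G v₀ S P) (hJ : ∀ n, Measurable (J n))
    (hSJ : IndepFun (fun ω n => S n ω) (fun ω n => J n ω) P) (n : ℕ) (w : V)
    {F : (ℕ → V) → (ℕ → ℝ) → ℝ≥0∞} (hF : ∀ x, Measurable (F x))
    (hFn : DependsOnly F (Set.Iic n)) :
    ∫⁻ ω, (if S (n + 1) ω = w then F (fun n => S n ω) (fun n => J n ω) else 0) ∂P =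
      ∫⁻ ω, ENNReal.ofReal (transitionProb G (S n ω) w) *
        F (fun n => S n ω) (fun n => J n ω) ∂P := by
  have hSm : Measurable fun ω n => S n ω := measurable_pi_lambda _ hS.measurable
  rw [lintegral_eq_sum_prefix hS.measurable n, lintegral_eq_sum_prefix hS.measurable n]
  refine Finset.sum_congr rfl fun x _ => ?_
  set y := extendPath x with hy
  have hB : MeasurableSet {ω | ∀ k ≤ n, S k ω = y k} := hSm (measurableSet_prefix n y)
  have hB' : MeasurableSet {ω | ∀ k ≤ n + 1, S k ω = Function.update y (n + 1) w k} :=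
    hSm (measurableSet_prefix (n + 1) _)
  have e1 : ∫⁻ ω in {ω | ∀ k ≤ n, S k ω = y k},
      (if S (n + 1) ω = w then F (fun n => S n ω) (fun n => J n ω) else 0) ∂P =
      ∫⁻ ω in {ω | ∀ k ≤ n + 1, S k ω = Function.update y (n + 1) w k},
        F y (fun n => J n ω) ∂P := by
    rw [← lintegral_indicator hB, ← lintegral_indicator hB']
    refine lintegral_congr fun ω => ?_
    have : (∀ k ≤ n + 1, S k ω = Function.update y (n + 1) w k) ↔
        (∀ k ≤ n, S k ω = y k) ∧ S (n + 1) ω = w := by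
      constructor
      · intro h
        refine ⟨fun k hk => ?_, ?_⟩
        · rw [h k (by omega), Function.update_of_ne (by omega)]
        · simpa using h (n + 1) le_rfl
      · rintro ⟨h1, h2⟩ k hk
        rcases Nat.lt_or_ge n k with h | h
        · obtain rfl : k = n + 1 := by omega
          simpa using h2
        · rw [h1 k h, Function.update_of_ne (by omega)]
    simp only [Set.indicator, Set.mem_ofPred_eq, this]
    by_cases h1 : ∀ k ≤ n, S k ω = y k
    · rw [hFn (fun n => S n ω) y (fun k hk => h1 k hk), if_pos h1]
      by_cases h2 : S (n + 1) ω = w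
      · rw [if_pos h2, if_pos ⟨h1, h2⟩]
      · rw [if_neg h2, if_neg fun h => h2 h.2]
    · rw [if_neg h1, if_neg fun h => h1 h.1]
  have e2 : ∫⁻ ω in {ω | ∀ k ≤ n, S k ω = y k}, ENNReal.ofReal (transitionProb G (S n ω) w) *
        F (fun n => S n ω) (fun n => J n ω) ∂P =
      ∫⁻ ω in {ω | ∀ k ≤ n, S k ω = y k}, ENNReal.ofReal (transitionProb G (y n) w) *
        F y (fun n => J n ω) ∂P := by
    refine setLIntegral_congr_fun hB fun ω h => ?_
    rw [hFn (fun n => S n ω) y (fun k hk => h k hk), h n le_rfl]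
  have i1 := setLIntegral_eq_mul_of_indepFun hS.measurable hJ hSJ
    (measurableSet_prefix (n + 1) (Function.update y (n + 1) w)) (hF y)
  have i2 := setLIntegral_eq_mul_of_indepFun hS.measurable hJ hSJ
    (measurableSet_prefix n y) ((hF y).const_mul (ENNReal.ofReal (transitionProb G (y n) w)))
  have hJm : Measurable fun ω n => J n ω := measurable_pi_lambda _ hJ
  simp only [Set.mem_ofPred_eq] at i1 i2
  rw [e1, e2, i1, i2,
    lintegral_const_mul _ (show Measurable fun ω => F y fun n => J n ω from (hF y).comp hJm),
    hS.path_prob, hS.path_prob]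
  -- The longer prefix has one more factor in `path_prob`, the transition from `y n` to `w`.
  rw [Function.update_of_ne (by omega : (0 : ℕ) ≠ n + 1), Finset.prod_range_succ]
  have : ∏ k ∈ Finset.range n, ENNReal.ofReal (transitionProb G
      (Function.update y (n + 1) w k) (Function.update y (n + 1) w (k + 1))) =
      ∏ k ∈ Finset.range n, ENNReal.ofReal (transitionProb G (y k) (y (k + 1))) := by
    refine Finset.prod_congr rfl fun k hk => ?_
    have := Finset.mem_range.1 hk
    rw [Function.update_of_ne (by omega), Function.update_of_ne (by omega)]
  rw [this, Function.update_of_ne (by omega), Function.update_self]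
  split_ifs
  · ring
  · simp

/-- Fubini for the law of the times before `n` and the law of `J n`, which are independent. Later
times do not enter because `f` ignores them. -/
lemma lintegral_update_holdingTime_aux (hJ : IsHoldingTimes J P) (n : ℕ)
    {f : (ℕ → ℝ) → ℝ≥0∞} (hf : Measurable f) (hfn : DependsOnly f (Set.Iic n)) :
    ∫⁻ ω, f (fun n => J n ω) ∂P =
      ∫⁻ ω, ∫⁻ y, f (Function.update (fun n => J n ω) n y) ∂(expMeasure 1) ∂P := by
  have hE : IsProbabilityMeasure (expMeasure 1) := isProbabilityMeasure_expMeasure one_pos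
  have hind := hJ.indep.indepFun_finset (Finset.range n) {n} (by simp) hJ.measurable
  have hind2 := hind.comp measurable_id (measurable_pi_apply (⟨n, by simp⟩ : ({n} : Finset ℕ)))
  have hm1 : Measurable fun ω (i : Finset.range n) => J i ω :=
    measurable_pi_lambda _ fun i => hJ.measurable i
  have hmap := (indepFun_iff_map_prod_eq_prod_map_map hm1.aemeasurable
    (hJ.measurable n).aemeasurable).1 hind2
  rw [(hJ.law n).map_eq] at hmap
  -- The values of `e` beyond `n` are arbitrary, since `f` does not see them.
  set e : ((Finset.range n → ℝ) × ℝ) → ℕ → ℝ := fun q k =>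
    if h : k ∈ Finset.range n then q.1 ⟨k, h⟩ else q.2 with he
  have hem : Measurable e := by
    refine measurable_pi_lambda _ fun k => ?_
    by_cases h : k ∈ Finset.range n
    · simp only [he, h, dif_pos]; fun_prop
    · simp only [he, h, dif_neg, not_false_eq_true]; fun_prop
  have h1 : ∀ ω, f (fun n => J n ω) = f (e (fun i => J i ω, J n ω)) := by
    intro ω
    refine hfn _ _ fun k hk => ?_
    by_cases h : k < n
    · simp [he, h]
    · obtain rfl : k = n := le_antisymm hk (not_lt.1 h)
      simp [he]
  have h2 : ∀ ω y, f (Function.update (fun n => J n ω) n y) =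
      f (e (fun i => J i ω, y)) := by
    intro ω y
    refine hfn _ _ fun k hk => ?_
    by_cases h : k < n
    · simp [he, h, h.ne]
    · obtain rfl : k = n := le_antisymm hk (not_lt.1 h)
      simp [he]
  simp_rw [h1, h2]
  have hfe : Measurable fun q => f (e q) := hf.comp hem
  rw [← lintegral_map (f := fun q => f (e q))
    (g := fun ω => ((fun (i : Finset.range n) => J i ω), J n ω))
    hfe (hm1.prodMk (hJ.measurable n))]
  have hmap' : P.map (fun ω => ((fun (i : Finset.range n) => J i ω), J n ω)) =
    (P.map fun ω (i : Finset.range n) => J i ω).prod (expMeasure 1) := hmap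
  rw [hmap', lintegral_prod _ hfe.aemeasurable,
    lintegral_map hfe.lintegral_prod_right' hm1]

lemma lintegral_update_holdingTime (hS : IsDiscreteWalk G v₀ S P) (hJ : IsHoldingTimes J P)
    (hSJ : IndepFun (fun ω n => S n ω) (fun ω n => J n ω) P) (n : ℕ)
    {F : (ℕ → V) → (ℕ → ℝ) → ℝ≥0∞} (hF : ∀ x, Measurable (F x))
    (hFn : DependsOnly F (Set.Iic n)) (hFJ : ∀ x, DependsOnly (F x) (Set.Iic n)) :
    ∫⁻ ω, F (fun n => S n ω) (fun n => J n ω) ∂P =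
      ∫⁻ ω, ∫⁻ y, F (fun n => S n ω) (Function.update (fun n => J n ω) n y)
        ∂(expMeasure 1) ∂P := by
  have hE : IsProbabilityMeasure (expMeasure 1) := isProbabilityMeasure_expMeasure one_pos
  have hSm : Measurable fun ω n => S n ω := measurable_pi_lambda _ hS.measurable
  rw [lintegral_eq_sum_prefix hS.measurable n, lintegral_eq_sum_prefix hS.measurable n]
  refine Finset.sum_congr rfl fun x _ => ?_
  set y := extendPath x with hy
  have hB : MeasurableSet {ω | ∀ k ≤ n, S k ω = y k} := hSm (measurableSet_prefix n y)
  have hup : Measurable fun q : (ℕ → ℝ) × ℝ => Function.update q.1 n q.2 := by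
    refine measurable_pi_lambda _ fun k => ?_
    by_cases h : k = n
    · subst h; simp only [Function.update_self]; fun_prop
    · simp only [Function.update_of_ne h]; fun_prop
  have hg : Measurable fun j : ℕ → ℝ => ∫⁻ z, F y (Function.update j n z) ∂(expMeasure 1) :=
    ((hF y).comp hup).lintegral_prod_right'
  have i1 := setLIntegral_eq_mul_of_indepFun hS.measurable hJ.measurable hSJ
    (measurableSet_prefix n y) (hF y)
  have i2 := setLIntegral_eq_mul_of_indepFun hS.measurable hJ.measurable hSJ
    (measurableSet_prefix n y) hg
  simp only [Set.mem_ofPred_eq] at i1 i2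
  rw [setLIntegral_congr_fun hB (g := fun ω => F y (fun n => J n ω)), i1,
    setLIntegral_congr_fun hB (f := fun ω => ∫⁻ z, F (fun n => S n ω)
      (Function.update (fun n => J n ω) n z) ∂(expMeasure 1))
      (g := fun ω => ∫⁻ z, F y (Function.update (fun n => J n ω) n z) ∂(expMeasure 1)), i2,
    lintegral_update_holdingTime_aux hJ n (hF y) (hFJ y)]
  · intro ω h
    simp only
    rw [hFn (fun n => S n ω) y (fun k hk => h k hk)]
  · intro ω h
    simp only
    rw [hFn (fun n => S n ω) y (fun k hk => h k hk)]

lemma measurable_comp_of_dependsOnly (hS : ∀ n, Measurable (S n)) (hJ : ∀ n, Measurable (J n))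
    {n : ℕ} {F : (ℕ → V) → (ℕ → ℝ) → ℝ≥0∞} (hF : ∀ x, Measurable (F x))
    (hFd : DependsOnly F (Set.Iic n)) :
    Measurable fun ω => F (fun n => S n ω) (fun n => J n ω) := by
  have hSm : Measurable fun ω n => S n ω := measurable_pi_lambda _ hS
  have hJm : Measurable fun ω n => J n ω := measurable_pi_lambda _ hJ
  have : (fun ω => F (fun n => S n ω) (fun n => J n ω)) = fun ω => ∑ x : Fin (n + 1) → V,
      {ω | ∀ k ≤ n, S k ω = extendPath x k}.indicator
        (fun ω => F (extendPath x) (fun n => J n ω)) ω := by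
    ext ω
    rw [Finset.sum_eq_single (fun i : Fin (n + 1) => S i ω)]
    · rw [Set.indicator_of_mem]
      · rw [hFd (fun n => S n ω) (extendPath fun i => S i ω)]
        intro k hk
        simp [extendPath, Nat.min_eq_left (Set.mem_Iic.1 hk)]
      · intro k hk
        simp [extendPath, Nat.min_eq_left hk]
    · intro x _ hx
      refine Set.indicator_of_notMem (fun h => hx (funext fun i => ?_)) _
      have := h i (by omega)
      simp [extendPath, Nat.min_eq_left (Nat.le_of_lt_succ i.2)] at this
      exact this.symm
    · simp
  rw [this]
  refine Finset.measurable_sum _ fun x _ => Measurable.indicator ((hF _).comp hJm) ?_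
  exact hSm (measurableSet_prefix _ _)

/-- One step of the pair formed by the walk and its holding times. -/
lemma lintegral_one_step (hS : IsDiscreteWalk G v₀ S P) (hJ : IsHoldingTimes J P)
    (hSJ : IndepFun (fun ω n => S n ω) (fun ω n => J n ω) P) (n : ℕ)
    {H : (ℕ → V) → (ℕ → ℝ) → ℝ≥0∞} (hH : ∀ x, Measurable (H x))
    (hHn : DependsOnly H (Set.Iic (n + 1))) (hHJ : ∀ x, DependsOnly (H x) (Set.Iic n)) :
    ∫⁻ ω, H (fun n => S n ω) (fun n => J n ω) ∂P =
      ∫⁻ ω, ∑ w, ENNReal.ofReal (transitionProb G (S n ω) w) *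
        ∫⁻ y, H (Function.update (fun n => S n ω) (n + 1) w)
          (Function.update (fun n => J n ω) n y) ∂(expMeasure 1) ∂P := by
  have hE : IsProbabilityMeasure (expMeasure 1) := isProbabilityMeasure_expMeasure one_pos
  have hdep : ∀ w, DependsOnly (fun x => H (Function.update x (n + 1) w)) (Set.Iic n) := by
    intro w x x' hx
    refine hHn _ _ fun k hk => ?_
    by_cases h : k = n + 1
    · subst h; simp
    · rw [Function.update_of_ne h, Function.update_of_ne h]
      exact hx k (by simp only [Set.mem_Iic] at hk ⊢; omega)
  have hSm : Measurable fun ω n => S n ω := measurable_pi_lambda _ hS.measurable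
  have hJm : Measurable fun ω n => J n ω := measurable_pi_lambda _ hJ.measurable
  have hstep : ∀ w, ∫⁻ ω, (if S (n + 1) ω = w then
      H (Function.update (fun n => S n ω) (n + 1) w) (fun n => J n ω) else 0) ∂P =
      ∫⁻ ω, ENNReal.ofReal (transitionProb G (S n ω) w) *
        ∫⁻ y, H (Function.update (fun n => S n ω) (n + 1) w)
          (Function.update (fun n => J n ω) n y) ∂(expMeasure 1) ∂P := by
    intro w
    rw [lintegral_next_step hS hJ.measurable hSJ n w
      (F := fun x => H (Function.update x (n + 1) w)) (fun x => hH _) (hdep w)]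
    rw [lintegral_update_holdingTime hS hJ hSJ n (F := fun x j =>
      ENNReal.ofReal (transitionProb G (x n) w) * H (Function.update x (n + 1) w) j)
      (fun x => (hH _).const_mul _)]
    · refine lintegral_congr fun ω => ?_
      rw [lintegral_const_mul]
      refine (hH _).comp (measurable_pi_lambda _ fun k => ?_)
      by_cases h : k = n
      · subst h; simp only [Function.update_self]; fun_prop
      · simp only [Function.update_of_ne h]; fun_prop
    · intro x x' hx
      have := hdep w x x' hx
      simp only at this ⊢
      rw [this, hx n (by simp)]
    · intro x j j' hj
      simp only
      rw [hHJ _ j j' hj]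
  have hup : Measurable fun q : (ℕ → ℝ) × ℝ => Function.update q.1 n q.2 := by
    refine measurable_pi_lambda _ fun k => ?_
    by_cases h : k = n
    · subst h; simp only [Function.update_self]; fun_prop
    · simp only [Function.update_of_ne h]; fun_prop
  -- Split by the value `w` of the next vertex; only the term with `w = S (n + 1)` survives, and it
  -- is `H` itself.
  rw [lintegral_finsetSum', ← Finset.sum_congr rfl fun w _ => hstep w, ← lintegral_finsetSum']
  · refine lintegral_congr fun ω => ?_
    rw [Finset.sum_ite_eq]
    simp only [Finset.mem_univ, if_true]
    congr 1
    exact (Function.update_eq_self (n + 1) fun n => S n ω).symm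
  · intro w _
    refine (measurable_comp_of_dependsOnly hS.measurable hJ.measurable (n := n + 1)
      (F := fun x j => if x (n + 1) = w then H (Function.update x (n + 1) w) j else 0)
      (fun x => ?_) ?_).aemeasurable
    · split_ifs
      · exact hH _
      · exact measurable_const
    · intro x x' hx
      have := hdep w x x' fun k hk => hx k (by simp only [Set.mem_Iic] at hk ⊢; omega)
      simp only at this ⊢
      rw [hx (n + 1) (by simp), this]
  · intro w _
    refine (measurable_comp_of_dependsOnly hS.measurable hJ.measurable (n := n + 1)
      (F := fun x j => ENNReal.ofReal (transitionProb G (x n) w) *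
        ∫⁻ y, H (Function.update x (n + 1) w) (Function.update j n y) ∂(expMeasure 1))
      (fun x => ?_) ?_).aemeasurable
    · exact (((hH _).comp hup).lintegral_prod_right').const_mul _
    · intro x x' hx
      have := hdep w x x' fun k hk => hx k (by simp only [Set.mem_Iic] at hk ⊢; omega)
      simp only at this ⊢
      rw [hx n (by simp), this]

end

/-! ### The discounted martingale up to the crossing of a level by the time at the root. -/

section

variable {V Ω : Type*} [Fintype V] [DecidableEq V] [MeasurableSpace V]
  [MeasurableSingletonClass V] [MeasurableSpace Ω] {G : SimpleGraph V} [DecidableRel G.Adj]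
  {v₀ : V} {P : Measure Ω} [IsProbabilityMeasure P] {S : ℕ → Ω → V} {J : ℕ → Ω → ℝ}

/-- The time spent at `v` before the `n`-th jump, for the path `x` with holding times `j`. -/
def occupation (x : ℕ → V) (j : ℕ → ℝ) (v : V) (n : ℕ) : ℝ :=
  ∑ k ∈ Finset.range n, if x k = v then j k else 0

/-- The discount accumulated before the `n`-th jump at the rates `c`. -/
def discount (c : V → ℝ) (x : ℕ → V) (j : ℕ → ℝ) (n : ℕ) : ℝ :=
  Real.exp (-∑ k ∈ Finset.range n, c (x k) * j k)

/-- The path is at `v₀`, before the `n+1`-st jump, when its time at `v₀` exceeds `r`. -/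
def CrossesAt (v₀ : V) (r : ℝ) (x : ℕ → V) (j : ℕ → ℝ) (n : ℕ) : Prop :=
  x n = v₀ ∧ occupation x j v₀ n ≤ r ∧ r < occupation x j v₀ n + j n

open Classical in
/-- The discount at the crossing index, if it is `n`. -/
def crossingDiscount (v₀ : V) (r : ℝ) (c : V → ℝ) (n : ℕ) (x : ℕ → V) (j : ℕ → ℝ) : ℝ≥0∞ :=
  if CrossesAt v₀ r x j n then ENNReal.ofReal (discount c x j n) else 0

/-- The conditional expectation of the discount at a crossing index not smaller than `n`. -/
def discountedValue (v₀ : V) (r : ℝ) (c φ : V → ℝ) (κ : ℝ) (n : ℕ) (x : ℕ → V) (j : ℕ → ℝ) :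
    ℝ≥0∞ :=
  if occupation x j v₀ n ≤ r then
    ENNReal.ofReal (discount c x j n * φ (x n) *
      Real.exp (-(κ * (r - occupation x j v₀ n)))) else 0

/-- `φ` solves the Dirichlet problem `(1 + c) φ = p φ` off `v₀`, and `φ v₀ = 1`. -/
structure IsDirichletSolution (G : SimpleGraph V) [DecidableRel G.Adj] (v₀ : V) (c φ : V → ℝ) :
    Prop where
  rate_root : c v₀ = 0
  rate_nonneg : ∀ v, 0 ≤ c v
  root : φ v₀ = 1
  nonneg : ∀ v, 0 ≤ φ v
  le_one : ∀ v, φ v ≤ 1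
  eqn : ∀ v, v ≠ v₀ → (1 + c v) * φ v = ∑ w, transitionProb G v w * φ w

lemma occupation_congr {x x' : ℕ → V} {j j' : ℕ → ℝ} {n : ℕ} (hx : ∀ k < n, x k = x' k)
    (hj : ∀ k < n, j k = j' k) (v : V) : occupation x j v n = occupation x' j' v n := by
  refine Finset.sum_congr rfl fun k hk => ?_
  rw [hx k (Finset.mem_range.1 hk), hj k (Finset.mem_range.1 hk)]

lemma discount_congr {x x' : ℕ → V} {j j' : ℕ → ℝ} {n : ℕ} (hx : ∀ k < n, x k = x' k)
    (hj : ∀ k < n, j k = j' k) (c : V → ℝ) : discount c x j n = discount c x' j' n := by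
  unfold discount
  congr 2
  refine Finset.sum_congr rfl fun k hk => ?_
  rw [hx k (Finset.mem_range.1 hk), hj k (Finset.mem_range.1 hk)]

lemma occupation_succ (x : ℕ → V) (j : ℕ → ℝ) (v : V) (n : ℕ) :
    occupation x j v (n + 1) = occupation x j v n + if x n = v then j n else 0 :=
  Finset.sum_range_succ _ _

lemma discount_succ (c : V → ℝ) (x : ℕ → V) (j : ℕ → ℝ) (n : ℕ) :
    discount c x j (n + 1) = discount c x j n * Real.exp (-(c (x n) * j n)) := by
  unfold discount
  rw [Finset.sum_range_succ, neg_add, Real.exp_add]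

lemma discount_pos (c : V → ℝ) (x : ℕ → V) (j : ℕ → ℝ) (n : ℕ) : 0 < discount c x j n :=
  Real.exp_pos _

lemma discount_eq (c : V → ℝ) (x : ℕ → V) (j : ℕ → ℝ) (n : ℕ) :
    discount c x j n = Real.exp (-∑ v, c v * occupation x j v n) := by
  unfold discount occupation
  simp_rw [Finset.mul_sum]
  rw [Finset.sum_comm]
  simp

lemma occupation_mono {x : ℕ → V} {j : ℕ → ℝ} (hj : ∀ k, 0 ≤ j k) (v : V) :
    Monotone (occupation x j v) := by
  refine monotone_nat_of_le_succ fun n => ?_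
  rw [occupation_succ]
  split_ifs
  · linarith [hj n]
  · linarith

lemma occupation_nonneg {x : ℕ → V} {j : ℕ → ℝ} (hj : ∀ k, 0 ≤ j k) (v : V) (n : ℕ) :
    0 ≤ occupation x j v n := by
  have := occupation_mono (x := x) hj v (Nat.zero_le n)
  simpa [occupation] using this

lemma discount_le_one {c : V → ℝ} (hc : ∀ v, 0 ≤ c v) {x : ℕ → V} {j : ℕ → ℝ}
    (hj : ∀ k, 0 ≤ j k) (n : ℕ) : discount c x j n ≤ 1 :=
  Real.exp_le_one_iff.2 (neg_nonpos.2 (Finset.sum_nonneg fun k _ => mul_nonneg (hc _) (hj k)))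

/-- Just after a crossing index the occupation of `v₀` exceeds `r`, and it never decreases. -/
lemma CrossesAt.unique {r : ℝ} {x : ℕ → V} {j : ℕ → ℝ} (hj : ∀ k, 0 ≤ j k) {m n : ℕ}
    (hm : CrossesAt v₀ r x j m) (hn : CrossesAt v₀ r x j n) : m = n := by
  have key : ∀ {m n : ℕ}, CrossesAt v₀ r x j m → CrossesAt v₀ r x j n → ¬ m < n := by
    intro m n hm hn h
    have h1 := occupation_mono (x := x) hj v₀ (Nat.succ_le_of_lt h)
    rw [Nat.succ_eq_add_one, occupation_succ, if_pos hm.1] at h1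
    linarith [hm.2.2, hn.2.1]
  exact le_antisymm (not_lt.1 (key hn hm)) (not_lt.1 (key hm hn))

lemma measurable_occupation (x : ℕ → V) (v : V) (n : ℕ) :
    Measurable fun j => occupation x j v n := by
  refine Finset.measurable_sum _ fun k _ => ?_
  split_ifs
  · exact measurable_pi_apply k
  · exact measurable_const

lemma measurable_discount (c : V → ℝ) (x : ℕ → V) (n : ℕ) :
    Measurable fun j => discount c x j n := by
  unfold discount
  fun_prop

lemma measurable_crossingDiscount (r : ℝ) (c : V → ℝ) (n : ℕ) (x : ℕ → V) :
    Measurable (crossingDiscount v₀ r c n x) := by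
  refine Measurable.ite ?_ (measurable_discount c x n).ennreal_ofReal measurable_const
  have h1 := measurable_occupation x v₀ n
  exact (MeasurableSet.const _).inter ((measurableSet_le h1 measurable_const).inter
    (measurableSet_lt measurable_const (h1.add (measurable_pi_apply n))))

lemma measurable_discountedValue (r : ℝ) (c φ : V → ℝ) (κ : ℝ) (n : ℕ) (x : ℕ → V) :
    Measurable (discountedValue v₀ r c φ κ n x) := by
  have h1 := measurable_occupation x v₀ n
  have h2 := measurable_discount c x n
  refine Measurable.ite (measurableSet_le h1 measurable_const) ?_ measurable_const
  fun_prop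

lemma transitionProb_nonneg (u v : V) : 0 ≤ transitionProb G u v := by
  unfold transitionProb totalConductance conductance
  refine div_nonneg ?_ (Finset.sum_nonneg fun _ _ => ?_) <;> split_ifs <;> norm_num

lemma ae_pos_expMeasure : ∀ᵐ y ∂(expMeasure 1), 0 < y := by
  have : ∫⁻ y, (if 0 < y then 0 else 1) ∂(expMeasure 1) = 0 := by
    rw [lintegral_expMeasure_one _
      (Measurable.ite measurableSet_Ioi measurable_const measurable_const),
      setLIntegral_congr_fun (g := fun _ => 0) measurableSet_Ioi]
    · simp
    · intro y hy
      simp only [Set.mem_Ioi] at hy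
      simp [hy]
  rw [lintegral_eq_zero_iff
    (Measurable.ite measurableSet_Ioi measurable_const measurable_const)] at this
  filter_upwards [this] with y hy
  by_contra h
  simp [h] at hy

/-- The martingale identity behind the Laplace transform. Off the root the holding time contributes
the factor 1/(1+c), which the Dirichlet equation compensates. At the root, κ is the probability that
an excursion is killed, and the identity is the renewal equation `lintegral_renewal_expMeasure`. -/
lemma sum_transitionProb_discountedValue (hp : ∀ v, ∑ w, transitionProb G v w = 1) {c φ : V → ℝ}
    (h : IsDirichletSolution G v₀ c φ) (r : ℝ) (n : ℕ) (x : ℕ → V) (j : ℕ → ℝ) :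
    ∑ w, ENNReal.ofReal (transitionProb G (x n) w) *
      ∫⁻ y, (discountedValue v₀ r c φ (1 - ∑ w, transitionProb G v₀ w * φ w) (n + 1)
          (Function.update x (n + 1) w) (Function.update j n y) +
        crossingDiscount v₀ r c n (Function.update x (n + 1) w) (Function.update j n y))
        ∂(expMeasure 1) =
      discountedValue v₀ r c φ (1 - ∑ w, transitionProb G v₀ w * φ w) n x j := by
  have hE : IsProbabilityMeasure (expMeasure 1) := isProbabilityMeasure_expMeasure one_pos
  set κ := 1 - ∑ w, transitionProb G v₀ w * φ w with hκ
  have hκ1 : κ ≤ 1 := by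
    have : 0 ≤ ∑ w, transitionProb G v₀ w * φ w :=
      Finset.sum_nonneg fun w _ => mul_nonneg (transitionProb_nonneg _ _) (h.nonneg w)
    linarith
  set A := occupation x j v₀ n with hA
  set W := discount c x j n with hW
  have hW0 : 0 ≤ W := (discount_pos _ _ _ _).le
  have hAu : ∀ w y, occupation (Function.update x (n + 1) w) (Function.update j n y) v₀ n = A :=
    fun w y => occupation_congr (n := n) (fun k hk => by rw [Function.update_of_ne]; omega)
      (fun k hk => by rw [Function.update_of_ne]; omega) _
  have hWu : ∀ w y, discount c (Function.update x (n + 1) w) (Function.update j n y) n = W :=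
    fun w y => discount_congr (n := n) (fun k hk => by rw [Function.update_of_ne]; omega)
      (fun k hk => by rw [Function.update_of_ne]; omega) _
  simp only [discountedValue, crossingDiscount, CrossesAt, occupation_succ, discount_succ, hAu, hWu,
    Function.update_self, Function.update_of_ne (Nat.succ_ne_self n).symm]
  rw [← hA, ← hW]
  by_cases hx : x n = v₀
  · simp only [hx, h.rate_root, h.root, if_true, true_and, zero_mul, neg_zero, Real.exp_zero,
      mul_one]
    by_cases hAr : A ≤ r
    · simp only [hAr, true_and, if_true]
      have hb : 0 ≤ r - A := sub_nonneg.2 hAr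
      have e : ∀ w, ∫⁻ y, ((if A + y ≤ r then
          ENNReal.ofReal (W * φ w * Real.exp (-(κ * (r - (A + y))))) else 0) +
          if r < A + y then ENNReal.ofReal W else 0) ∂(expMeasure 1) =
          ENNReal.ofReal W * (ENNReal.ofReal (φ w) *
            ∫⁻ y, (if y ≤ r - A then
              ENNReal.ofReal (Real.exp (-(κ * ((r - A) - y)))) else 0) ∂(expMeasure 1) +
            ENNReal.ofReal (Real.exp (-(r - A)))) := by
        intro w
        have m1 : Measurable fun y : ℝ => if y ≤ r - A then
            ENNReal.ofReal (Real.exp (-(κ * ((r - A) - y)))) else 0 :=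
          Measurable.ite measurableSet_Iic (by fun_prop) measurable_const
        have m2 : Measurable fun y : ℝ => if r - A < y then (1 : ℝ≥0∞) else 0 :=
          Measurable.ite measurableSet_Ioi measurable_const measurable_const
        have m3 : Measurable fun y : ℝ => ENNReal.ofReal (φ w) * (if y ≤ r - A then
            ENNReal.ofReal (Real.exp (-(κ * ((r - A) - y)))) else 0) +
            if r - A < y then (1 : ℝ≥0∞) else 0 := (m1.const_mul _).add m2
        rw [← expMeasure_one_Ioi hb, ← lintegral_const_mul _ m1,
          ← lintegral_add_left (m1.const_mul _), ← lintegral_const_mul _ m3]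
        refine lintegral_congr fun y => ?_
        by_cases hy : y ≤ r - A
        · have h1 : A + y ≤ r := by linarith
          rw [if_pos h1, if_pos hy, if_neg (not_lt.2 h1), if_neg (not_lt.2 hy), add_zero, add_zero,
            mul_assoc W, ENNReal.ofReal_mul hW0, ENNReal.ofReal_mul (h.nonneg w)]
          ring_nf
        · have h1 : ¬ A + y ≤ r := by linarith
          rw [if_neg h1, if_neg hy, if_pos (not_le.1 h1), if_pos (not_le.1 hy)]
          simp
      simp_rw [e, mul_add, mul_left_comm _ (ENNReal.ofReal W), ← mul_assoc (ENNReal.ofReal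
        (transitionProb G _ _)) (ENNReal.ofReal (φ _)), ← ENNReal.ofReal_mul
        (transitionProb_nonneg (G := G) _ _)]
      rw [Finset.sum_add_distrib, ← Finset.mul_sum, ← Finset.mul_sum, ← Finset.sum_mul,
        ← ENNReal.ofReal_sum_of_nonneg fun w _ =>
          mul_nonneg (transitionProb_nonneg _ _) (h.nonneg w),
        ← ENNReal.ofReal_sum_of_nonneg fun w _ =>
          mul_nonneg (transitionProb_nonneg _ _) (Real.exp_pos _).le, ← Finset.sum_mul, hp,
        one_mul, ← mul_add,
        show ∑ w, transitionProb G v₀ w * φ w = 1 - κ by rw [hκ]; ring,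
        lintegral_renewal_expMeasure hb hκ1, ← ENNReal.ofReal_mul hW0]
    -- Beyond the level the value stays zero, because holding times are almost surely positive.
    · simp only [hAr, false_and, if_false, add_zero]
      refine Finset.sum_eq_zero fun w _ => ?_
      rw [lintegral_congr_ae (g := fun _ => 0)]
      · simp
      · filter_upwards [ae_pos_expMeasure] with y hy
        rw [if_neg]
        linarith
  -- Off the root the occupation of `v₀` does not change and no crossing can take place.
  · simp only [hx, if_false, false_and, add_zero]
    split_ifs with hAr
    · have e : ∀ w, ∫⁻ y, ENNReal.ofReal (W * Real.exp (-(c (x n) * y)) * φ w *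
          Real.exp (-(κ * (r - A)))) ∂(expMeasure 1) =
          ENNReal.ofReal (W * φ w * Real.exp (-(κ * (r - A))) * (1 / (1 + c (x n)))) := by
        intro w
        have := h.nonneg w
        rw [ENNReal.ofReal_mul (by positivity), ← lintegral_exp_neg_mul_expMeasure
          (h.rate_nonneg (x n)), ← lintegral_const_mul _ (by fun_prop)]
        refine lintegral_congr fun y => ?_
        rw [← ENNReal.ofReal_mul (by positivity)]
        ring_nf
      simp_rw [e, ← ENNReal.ofReal_mul (transitionProb_nonneg (G := G) _ _)]
      have hc := h.rate_nonneg (x n)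
      rw [← ENNReal.ofReal_sum_of_nonneg fun w _ => by
        have := h.nonneg w
        have := transitionProb_nonneg (G := G) (x n) w
        positivity]
      congr 1
      have := h.eqn (x n) hx
      have h2 : φ (x n) = (∑ w, transitionProb G (x n) w * φ w) * (1 / (1 + c (x n))) := by
        rw [← this]; field_simp
      rw [h2, Finset.sum_mul, Finset.mul_sum, Finset.sum_mul]
      refine Finset.sum_congr rfl fun w _ => ?_
      ring
    · simp

lemma dependsOnly_crossingDiscount (r : ℝ) (c : V → ℝ) (n : ℕ) :
    DependsOnly (crossingDiscount v₀ r c n) (Set.Iic n) := by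
  intro x x' hx
  ext j
  simp only [crossingDiscount, CrossesAt,
    occupation_congr (fun k hk => hx k (Set.mem_Iic.2 (le_of_lt hk))) (fun k _ => rfl),
    discount_congr (fun k hk => hx k (Set.mem_Iic.2 (le_of_lt hk))) (fun k _ => rfl),
    hx n (by simp)]
  congr

lemma dependsOnly_crossingDiscount_right (r : ℝ) (c : V → ℝ) (n : ℕ) (x : ℕ → V) :
    DependsOnly (crossingDiscount v₀ r c n x) (Set.Iic n) := by
  intro j j' hj
  simp only [crossingDiscount, CrossesAt,
    occupation_congr (fun k _ => rfl) (fun k hk => hj k (Set.mem_Iic.2 (le_of_lt hk))),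
    discount_congr (fun k _ => rfl) (fun k hk => hj k (Set.mem_Iic.2 (le_of_lt hk))),
    hj n (by simp)]
  congr

lemma dependsOnly_discountedValue (r : ℝ) (c φ : V → ℝ) (κ : ℝ) (n : ℕ) :
    DependsOnly (discountedValue v₀ r c φ κ n) (Set.Iic n) := by
  intro x x' hx
  ext j
  simp only [discountedValue,
    occupation_congr (fun k hk => hx k (Set.mem_Iic.2 (le_of_lt hk))) (fun k _ => rfl),
    discount_congr (fun k hk => hx k (Set.mem_Iic.2 (le_of_lt hk))) (fun k _ => rfl),
    hx n (by simp)]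

lemma dependsOnly_discountedValue_right (r : ℝ) (c φ : V → ℝ) (κ : ℝ) (n : ℕ) (x : ℕ → V) :
    DependsOnly (discountedValue v₀ r c φ κ (n + 1) x) (Set.Iic n) := by
  intro j j' hj
  simp only [discountedValue,
    occupation_congr (fun k _ => rfl) (fun k hk => hj k (Set.mem_Iic.2 (Nat.le_of_lt_succ hk))),
    discount_congr (fun k _ => rfl) (fun k hk => hj k (Set.mem_Iic.2 (Nat.le_of_lt_succ hk)))]

lemma DependsOnly.mono {α β : Type*} {F : (ℕ → α) → β} {s t : Set ℕ} (h : DependsOnly F s)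
    (hst : s ⊆ t) : DependsOnly F t :=
  fun x x' hx => h x x' fun k hk => hx k (hst hk)

lemma lintegral_discountedValue_succ (hS : IsDiscreteWalk G v₀ S P) (hJ : IsHoldingTimes J P)
    (hSJ : IndepFun (fun ω n => S n ω) (fun ω n => J n ω) P)
    (hp : ∀ v, ∑ w, transitionProb G v w = 1) {c φ : V → ℝ}
    (h : IsDirichletSolution G v₀ c φ) (r : ℝ) (n : ℕ) :
    ∫⁻ ω, discountedValue v₀ r c φ (1 - ∑ w, transitionProb G v₀ w * φ w) n
        (fun n => S n ω) (fun n => J n ω) ∂P =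
      ∫⁻ ω, discountedValue v₀ r c φ (1 - ∑ w, transitionProb G v₀ w * φ w) (n + 1)
        (fun n => S n ω) (fun n => J n ω) ∂P +
      ∫⁻ ω, crossingDiscount v₀ r c n (fun n => S n ω) (fun n => J n ω) ∂P := by
  set κ := 1 - ∑ w, transitionProb G v₀ w * φ w with hκ
  rw [← lintegral_add_left (measurable_comp_of_dependsOnly hS.measurable hJ.measurable
    (fun x => measurable_discountedValue r c φ κ (n + 1) x)
    (dependsOnly_discountedValue r c φ κ (n + 1)))]
  rw [lintegral_one_step hS hJ hSJ n (H := fun x j =>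
    discountedValue v₀ r c φ κ (n + 1) x j + crossingDiscount v₀ r c n x j)]
  · refine lintegral_congr fun ω => ?_
    exact (sum_transitionProb_discountedValue hp h r n _ _).symm
  · exact fun x => (measurable_discountedValue r c φ κ (n + 1) x).add
      (measurable_crossingDiscount r c n x)
  · intro x x' hx
    simp only [dependsOnly_discountedValue r c φ κ (n + 1) x x' hx,
      ((dependsOnly_crossingDiscount r c n).mono (Set.Iic_subset_Iic.2 (Nat.le_succ n))) x x' hx]
  · intro x j j' hj
    simp only [dependsOnly_discountedValue_right r c φ κ n x j j' hj,
      dependsOnly_crossingDiscount_right r c n x j j' hj]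

lemma ae_start (hS : IsDiscreteWalk G v₀ S P) : ∀ᵐ ω ∂P, S 0 ω = v₀ := by
  have h := hS.path_prob 0 (fun _ => v₀)
  have hm : MeasurableSet {ω | S 0 ω = v₀} := hS.measurable 0 (measurableSet_singleton _)
  have : {ω | ∀ k ≤ 0, S k ω = v₀} = {ω | S 0 ω = v₀} := by
    ext ω; simp
  rw [this] at h
  simp only [if_true, Finset.range_zero, Finset.prod_empty] at h
  rw [ae_iff]
  exact (prob_compl_eq_zero_iff hm).2 h

lemma ae_pos_holdingTimes (hJ : IsHoldingTimes J P) : ∀ᵐ ω ∂P, ∀ k, 0 < J k ω := by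
  refine ae_all_iff.2 fun k => ?_
  have h := ae_pos_expMeasure
  rw [← (hJ.law k).map_eq] at h
  exact ae_of_ae_map (hJ.measurable k).aemeasurable h

lemma lintegral_discountedValue_zero (hS : IsDiscreteWalk G v₀ S P) {c φ : V → ℝ}
    (h : IsDirichletSolution G v₀ c φ) {r : ℝ} (hr : 0 ≤ r) (κ : ℝ) :
    ∫⁻ ω, discountedValue v₀ r c φ κ 0 (fun n => S n ω) (fun n => J n ω) ∂P =
      ENNReal.ofReal (Real.exp (-(κ * r))) := by
  rw [lintegral_congr_ae (g := fun _ => ENNReal.ofReal (Real.exp (-(κ * r))))]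
  · simp
  · filter_upwards [ae_start hS] with ω hω
    simp [discountedValue, occupation, discount, hr, hω, h.root]

/-- Telescoping: the amounts paid at crossings before `n` plus the value still carried at `n` add up
to the initial value exp(-κr). `hlim` says that nothing escapes as n tends to infinity. -/
lemma tsum_lintegral_crossingDiscount (hS : IsDiscreteWalk G v₀ S P) (hJ : IsHoldingTimes J P)
    (hSJ : IndepFun (fun ω n => S n ω) (fun ω n => J n ω) P)
    (hp : ∀ v, ∑ w, transitionProb G v w = 1) {c φ : V → ℝ}
    (h : IsDirichletSolution G v₀ c φ) {r : ℝ} (hr : 0 ≤ r)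
    (hlim : Filter.Tendsto (fun n => ∫⁻ ω,
      discountedValue v₀ r c φ (1 - ∑ w, transitionProb G v₀ w * φ w) n
        (fun n => S n ω) (fun n => J n ω) ∂P) Filter.atTop (nhds 0)) :
    ∑' n, ∫⁻ ω, crossingDiscount v₀ r c n (fun n => S n ω) (fun n => J n ω) ∂P =
      ENNReal.ofReal (Real.exp (-((1 - ∑ w, transitionProb G v₀ w * φ w) * r))) := by
  set κ := 1 - ∑ w, transitionProb G v₀ w * φ w with hκ
  have hsum : ∀ n, ∫⁻ ω, discountedValue v₀ r c φ κ n (fun n => S n ω) (fun n => J n ω) ∂P +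
      ∑ k ∈ Finset.range n,
        ∫⁻ ω, crossingDiscount v₀ r c k (fun n => S n ω) (fun n => J n ω) ∂P =
      ENNReal.ofReal (Real.exp (-(κ * r))) := by
    intro n
    induction n with
    | zero => simpa using lintegral_discountedValue_zero hS h hr κ
    | succ n ih =>
      rw [Finset.sum_range_succ, add_comm (∑ k ∈ Finset.range n, _), ← add_assoc,
        ← lintegral_discountedValue_succ hS hJ hSJ hp h r n, ih]
  have h1 := hlim.add (ENNReal.tendsto_nat_tsum fun n =>
    ∫⁻ ω, crossingDiscount v₀ r c n (fun n => S n ω) (fun n => J n ω) ∂P)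
  simp only [hsum, zero_add] at h1
  exact tendsto_nhds_unique h1 tendsto_const_nhds

end

/-! ### Almost sure crossing of every level, and the Laplace transform at the crossing. -/

section

variable {V Ω : Type*} [Fintype V] [DecidableEq V] [MeasurableSpace V]
  [MeasurableSingletonClass V] [MeasurableSpace Ω] {G : SimpleGraph V} [DecidableRel G.Adj]
  {v₀ : V} {P : Measure Ω} [IsProbabilityMeasure P] {S : ℕ → Ω → V} {J : ℕ → Ω → ℝ}

/-- Each holding time at a vertex with rate c contributes an independent factor with mean 1/(1+c) ≤
1/(1+m). -/
lemma lintegral_discount_le (hS : IsDiscreteWalk G v₀ S P) (hJ : IsHoldingTimes J P)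
    (hSJ : IndepFun (fun ω n => S n ω) (fun ω n => J n ω) P) {c : V → ℝ} {m : ℝ} (hm : 0 < m)
    (hc : ∀ v, m ≤ c v) (n : ℕ) :
    ∫⁻ ω, ENNReal.ofReal (discount c (fun n => S n ω) (fun n => J n ω) n) ∂P ≤
      ENNReal.ofReal (1 / (1 + m)) ^ n := by
  induction n with
  | zero => simp [discount]
  | succ n ih =>
    rw [lintegral_update_holdingTime hS hJ hSJ n
      (F := fun x j => ENNReal.ofReal (discount c x j (n + 1)))
      (fun x => (measurable_discount c x (n + 1)).ennreal_ofReal)]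
    · have e : ∀ ω, ∫⁻ y, ENNReal.ofReal (discount c (fun n => S n ω)
          (Function.update (fun n => J n ω) n y) (n + 1)) ∂(expMeasure 1) ≤
          ENNReal.ofReal (1 / (1 + m)) *
            ENNReal.ofReal (discount c (fun n => S n ω) (fun n => J n ω) n) := by
        intro ω
        have h0 : 0 ≤ c (S n ω) := hm.le.trans (hc _)
        have e1 : ∀ y, ENNReal.ofReal (discount c (fun n => S n ω)
            (Function.update (fun n => J n ω) n y) (n + 1)) =
            ENNReal.ofReal (discount c (fun n => S n ω) (fun n => J n ω) n) *
              ENNReal.ofReal (Real.exp (-(c (S n ω) * y))) := by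
          intro y
          rw [discount_succ, ENNReal.ofReal_mul (discount_pos _ _ _ _).le, Function.update_self,
            discount_congr (n := n) (fun _ _ => rfl)
              (fun k hk => by rw [Function.update_of_ne]; omega)]
        simp_rw [e1]
        rw [lintegral_const_mul _ (by fun_prop), lintegral_exp_neg_mul_expMeasure h0, mul_comm]
        gcongr
        exact hc _
      refine (lintegral_mono e).trans ?_
      rw [lintegral_const_mul, pow_succ']
      · gcongr
      · refine measurable_comp_of_dependsOnly hS.measurable hJ.measurable (n := n)
          (F := fun x j => ENNReal.ofReal (discount c x j n))
          (fun x => (measurable_discount c x n).ennreal_ofReal) ?_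
        intro x x' hx
        ext j
        exact congrArg _ (discount_congr (n := n) (fun k hk => hx k (Set.mem_Iic.2 (le_of_lt hk)))
          (fun k _ => rfl) c)
    · intro x x' hx
      ext j
      exact congrArg _ (discount_congr (n := n + 1)
        (fun k hk => hx k (Set.mem_Iic.2 (Nat.le_of_lt_succ hk))) (fun k _ => rfl) c)
    · intro x j j' hj
      exact congrArg _ (discount_congr (n := n + 1) (fun k _ => rfl)
        (fun k hk => hj k (Set.mem_Iic.2 (Nat.le_of_lt_succ hk))) c)

lemma IsDirichletSolution.exponent_nonneg (hp : ∀ v, ∑ w, transitionProb G v w = 1) {c φ : V → ℝ}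
    (h : IsDirichletSolution G v₀ c φ) : 0 ≤ 1 - ∑ w, transitionProb G v₀ w * φ w := by
  rw [sub_nonneg, ← hp v₀]
  exact Finset.sum_le_sum fun w _ =>
    mul_le_of_le_one_right (transitionProb_nonneg _ _) (h.le_one w)

/-- Time off the root is discounted, and time at the root is at most `r` while the value is nonzero.
No recurrence is needed here; it will be deduced from this case. -/
lemma tendsto_discountedValue_of_pos (hS : IsDiscreteWalk G v₀ S P) (hJ : IsHoldingTimes J P)
    (hSJ : IndepFun (fun ω n => S n ω) (fun ω n => J n ω) P)
    {c φ : V → ℝ} (h : IsDirichletSolution G v₀ c φ) (hc : ∀ v, v ≠ v₀ → 0 < c v) (r : ℝ) {κ : ℝ}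
    (hκ : 0 ≤ κ) :
    Filter.Tendsto (fun n => ∫⁻ ω, discountedValue v₀ r c φ κ n
      (fun n => S n ω) (fun n => J n ω) ∂P) Filter.atTop (nhds 0) := by
  -- An artificial rate 1 at the root bounds all rates below. It costs at most a factor exp(r),
  -- because the occupation of the root is at most `r`.
  set c' := Function.update c v₀ 1 with hc'
  have hpos : ∀ v, 0 < c' v := by
    intro v
    by_cases hv : v = v₀
    · subst hv; simp [hc']
    · rw [hc', Function.update_of_ne hv]; exact hc v hv
  obtain ⟨v₁, -, hv₁⟩ := Finset.exists_min_image Finset.univ c' ⟨v₀, Finset.mem_univ _⟩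
  have hm := hpos v₁
  have hle : ∀ n x j, discountedValue v₀ r c φ κ n x j ≤
      ENNReal.ofReal (Real.exp r) * ENNReal.ofReal (discount c' x j n) := by
    intro n x j
    unfold discountedValue
    split_ifs with hA
    · rw [← ENNReal.ofReal_mul (Real.exp_pos _).le]
      refine ENNReal.ofReal_le_ofReal ?_
      have e : discount c' x j n = discount c x j n * Real.exp (-occupation x j v₀ n) := by
        rw [discount_eq, discount_eq, ← Real.exp_add, ← Finset.add_sum_erase _ _
          (Finset.mem_univ v₀), ← Finset.add_sum_erase _ (fun v => c v * _) (Finset.mem_univ v₀)]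
        congr 1
        rw [Finset.sum_congr rfl fun v hv => by
          rw [hc', Function.update_of_ne (Finset.ne_of_mem_erase hv)]]
        simp [hc', h.rate_root]
      rw [e]
      have h1 : Real.exp (-(κ * (r - occupation x j v₀ n))) ≤ 1 :=
        Real.exp_le_one_iff.2 (neg_nonpos.2 (mul_nonneg hκ (by linarith)))
      have h2 : 1 ≤ Real.exp r * Real.exp (-occupation x j v₀ n) := by
        rw [← Real.exp_add]; exact Real.one_le_exp (by linarith)
      have h3 := (discount_pos c x j n).le
      calc discount c x j n * φ (x n) * Real.exp (-(κ * (r - occupation x j v₀ n)))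
          ≤ discount c x j n * 1 * 1 := by
            gcongr
            exact h.le_one _
        _ ≤ discount c x j n * (Real.exp r * Real.exp (-occupation x j v₀ n)) := by
            rw [mul_one]
            gcongr
        _ = _ := by ring
    · exact zero_le
  have hb : ∀ n, ∫⁻ ω, discountedValue v₀ r c φ κ n (fun n => S n ω) (fun n => J n ω) ∂P ≤
      ENNReal.ofReal (Real.exp r) * ENNReal.ofReal (1 / (1 + c' v₁)) ^ n := by
    intro n
    refine (lintegral_mono fun ω => hle n _ _).trans ?_
    rw [lintegral_const_mul' _ _ ENNReal.ofReal_ne_top]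
    gcongr
    exact lintegral_discount_le hS hJ hSJ hm (fun v => hv₁ v (Finset.mem_univ _)) n
  refine tendsto_of_tendsto_of_tendsto_of_le_of_le tendsto_const_nhds ?_ (fun _ => zero_le) hb
  rw [← mul_zero (ENNReal.ofReal (Real.exp r))]
  refine ENNReal.Tendsto.const_mul (ENNReal.tendsto_pow_atTop_nhds_zero_of_lt_one ?_)
    (Or.inr ENNReal.ofReal_ne_top)
  rw [← ENNReal.ofReal_one, ENNReal.ofReal_lt_ofReal_iff one_pos]
  rw [div_lt_one (by linarith)]
  linarith

lemma measurableSet_crossesAt (hS : ∀ n, Measurable (S n)) (hJ : ∀ n, Measurable (J n)) (r : ℝ)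
    (n : ℕ) : MeasurableSet {ω | CrossesAt v₀ r (fun n => S n ω) (fun n => J n ω) n} := by
  have ho : Measurable fun ω => occupation (fun n => S n ω) (fun n => J n ω) v₀ n := by
    refine Finset.measurable_sum _ fun k _ => ?_
    exact Measurable.ite (hS k (measurableSet_singleton _)) (hJ k) measurable_const
  exact (hS n (measurableSet_singleton v₀)).inter ((measurableSet_le ho measurable_const).inter
    (measurableSet_lt measurable_const (ho.add (hJ n))))

-- At most one index is a crossing, and discounts at nonnegative rates are at most 1.
open Classical in
lemma tsum_crossingDiscount_le {r : ℝ} {c : V → ℝ} (hc : ∀ v, 0 ≤ c v) {x : ℕ → V} {j : ℕ → ℝ}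
    (hj : ∀ k, 0 ≤ j k) :
    ∑' n, crossingDiscount v₀ r c n x j ≤ if ∃ n, CrossesAt v₀ r x j n then 1 else 0 := by
  split_ifs with h
  · obtain ⟨n, hn⟩ := h
    rw [tsum_eq_single n]
    · simp only [crossingDiscount, hn, if_true]
      exact ENNReal.ofReal_le_one.2 (discount_le_one hc hj n)
    · intro m hm
      have : ¬ CrossesAt v₀ r x j m := fun h => hm (h.unique hj hn)
      simp [crossingDiscount, this]
  · push Not at h
    simp [crossingDiscount, h]

/-- If the walk can be killed at arbitrarily small cost, it almost surely spends more time at its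
starting point than any given bound. -/
lemma ae_exists_crossesAt (hS : IsDiscreteWalk G v₀ S P) (hJ : IsHoldingTimes J P)
    (hSJ : IndepFun (fun ω n => S n ω) (fun ω n => J n ω) P)
    (hp : ∀ v, ∑ w, transitionProb G v w = 1)
    (hrec : ∀ δ > 0, ∃ c φ : V → ℝ, IsDirichletSolution G v₀ c φ ∧ (∀ v, v ≠ v₀ → 0 < c v) ∧
      ∀ v, 1 - δ ≤ φ v) {r : ℝ} (hr : 0 ≤ r) :
    ∀ᵐ ω ∂P, ∃ n, CrossesAt v₀ r (fun n => S n ω) (fun n => J n ω) n := by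
  have hmeas : MeasurableSet {ω | ∃ n, CrossesAt v₀ r (fun n => S n ω) (fun n => J n ω) n} := by
    rw [Set.ofPred_exists]
    exact MeasurableSet.iUnion fun n => measurableSet_crossesAt hS.measurable hJ.measurable r n
  rw [ae_iff]
  refine (prob_compl_eq_zero_iff hmeas).2 (le_antisymm prob_le_one ?_)
  -- Discounts are paid only at a crossing, so the Laplace transform is a lower bound for the
  -- crossing probability; with weak killing the bound tends to 1.
  have key : ∀ δ > 0, ENNReal.ofReal (Real.exp (-(δ * r))) ≤
      P {ω | ∃ n, CrossesAt v₀ r (fun n => S n ω) (fun n => J n ω) n} := by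
    intro δ hδ
    obtain ⟨c, φ, h, hc, hφ⟩ := hrec δ hδ
    have h1 := tsum_lintegral_crossingDiscount hS hJ hSJ hp h hr
      (tendsto_discountedValue_of_pos hS hJ hSJ h hc r (h.exponent_nonneg hp))
    have hκ : 1 - ∑ w, transitionProb G v₀ w * φ w ≤ δ := by
      have : ∑ w, transitionProb G v₀ w * (1 - δ) ≤ ∑ w, transitionProb G v₀ w * φ w :=
        Finset.sum_le_sum fun w _ => mul_le_mul_of_nonneg_left (hφ w) (transitionProb_nonneg _ _)
      rw [← Finset.sum_mul, hp] at this
      linarith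
    calc ENNReal.ofReal (Real.exp (-(δ * r)))
        ≤ ENNReal.ofReal (Real.exp (-((1 - ∑ w, transitionProb G v₀ w * φ w) * r))) := by gcongr
      _ = _ := h1.symm
      _ = ∫⁻ ω, ∑' n, crossingDiscount v₀ r c n (fun n => S n ω) (fun n => J n ω) ∂P := by
        rw [lintegral_tsum]
        exact fun n => (measurable_comp_of_dependsOnly hS.measurable hJ.measurable
          (fun x => measurable_crossingDiscount r c n x)
          (dependsOnly_crossingDiscount r c n)).aemeasurable
      _ ≤ ∫⁻ ω, {ω | ∃ n, CrossesAt v₀ r (fun n => S n ω) (fun n => J n ω) n}.indicator 1 ω ∂P := by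
        refine lintegral_mono_ae ?_
        filter_upwards [ae_pos_holdingTimes hJ] with ω hω
        refine (tsum_crossingDiscount_le h.rate_nonneg fun k => (hω k).le).trans_eq ?_
        simp [Set.indicator]
      _ = _ := lintegral_indicator_one hmeas
  have hlim : Filter.Tendsto (fun δ : ℝ => ENNReal.ofReal (Real.exp (-(δ * r))))
      (nhdsWithin 0 (Set.Ioi 0)) (nhds (ENNReal.ofReal (Real.exp (-(0 * r))))) := by
    refine Filter.Tendsto.mono_left (Continuous.tendsto ?_ 0) nhdsWithin_le_nhds
    exact ENNReal.continuous_ofReal.comp (by fun_prop)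
  simp only [zero_mul, neg_zero, Real.exp_zero, ENNReal.ofReal_one] at hlim
  exact le_of_tendsto hlim (Filter.eventually_of_mem self_mem_nhdsWithin fun δ hδ => key δ hδ)

/-- The Laplace transform of the occupation times at the crossing. -/
theorem lintegral_tsum_crossingDiscount (hS : IsDiscreteWalk G v₀ S P) (hJ : IsHoldingTimes J P)
    (hSJ : IndepFun (fun ω n => S n ω) (fun ω n => J n ω) P)
    (hp : ∀ v, ∑ w, transitionProb G v w = 1) {r : ℝ} (hr : 0 ≤ r)
    (hcross : ∀ᵐ ω ∂P, ∃ n, CrossesAt v₀ r (fun n => S n ω) (fun n => J n ω) n)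
    {c φ : V → ℝ} (h : IsDirichletSolution G v₀ c φ) :
    ∫⁻ ω, ∑' n, crossingDiscount v₀ r c n (fun n => S n ω) (fun n => J n ω) ∂P =
      ENNReal.ofReal (Real.exp (-((1 - ∑ w, transitionProb G v₀ w * φ w) * r))) := by
  have hκ := h.exponent_nonneg hp
  rw [lintegral_tsum fun n => (measurable_comp_of_dependsOnly hS.measurable hJ.measurable
    (fun x => measurable_crossingDiscount r c n x)
    (dependsOnly_crossingDiscount r c n)).aemeasurable]
  refine tsum_lintegral_crossingDiscount hS hJ hSJ hp h hr ?_
  set κ := 1 - ∑ w, transitionProb G v₀ w * φ w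
  -- Rates may vanish here; instead, almost sure crossing is used, since after the crossing index
  -- the occupation exceeds `r` and the value is zero.
  rw [show (0 : ℝ≥0∞) = ∫⁻ ω, 0 ∂P by simp]
  refine tendsto_lintegral_of_dominated_convergence (fun _ => 1)
    (fun n => measurable_comp_of_dependsOnly hS.measurable hJ.measurable
      (fun x => measurable_discountedValue r c φ κ n x)
      (dependsOnly_discountedValue r c φ κ n)) (fun n => ?_) (by simp) ?_
  · filter_upwards [ae_pos_holdingTimes hJ] with ω hω
    unfold discountedValue
    split_ifs with hA
    · refine ENNReal.ofReal_le_one.2 (mul_le_one₀ (mul_le_one₀ (discount_le_one h.rate_nonneg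
        (fun k => (hω k).le) n) (h.nonneg _) (h.le_one _)) (Real.exp_pos _).le ?_)
      exact Real.exp_le_one_iff.2 (neg_nonpos.2 (mul_nonneg hκ (by linarith)))
    · exact zero_le
  · filter_upwards [ae_pos_holdingTimes hJ, hcross] with ω hω ⟨m, hm⟩
    refine tendsto_const_nhds.congr' ?_
    filter_upwards [Filter.eventually_gt_atTop m] with n hn
    unfold discountedValue
    rw [if_neg]
    have h1 := occupation_mono (x := fun n => S n ω) (fun k => (hω k).le) v₀ (Nat.succ_le_of_lt hn)
    rw [Nat.succ_eq_add_one, occupation_succ, if_pos hm.1] at h1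
    linarith [hm.2.2]

end

/-! ### From occupation times at the crossing to local times at the inverse local time. -/

section

variable {V Ω : Type*} [Fintype V] [DecidableEq V] [MeasurableSpace V]
  [MeasurableSingletonClass V] [MeasurableSpace Ω] {G : SimpleGraph V} [DecidableRel G.Adj]
  {v₀ : V} {P : Measure Ω} [IsProbabilityMeasure P] {S : ℕ → Ω → V} {J : ℕ → Ω → ℝ}

lemma jumpTime_succ (n : ℕ) (ω : Ω) : jumpTime J (n + 1) ω = jumpTime J n ω + J n ω :=
  Finset.sum_range_succ _ _

lemma intervalIntegral_indicator_jump {X : ℝ → Ω → V} {ω : Ω} {n : ℕ}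
    (hX : ∀ s, jumpTime J n ω ≤ s → s < jumpTime J (n + 1) ω → X s ω = S n ω) (v : V) {s : ℝ}
    (hs : jumpTime J n ω ≤ s) (hs' : s ≤ jumpTime J (n + 1) ω) :
    IntervalIntegrable (Set.indicator {r | X r ω = v} fun _ => (1 : ℝ)) volume
        (jumpTime J n ω) s ∧
      ∫ r in (jumpTime J n ω)..s, Set.indicator {r | X r ω = v} (fun _ => (1 : ℝ)) r =
        if S n ω = v then s - jumpTime J n ω else 0 := by
  have h : (Set.Ioo (jumpTime J n ω) s).EqOn (Set.indicator {r | X r ω = v} fun _ => (1 : ℝ))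
      fun _ => if S n ω = v then 1 else 0 := by
    intro r hr
    have := hX r hr.1.le (hr.2.trans_le hs')
    simp [Set.indicator, this]
  constructor
  · refine (intervalIntegrable_const (c := if S n ω = v then (1 : ℝ) else 0)).congr_uIoo ?_
    rw [Set.uIoo_of_le hs]
    exact h.symm
  · rw [intervalIntegral.integral_congr_Ioo_of_le hs h]
    split_ifs <;> simp

lemma integral_indicator_jumpTime {X : ℝ → Ω → V} {ω : Ω}
    (hX : ∀ (n : ℕ) (s : ℝ), jumpTime J n ω ≤ s → s < jumpTime J (n + 1) ω → X s ω = S n ω)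
    (hJ : ∀ k, 0 < J k ω) (v : V) (n : ℕ) :
    IntervalIntegrable (Set.indicator {r | X r ω = v} fun _ => (1 : ℝ)) volume
        0 (jumpTime J n ω) ∧
      ∫ r in (0 : ℝ)..(jumpTime J n ω), Set.indicator {r | X r ω = v} (fun _ => (1 : ℝ)) r =
        occupation (fun n => S n ω) (fun n => J n ω) v n := by
  induction n with
  | zero => simp [jumpTime, occupation]
  | succ n ih =>
    have hle : jumpTime J n ω ≤ jumpTime J (n + 1) ω := by
      rw [jumpTime_succ]; linarith [hJ n]
    have h := intervalIntegral_indicator_jump (hX n) v hle le_rfl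
    refine ⟨ih.1.trans h.1, ?_⟩
    rw [← intervalIntegral.integral_add_adjacent_intervals ih.1 h.1, ih.2, h.2, occupation_succ,
      jumpTime_succ]
    simp

lemma integral_indicator_of_mem_Icc {X : ℝ → Ω → V} {ω : Ω}
    (hX : ∀ (n : ℕ) (s : ℝ), jumpTime J n ω ≤ s → s < jumpTime J (n + 1) ω → X s ω = S n ω)
    (hJ : ∀ k, 0 < J k ω) (v : V) (n : ℕ) {s : ℝ}
    (hs : jumpTime J n ω ≤ s) (hs' : s ≤ jumpTime J (n + 1) ω) :
    IntervalIntegrable (Set.indicator {r | X r ω = v} fun _ => (1 : ℝ)) volume 0 s ∧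
      ∫ r in (0 : ℝ)..s, Set.indicator {r | X r ω = v} (fun _ => (1 : ℝ)) r =
        occupation (fun n => S n ω) (fun n => J n ω) v n +
          if S n ω = v then s - jumpTime J n ω else 0 := by
  have h := intervalIntegral_indicator_jump (hX n) v hs hs'
  have ih := integral_indicator_jumpTime hX hJ v n
  refine ⟨ih.1.trans h.1, ?_⟩
  rw [← intervalIntegral.integral_add_adjacent_intervals ih.1 h.1, ih.2, h.2]

/-- The inverse local time and the local times there, read off the crossing of level `t d_{v₀}`. -/
lemma localTime_inverseLocalTime_of_crossesAt {X : ℝ → Ω → V} {ω : Ω}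
    (hX : ∀ (n : ℕ) (s : ℝ), jumpTime J n ω ≤ s → s < jumpTime J (n + 1) ω → X s ω = S n ω)
    (hJ : ∀ k, 0 < J k ω) (hd : 0 < totalConductance G v₀) {t : ℝ} {N : ℕ}
    (hN : CrossesAt v₀ (t * totalConductance G v₀) (fun n => S n ω) (fun n => J n ω) N) (v : V) :
    localTime G X v (inverseLocalTime G X v₀ t ω) ω =
      if v = v₀ then t else
        1 / totalConductance G v * occupation (fun n => S n ω) (fun n => J n ω) v N := by
  set d := totalConductance G v₀ with hd'
  obtain ⟨hN1, hN2, hN3⟩ := hN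
  simp only at hN1 hN2 hN3
  set A := occupation (fun n => S n ω) (fun n => J n ω) v₀ N with hA
  -- The instant inside the holding interval `N` at which the time at `v₀` equals `t * d`. Local
  -- time at `v₀` grows strictly right after it, so it is the infimum defining the inverse local
  -- time.
  set s₀ := jumpTime J N ω + (t * d - A) with hs₀
  have hs1 : jumpTime J N ω ≤ s₀ := by linarith
  have hs2 : s₀ < jumpTime J (N + 1) ω := by rw [jumpTime_succ]; linarith
  have hT : 0 ≤ jumpTime J N ω := Finset.sum_nonneg fun k _ => (hJ k).le
  have hloc : ∀ s, jumpTime J N ω ≤ s → s ≤ jumpTime J (N + 1) ω →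
      localTime G X v₀ s ω = t + (s - s₀) / d := by
    intro s h1 h2
    unfold localTime
    rw [(integral_indicator_of_mem_Icc hX hJ v₀ N h1 h2).2, if_pos hN1, ← hA, ← hd']
    field_simp
    rw [hs₀]
    ring
  have hτ : inverseLocalTime G X v₀ t ω = s₀ := by
    refine IsGLB.csInf_eq ⟨fun s hs => ?_, fun b hb => ?_⟩ ?_
    · by_contra hlt
      push Not at hlt
      have hle : localTime G X v₀ s ω ≤ localTime G X v₀ s₀ ω := by
        unfold localTime
        refine mul_le_mul_of_nonneg_left (intervalIntegral.integral_mono_interval le_rfl hs.1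
          hlt.le ?_ (integral_indicator_of_mem_Icc hX hJ v₀ N hs1 hs2.le).1) (by positivity)
        exact Filter.Eventually.of_forall fun r => Set.indicator_nonneg (fun _ _ => zero_le_one) r
      rw [hloc s₀ hs1 hs2.le] at hle
      have := hs.2
      simp at hle
      linarith
    · refine le_of_forall_gt_imp_ge_of_dense fun s hs => ?_
      rcases le_total s (jumpTime J (N + 1) ω) with h | h
      · refine hb ⟨by linarith, ?_⟩
        rw [hloc s (by linarith) h]
        have : 0 < (s - s₀) / d := div_pos (by linarith) hd
        linarith
      · refine le_trans (hb ⟨by linarith, ?_⟩) h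
        rw [hloc _ (by linarith) le_rfl]
        have : 0 < (jumpTime J (N + 1) ω - s₀) / d := div_pos (by linarith) hd
        linarith
    · refine ⟨jumpTime J (N + 1) ω, by linarith, ?_⟩
      rw [hloc _ (by linarith) le_rfl]
      have : 0 < (jumpTime J (N + 1) ω - s₀) / d := div_pos (by linarith) hd
      linarith
  rw [hτ]
  split_ifs with hv
  · rw [hv, hloc s₀ hs1 hs2.le]; simp
  · unfold localTime
    rw [(integral_indicator_of_mem_Icc hX hJ v N hs1 hs2.le).2, if_neg, add_zero]
    rw [hN1]; exact fun h => hv h.symm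

open Classical in
/-- A measurable version of the local times at the inverse local time. -/
def localField (G : SimpleGraph V) [DecidableRel G.Adj] (v₀ : V) (S : ℕ → Ω → V) (J : ℕ → Ω → ℝ)
    (t : ℝ) (ω : Ω) (v : V) : ℝ :=
  if v = v₀ then t else
    -- At most one term is nonzero when the holding times are nonnegative; a sum in `ℝ≥0∞` is
    -- measurable without any selection of the crossing index.
    (∑' n, if CrossesAt v₀ (t * totalConductance G v₀) (fun n => S n ω) (fun n => J n ω) n then
      ENNReal.ofReal
        (1 / totalConductance G v * occupation (fun n => S n ω) (fun n => J n ω) v n)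
      else 0).toReal

lemma measurable_localField (hS : ∀ n, Measurable (S n)) (hJ : ∀ n, Measurable (J n)) (t : ℝ) :
    Measurable (localField G v₀ S J t) := by
  refine measurable_pi_lambda _ fun v => ?_
  unfold localField
  split_ifs
  · exact measurable_const
  · refine Measurable.ennreal_toReal (Measurable.tsum fun n => ?_)
    refine Measurable.ite (measurableSet_crossesAt hS hJ _ n) ?_ measurable_const
    refine (Measurable.const_mul ?_ _).ennreal_ofReal
    refine Finset.measurable_sum _ fun k _ => ?_
    exact Measurable.ite (hS k (measurableSet_singleton _)) (hJ k) measurable_const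

lemma totalConductance_nonneg (v : V) : 0 ≤ totalConductance G v := by
  unfold totalConductance conductance
  exact Finset.sum_nonneg fun _ _ => by split_ifs <;> norm_num

lemma localField_of_crossesAt {ω : Ω} (hJ : ∀ k, 0 ≤ J k ω) {t : ℝ} {N : ℕ}
    (hN : CrossesAt v₀ (t * totalConductance G v₀) (fun n => S n ω) (fun n => J n ω) N) (v : V) :
    localField G v₀ S J t ω v = if v = v₀ then t else
      1 / totalConductance G v * occupation (fun n => S n ω) (fun n => J n ω) v N := by
  unfold localField
  split_ifs with hv
  · rfl
  · rw [tsum_eq_single N, if_pos hN, ENNReal.toReal_ofReal]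
    · exact mul_nonneg (one_div_nonneg.2 (totalConductance_nonneg v)) (occupation_nonneg hJ v N)
    · intro m hm
      rw [if_neg fun h => hm (h.unique hJ hN)]

lemma localField_nonneg {t : ℝ} (ht : 0 ≤ t) (ω : Ω) (v : V) : 0 ≤ localField G v₀ S J t ω v := by
  unfold localField
  split_ifs
  · exact ht
  · exact ENNReal.toReal_nonneg

lemma sum_transitionProb {v : V} (hd : 0 < totalConductance G v) :
    ∑ w, transitionProb G v w = 1 := by
  unfold transitionProb
  rw [← Finset.sum_div]
  exact div_self hd.ne'

/-- The Laplace transform of the local times at the inverse local time. -/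
theorem lintegral_exp_localField (hS : IsDiscreteWalk G v₀ S P) (hJ : IsHoldingTimes J P)
    (hSJ : IndepFun (fun ω n => S n ω) (fun ω n => J n ω) P)
    (hd : ∀ v, 0 < totalConductance G v) {t : ℝ} (ht : 0 ≤ t)
    (hcross : ∀ᵐ ω ∂P, ∃ n, CrossesAt v₀ (t * totalConductance G v₀)
      (fun n => S n ω) (fun n => J n ω) n)
    {l φ : V → ℝ} (hl : ∀ v, 0 ≤ l v) (hφ0 : φ v₀ = 1) (hφn : ∀ v, 0 ≤ φ v) (hφ1 : ∀ v, φ v ≤ 1)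
    (hφ : ∀ v, v ≠ v₀ → (totalConductance G v + l v) * φ v = ∑ w, conductance G v w * φ w) :
    ∫⁻ ω, ENNReal.ofReal (Real.exp (-∑ v, l v * localField G v₀ S J t ω v)) ∂P =
      ENNReal.ofReal (Real.exp (-(t * (l v₀ + ∑ w, conductance G v₀ w * (1 - φ w))))) := by
  -- The rates `c` act on occupation times, which are the degrees times the local times. The root
  -- receives rate 0: its local time is exactly `t`, and it contributes the separate factor
  -- exp(-l(v₀) t).
  set c : V → ℝ := fun v => if v = v₀ then 0 else l v / totalConductance G v with hc
  have hsol : IsDirichletSolution G v₀ c φ := by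
    refine ⟨by simp [hc], fun v => ?_, hφ0, hφn, hφ1, fun v hv => ?_⟩
    · simp only [hc]
      split_ifs
      · exact le_rfl
      · exact div_nonneg (hl v) (hd v).le
    · have := hd v
      simp only [hc, hv, if_false, transitionProb]
      simp_rw [div_mul_eq_mul_div]
      rw [← Finset.sum_div, ← hφ v hv]
      field_simp
  have hd0 := hd v₀
  have key := lintegral_tsum_crossingDiscount hS hJ hSJ (fun v => sum_transitionProb (hd v))
    (r := t * totalConductance G v₀) (by positivity) hcross hsol
  have hae : ∀ᵐ ω ∂P, ENNReal.ofReal (Real.exp (-∑ v, l v * localField G v₀ S J t ω v)) =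
      ENNReal.ofReal (Real.exp (-(l v₀ * t))) * ∑' n, crossingDiscount v₀
        (t * totalConductance G v₀) c n (fun n => S n ω) (fun n => J n ω) := by
    filter_upwards [hcross, ae_pos_holdingTimes hJ] with ω ⟨N, hN⟩ hω
    have hω' : ∀ k, 0 ≤ J k ω := fun k => (hω k).le
    rw [tsum_eq_single N]
    · unfold crossingDiscount
      rw [if_pos hN, ← ENNReal.ofReal_mul (Real.exp_pos _).le, discount_eq, ← Real.exp_add]
      congr 2
      rw [← neg_add]
      congr 1
      rw [← Finset.add_sum_erase _ _ (Finset.mem_univ v₀),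
        ← Finset.add_sum_erase _ (fun v => c v * _) (Finset.mem_univ v₀),
        localField_of_crossesAt hω' hN]
      simp only [if_true, hc, zero_mul, zero_add]
      congr 1
      refine Finset.sum_congr rfl fun v hv => ?_
      have hv' := Finset.ne_of_mem_erase hv
      rw [localField_of_crossesAt hω' hN, if_neg hv', if_neg hv']
      ring
    · intro m hm
      unfold crossingDiscount
      rw [if_neg fun h => hm (h.unique hω' hN)]
  rw [lintegral_congr_ae hae, lintegral_const_mul' _ _ ENNReal.ofReal_ne_top, key,
    ← ENNReal.ofReal_mul (Real.exp_pos _).le, ← Real.exp_add]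
  congr 2
  have h1 : ∑ w, conductance G v₀ w * (1 - φ w) =
      (1 - ∑ w, transitionProb G v₀ w * φ w) * totalConductance G v₀ := by
    unfold transitionProb
    simp_rw [div_mul_eq_mul_div]
    rw [← Finset.sum_div, sub_mul, div_mul_cancel₀ _ hd0.ne', one_mul, totalConductance,
      ← Finset.sum_sub_distrib]
    exact Finset.sum_congr rfl fun _ _ => by ring
  rw [h1]
  ring

end

/-! ### Rooted trees, killing rates of subtrees and Dirichlet solutions. -/

section Tree

variable {V : Type*} {T : SimpleGraph V} {v₀ : V}

/-- Paths in a tree are unique, so a neighbour of `v` closer to the root must be the penultimate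
vertex of the path from the root to `v`. -/
lemma eq_of_adj_of_dist_lt (hT : T.IsTree) {u u' v : V} (hu : T.Adj v u)
    (hu' : T.Adj v u') (h : T.dist v₀ u < T.dist v₀ v) (h' : T.dist v₀ u' < T.dist v₀ v) :
    u = u' := by
  obtain ⟨p, hp, hpl⟩ := (hT.connected v₀ v).exists_path_of_dist
  have key : ∀ u, T.Adj v u → T.dist v₀ u < T.dist v₀ v → u = p.penultimate := by
    intro u hu h
    refine hT.isAcyclic.eq_penultimate_of_adj_end hp hu ?_
    by_contra hns
    obtain ⟨q, hq, hql⟩ := (hT.connected v₀ u).exists_path_of_dist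
    have e : q = p.concat hu := (hT.existsUnique_path v₀ u).unique hq (hp.concat hns hu)
    have := congrArg SimpleGraph.Walk.length e
    rw [SimpleGraph.Walk.length_concat] at this
    omega
  rw [key u hu h, key u' hu' h']

lemma exists_adj_dist_lt (hT : T.IsTree) {v : V} (hv : v ≠ v₀) :
    ∃ u, T.Adj v u ∧ T.dist v₀ u < T.dist v₀ v := by
  obtain ⟨p, hp, hpl⟩ := (hT.connected v₀ v).exists_path_of_dist
  have hnil : ¬ p.Nil := SimpleGraph.Walk.not_nil_of_ne hv.symm
  refine ⟨p.penultimate, (p.adj_penultimate hnil).symm, ?_⟩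
  have h1 : T.dist v₀ p.penultimate ≤ p.dropLast.length := SimpleGraph.dist_le _
  have h2 : p.dropLast.length + 1 = p.length := SimpleGraph.Walk.length_dropLast_add_one hnil
  omega

open Classical in
/-- The parent of a vertex in the tree `T` rooted at `v₀`. -/
def parent (T : SimpleGraph V) (v₀ v : V) : V :=
  if h : ∃ u, T.Adj v u ∧ T.dist v₀ u < T.dist v₀ v then h.choose else v

lemma adj_parent (hT : T.IsTree) {v : V} (hv : v ≠ v₀) : T.Adj v (parent T v₀ v) := by
  have h := exists_adj_dist_lt hT hv
  rw [parent, dif_pos h]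
  exact h.choose_spec.1

lemma dist_parent_lt (hT : T.IsTree) {v : V} (hv : v ≠ v₀) :
    T.dist v₀ (parent T v₀ v) < T.dist v₀ v := by
  have h := exists_adj_dist_lt hT hv
  rw [parent, dif_pos h]
  exact h.choose_spec.2

lemma dist_eq_dist_parent_add_one (hT : T.IsTree) {v : V} (hv : v ≠ v₀) :
    T.dist v₀ v = T.dist v₀ (parent T v₀ v) + 1 := by
  have h1 := dist_parent_lt hT hv
  have h2 := hT.dist_eq_dist_add_one_of_adj v₀ (adj_parent hT hv)
  omega

lemma ne_root_of_dist_lt {u v : V} (h : T.dist v₀ u < T.dist v₀ v) : v ≠ v₀ := by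
  rintro rfl
  simp at h

lemma eq_parent (hT : T.IsTree) {u v : V} (huv : T.Adj v u) (h : T.dist v₀ u < T.dist v₀ v) :
    u = parent T v₀ v :=
  eq_of_adj_of_dist_lt hT huv (adj_parent hT (ne_root_of_dist_lt h)) h
    (dist_parent_lt hT (ne_root_of_dist_lt h))

variable [Fintype V]

open Classical in
/-- The children of a vertex in the tree `T` rooted at `v₀`. -/
def children (T : SimpleGraph V) (v₀ v : V) : Finset V :=
  Finset.univ.filter fun w => T.Adj v w ∧ T.dist v₀ v < T.dist v₀ w

lemma mem_children {v w : V} :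
    w ∈ children T v₀ v ↔ T.Adj v w ∧ T.dist v₀ v < T.dist v₀ w := by
  simp [children]

lemma mem_children_iff_parent (hT : T.IsTree) {v w : V} :
    w ∈ children T v₀ v ↔ w ≠ v₀ ∧ parent T v₀ w = v := by
  rw [mem_children]
  constructor
  · rintro ⟨h1, h2⟩
    exact ⟨ne_root_of_dist_lt h2, (eq_parent hT h1.symm h2).symm⟩
  · rintro ⟨h1, rfl⟩
    exact ⟨(adj_parent hT h1).symm, dist_parent_lt hT h1⟩

/-- Induction from the leaves to the root. -/
lemma children_induction {C : V → Prop} (h : ∀ v, (∀ z ∈ children T v₀ v, C z) → C v) (v : V) :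
    C v := by
  have key : ∀ n v, Finset.univ.sup (T.dist v₀) - T.dist v₀ v ≤ n → C v := by
    intro n
    induction n with
    | zero =>
      intro v hv
      refine h v fun z hz => ?_
      have h1 := (mem_children.1 hz).2
      have h2 : T.dist v₀ z ≤ Finset.univ.sup (T.dist v₀) := Finset.le_sup (Finset.mem_univ z)
      omega
    | succ n ih =>
      intro v hv
      refine h v fun z hz => ih z ?_
      have h1 := (mem_children.1 hz).2
      have h2 : T.dist v₀ z ≤ Finset.univ.sup (T.dist v₀) := Finset.le_sup (Finset.mem_univ z)
      omega
  exact key _ v le_rfl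

/-- Sums over the neighbours of a vertex split into the parent and the children. -/
lemma sum_conductance_mul [DecidableRel T.Adj] [DecidableEq V] (hT : T.IsTree) (v : V)
    (f : V → ℝ) : ∑ w, conductance T v w * f w =
      (if v = v₀ then 0 else f (parent T v₀ v)) + ∑ z ∈ children T v₀ v, f z := by
  have h1 : ∀ w, conductance T v w * f w =
      (if v ≠ v₀ ∧ w = parent T v₀ v then f w else 0) +
        if w ∈ children T v₀ v then f w else 0 := by
    intro w
    unfold conductance
    by_cases hw : w ∈ children T v₀ v
    · have h := mem_children.1 hw
      rw [if_pos h.1, if_pos hw, if_neg]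
      · ring
      · rintro ⟨h2, rfl⟩
        have := dist_parent_lt hT h2
        omega
    · rw [if_neg hw, add_zero]
      by_cases ha : T.Adj v w
      · have hlt : T.dist v₀ w < T.dist v₀ v := by
          rw [mem_children] at hw
          have := hT.dist_ne_of_adj v₀ ha
          by_contra hcon
          exact hw ⟨ha, by omega⟩
        rw [if_pos ha, if_pos ⟨ne_root_of_dist_lt hlt, eq_parent hT ha hlt⟩, one_mul]
      · rw [if_neg ha, zero_mul, if_neg]
        rintro ⟨h2, rfl⟩
        exact ha (adj_parent hT h2)
  simp_rw [h1]
  rw [Finset.sum_add_distrib, Finset.sum_ite_mem, Finset.univ_inter]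
  congr 1
  split_ifs with hv
  · simp [hv]
  · simp [hv]

lemma totalConductance_eq [DecidableRel T.Adj] [DecidableEq V] (hT : T.IsTree) (v : V) :
    totalConductance T v = (if v = v₀ then 0 else 1) + (children T v₀ v).card := by
  have := sum_conductance_mul (v₀ := v₀) hT v fun _ => 1
  simpa [totalConductance] using this

lemma totalConductance_pos [DecidableRel T.Adj] [Nontrivial V] (hT : T.IsTree) (v : V) :
    0 < totalConductance T v := by
  obtain ⟨w, hw⟩ := hT.connected.preconnected.exists_adj_of_nontrivial v
  unfold totalConductance
  refine Finset.sum_pos' (fun u _ => ?_) ⟨w, Finset.mem_univ w, ?_⟩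
  · unfold conductance; split_ifs <;> norm_num
  · simp [conductance, hw]

/-- The rate at which local time at `v` is killed, if the local time at each vertex `z` of the
subtree above `v` is killed at the rate `l z`. -/
def effectiveRate (T : SimpleGraph V) (v₀ : V) (l : V → ℝ) (v : V) : ℝ :=
  -- Series law: a unit edge in front of a subtree with rate a acts as a killing rate a/(1+a) at the
  -- lower end of the edge.
  l v + ∑ z : children T v₀ v, effectiveRate T v₀ l z / (1 + effectiveRate T v₀ l z)
termination_by Finset.univ.sup (T.dist v₀) - T.dist v₀ v
decreasing_by
  all_goals
    have h1 := (mem_children.1 z.2).2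
    have h2 : T.dist v₀ z ≤ Finset.univ.sup (T.dist v₀) := Finset.le_sup (Finset.mem_univ _)
    omega

lemma effectiveRate_eq (l : V → ℝ) (v : V) : effectiveRate T v₀ l v =
    l v + ∑ z ∈ children T v₀ v, effectiveRate T v₀ l z / (1 + effectiveRate T v₀ l z) := by
  rw [effectiveRate, Finset.sum_coe_sort (children T v₀ v)
    fun z => effectiveRate T v₀ l z / (1 + effectiveRate T v₀ l z)]

lemma effectiveRate_nonneg {l : V → ℝ} (hl : ∀ v, 0 ≤ l v) (v : V) :
    0 ≤ effectiveRate T v₀ l v := by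
  induction v using children_induction (T := T) (v₀ := v₀) with
  | h v ih =>
  rw [effectiveRate_eq]
  exact add_nonneg (hl v) (Finset.sum_nonneg fun z hz =>
    div_nonneg (ih z hz) (by linarith [ih z hz]))

/-- The probability that the killed walk started at `v` reaches the root. -/
def survival [DecidableEq V] (T : SimpleGraph V) (v₀ : V) (l : V → ℝ) (v : V) : ℝ :=
  if h : T.dist v₀ (parent T v₀ v) < T.dist v₀ v then
    survival T v₀ l (parent T v₀ v) / (1 + effectiveRate T v₀ l v)
  else 1
termination_by T.dist v₀ v

lemma survival_root [DecidableEq V] (l : V → ℝ) : survival T v₀ l v₀ = 1 := by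
  rw [survival, dif_neg]
  simp

lemma survival_of_ne [DecidableEq V] (hT : T.IsTree) (l : V → ℝ) {v : V} (hv : v ≠ v₀) :
    survival T v₀ l v = survival T v₀ l (parent T v₀ v) / (1 + effectiveRate T v₀ l v) := by
  rw [survival, dif_pos (dist_parent_lt hT hv)]

lemma survival_mem_Icc [DecidableEq V] {l : V → ℝ} (hl : ∀ v, 0 ≤ l v) (v : V) :
    0 ≤ survival T v₀ l v ∧ survival T v₀ l v ≤ 1 := by
  induction hn : T.dist v₀ v using Nat.strong_induction_on generalizing v with
  | _ n ih =>
    rw [survival]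
    split_ifs with h
    · have := ih _ (hn ▸ h) (parent T v₀ v) rfl
      have ha := effectiveRate_nonneg (T := T) (v₀ := v₀) hl v
      refine ⟨div_nonneg this.1 (by linarith), ?_⟩
      rw [div_le_one (by linarith)]
      linarith
    · norm_num

/-- Write φ for `survival` and a for `effectiveRate`. The parent of v contributes (1+a_v)φ_v and
each child z contributes φ_v - φ_v a_z/(1+a_z); since the degree is one plus the number of children,
the recursion for a_v balances both sides. -/
lemma survival_eqn [DecidableRel T.Adj] [DecidableEq V] (hT : T.IsTree) {l : V → ℝ}
    (hl : ∀ v, 0 ≤ l v) {v : V} (hv : v ≠ v₀) :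
    (totalConductance T v + l v) * survival T v₀ l v =
      ∑ w, conductance T v w * survival T v₀ l w := by
  rw [sum_conductance_mul (v₀ := v₀) hT, totalConductance_eq (v₀ := v₀) hT, if_neg hv, if_neg hv]
  have ha := effectiveRate_nonneg (T := T) (v₀ := v₀) hl
  have h1 : survival T v₀ l (parent T v₀ v) =
      (1 + effectiveRate T v₀ l v) * survival T v₀ l v := by
    have := ha v
    rw [survival_of_ne hT l hv]; field_simp
  have h2 : ∀ z ∈ children T v₀ v, survival T v₀ l z =
      survival T v₀ l v * (1 - effectiveRate T v₀ l z / (1 + effectiveRate T v₀ l z)) := by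
    intro z hz
    have hz' := (mem_children_iff_parent hT).1 hz
    have := ha z
    rw [survival_of_ne hT l hz'.1, hz'.2]; field_simp; ring
  rw [Finset.sum_congr rfl h2, ← Finset.mul_sum, Finset.sum_sub_distrib, h1, effectiveRate_eq]
  simp
  ring

/-- Identifies the exponent of the Laplace transform: a child z of the root survives with
probability 1/(1+a_z), so its edge contributes a_z/(1+a_z). -/
lemma effectiveRate_root [DecidableRel T.Adj] [DecidableEq V] (hT : T.IsTree) {l : V → ℝ}
    (hl : ∀ v, 0 ≤ l v) :
    l v₀ + ∑ w, conductance T v₀ w * (1 - survival T v₀ l w) = effectiveRate T v₀ l v₀ := by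
  rw [sum_conductance_mul (v₀ := v₀) hT, if_pos rfl, zero_add, effectiveRate_eq]
  congr 1
  refine Finset.sum_congr rfl fun z hz => ?_
  have hz' := (mem_children_iff_parent hT).1 hz
  have := effectiveRate_nonneg (T := T) (v₀ := v₀) hl z
  rw [survival_of_ne hT l hz'.1, hz'.2, survival_root]
  field_simp
  ring

lemma effectiveRate_eq_zero (hT : T.IsTree) {B : Finset V}
    (hB : ∀ z ∈ B, z ≠ v₀ → parent T v₀ z ∈ B) {m : V → ℝ} (hm : ∀ z, z ∉ B → m z = 0) {v : V}
    (hv : v ∉ B) : effectiveRate T v₀ m v = 0 := by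
  induction v using children_induction (T := T) (v₀ := v₀) with
  | h v ih =>
  rw [effectiveRate_eq, hm v hv, zero_add]
  refine Finset.sum_eq_zero fun z hz => ?_
  have hz' := (mem_children_iff_parent hT).1 hz
  rw [ih z hz fun h => hv (hz'.2 ▸ hB z h hz'.1), zero_div]

/-- Killing at a vertex `w` with no killing above it is the same as killing at its parent. -/
lemma effectiveRate_update [DecidableEq V] (hT : T.IsTree) {A : Finset V} {w : V}
    (hA : ∀ z ∈ A, z ≠ v₀ → parent T v₀ z ∈ A) (hv₀ : v₀ ∈ A) (hw : w ∉ A)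
    (hpw : parent T v₀ w ∈ A) {l : V → ℝ} (hl : ∀ z, z ∉ insert w A → l z = 0) :
    effectiveRate T v₀ (Function.update (Function.update l (parent T v₀ w)
      (l (parent T v₀ w) + l w / (1 + l w))) w 0) v₀ = effectiveRate T v₀ l v₀ := by
  set u := parent T v₀ w with hu
  set l' := Function.update (Function.update l u (l u + l w / (1 + l w))) w 0 with hl'
  have hwv : w ≠ v₀ := fun h => hw (h ▸ hv₀)
  have huw : u ≠ w := fun h => hw (h ▸ hpw)
  have hB : ∀ z ∈ insert w A, z ≠ v₀ → parent T v₀ z ∈ insert w A := by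
    intro z hz hzv
    rcases Finset.mem_insert.1 hz with rfl | h
    · exact Finset.mem_insert_of_mem hpw
    · exact Finset.mem_insert_of_mem (hA z h hzv)
  have hl'A : ∀ z, z ∉ A → l' z = 0 := by
    intro z hz
    by_cases hzw : z = w
    · simp [hl', hzw]
    · have hzu : z ≠ u := fun h => hz (h ▸ hpw)
      rw [hl', Function.update_of_ne hzw, Function.update_of_ne hzu]
      exact hl z (by simp [hzw, hz])
  -- No child of `w` lies in `insert w A`, because `A` is closed under parents and omits `w`; so
  -- nothing is killed strictly above `w`.
  have haw : effectiveRate T v₀ l w = l w := by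
    rw [effectiveRate_eq, add_eq_left]
    refine Finset.sum_eq_zero fun z hz => ?_
    have hz' := (mem_children_iff_parent hT).1 hz
    rw [effectiveRate_eq_zero hT hB hl, zero_div]
    intro h
    rcases Finset.mem_insert.1 h with rfl | h
    · exact (adj_parent hT hz'.1).ne hz'.2.symm
    · exact hw (hz'.2 ▸ hA z h hz'.1)
  have key : ∀ v, v ∈ A → effectiveRate T v₀ l' v = effectiveRate T v₀ l v := by
    intro v
    induction v using children_induction (T := T) (v₀ := v₀) with
    | h v ih =>
    intro hv
    have hvw : v ≠ w := fun h => hw (h ▸ hv)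
    have hch : ∀ z ∈ children T v₀ v, z ≠ w →
        effectiveRate T v₀ l' z / (1 + effectiveRate T v₀ l' z) =
          effectiveRate T v₀ l z / (1 + effectiveRate T v₀ l z) := by
      intro z hz hzw
      by_cases hzA : z ∈ A
      · rw [ih z hz hzA]
      · rw [effectiveRate_eq_zero hT hA hl'A hzA,
          effectiveRate_eq_zero hT hB hl (by simp [hzw, hzA])]
    rw [effectiveRate_eq, effectiveRate_eq l]
    -- At `u` the contribution of the child `w` has moved into the rate of `u` itself; at other
    -- vertices of `A` the recursion is unchanged.
    by_cases hvu : v = u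
    · have hmem : w ∈ children T v₀ v := (mem_children_iff_parent hT).2 ⟨hwv, by rw [hvu, hu]⟩
      rw [← Finset.add_sum_erase _ _ hmem,
        ← Finset.add_sum_erase _ (fun z => effectiveRate T v₀ l z / _) hmem, haw,
        effectiveRate_eq_zero hT hA hl'A hw, hl', Function.update_of_ne hvw, hvu,
        Function.update_self, zero_div, zero_add, ← add_assoc]
      congr 1
      refine Finset.sum_congr rfl fun z hz => ?_
      rw [← hvu] at hz
      exact hch z (Finset.mem_of_mem_erase hz) (Finset.ne_of_mem_erase hz)
    · rw [hl', Function.update_of_ne hvw, Function.update_of_ne hvu]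
      congr 1
      refine Finset.sum_congr rfl fun z hz => hch z hz ?_
      rintro rfl
      exact hvu ((mem_children_iff_parent hT).1 hz).2.symm
  exact key v₀ hv₀

/-- Arbitrarily weak killing of the walk off the root. -/
lemma exists_isDirichletSolution [DecidableRel T.Adj] [DecidableEq V] [Nontrivial V]
    (hT : T.IsTree) (v₀ : V) {δ : ℝ} (hδ : 0 < δ) :
    ∃ c φ : V → ℝ, IsDirichletSolution T v₀ c φ ∧ (∀ v, v ≠ v₀ → 0 < c v) ∧
      ∀ v, 1 - δ ≤ φ v := by
  set ε := min δ (1 / 2) with hε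
  have hε0 : 0 < ε := lt_min hδ (by norm_num)
  have hε1 : ε ≤ 1 / 2 := min_le_right _ _
  -- With α times the number of children below 1, the function 1 - ε(1 - α^dist) gains more at the
  -- parent than it loses at all children together. Off the root it is thus strictly below its
  -- average over neighbours, and the ratio of the two, minus 1, is a positive killing rate.
  set α : ℝ := 1 / (Fintype.card V + 1) with hα
  have hα0 : 0 < α := by positivity
  have hα1 : α ≤ 1 := by
    rw [hα, div_le_one (by positivity)]
    have : (0 : ℝ) ≤ Fintype.card V := by positivity
    linarith
  set φ : V → ℝ := fun v => 1 - ε * (1 - α ^ T.dist v₀ v) with hφ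
  have hpow : ∀ v, 0 < α ^ T.dist v₀ v ∧ α ^ T.dist v₀ v ≤ 1 :=
    fun v => ⟨by positivity, pow_le_one₀ hα0.le hα1⟩
  have hφpos : ∀ v, 1 / 2 ≤ φ v := by
    intro v
    have := hpow v
    simp only [hφ]
    nlinarith
  have hφle : ∀ v, φ v ≤ 1 := by
    intro v
    have := hpow v
    simp only [hφ]
    nlinarith
  have hgt : ∀ v, v ≠ v₀ → totalConductance T v * φ v < ∑ w, conductance T v w * φ w := by
    intro v hv
    rw [sum_conductance_mul (v₀ := v₀) hT, totalConductance_eq (v₀ := v₀) hT, if_neg hv, if_neg hv]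
    have hd := dist_eq_dist_parent_add_one hT hv
    set h := T.dist v₀ (parent T v₀ v) with hh
    have h1 : φ (parent T v₀ v) = φ v + ε * α ^ h * (1 - α) := by
      simp only [hφ, hd, ← hh]; ring
    have h2 : ∀ z ∈ children T v₀ v, φ z = φ v - ε * α ^ h * (1 - α) * α := by
      intro z hz
      have hz' := (mem_children_iff_parent hT).1 hz
      have hdz := dist_eq_dist_parent_add_one hT hz'.1
      rw [hz'.2, hd] at hdz
      simp only [hφ, hd, hdz]; ring
    rw [h1, Finset.sum_congr rfl h2, Finset.sum_const, nsmul_eq_mul]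
    have hlt : α < 1 := by
      rw [hα, div_lt_one (by positivity)]
      have : (0 : ℝ) < Fintype.card V := by exact_mod_cast Fintype.card_pos
      linarith
    have hcard : ((children T v₀ v).card : ℝ) * α < 1 := by
      rw [hα, mul_one_div, div_lt_one (by positivity)]
      have : ((children T v₀ v).card : ℝ) ≤ Fintype.card V := by
        exact_mod_cast Finset.card_le_univ _
      linarith
    have : 0 < ε * α ^ h * (1 - α) * (1 - (children T v₀ v).card * α) :=
      mul_pos (mul_pos (by positivity) (by linarith)) (by linarith)
    nlinarith
  have hc : ∀ v, v ≠ v₀ → 0 < (∑ w, transitionProb T v w * φ w) / φ v - 1 := by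
    intro v hv
    have hd := totalConductance_pos hT v
    rw [sub_pos, lt_div_iff₀ (by linarith [hφpos v]), one_mul]
    unfold transitionProb
    simp_rw [div_mul_eq_mul_div]
    rw [← Finset.sum_div, lt_div_iff₀ hd, mul_comm]
    exact hgt v hv
  refine ⟨fun v => if v = v₀ then 0 else (∑ w, transitionProb T v w * φ w) / φ v - 1, φ,
    ⟨by simp, fun v => ?_, by simp [hφ], fun v => by linarith [hφpos v], hφle, fun v hv => ?_⟩,
    fun v hv => ?_, ?_⟩
  · split_ifs with h
    · exact le_rfl
    · exact (hc v h).le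
  · have := hφpos v
    simp only [hv, if_false]
    rw [add_sub_cancel, div_mul_cancel₀ _ (by linarith)]
  · simp only [hv, if_false]
    exact hc v hv
  · intro v
    have := hpow v
    have : ε ≤ δ := min_le_left _ _
    simp only [hφ]
    nlinarith

end Tree

/-! ### The Laplace transform of the local times on a tree. -/

section Laplace

variable {V Ω : Type*} [Fintype V] [DecidableEq V] [Nontrivial V] [MeasurableSpace V]
  [MeasurableSingletonClass V] [MeasurableSpace Ω] {T : SimpleGraph V} [DecidableRel T.Adj]
  {v₀ : V} {P : Measure Ω} [IsProbabilityMeasure P] {S : ℕ → Ω → V} {J : ℕ → Ω → ℝ}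

lemma ae_exists_crossesAt_tree (hT : T.IsTree) (hS : IsDiscreteWalk T v₀ S P)
    (hJ : IsHoldingTimes J P) (hSJ : IndepFun (fun ω n => S n ω) (fun ω n => J n ω) P) {r : ℝ}
    (hr : 0 ≤ r) : ∀ᵐ ω ∂P, ∃ n, CrossesAt v₀ r (fun n => S n ω) (fun n => J n ω) n :=
  ae_exists_crossesAt hS hJ hSJ (fun v => sum_transitionProb (totalConductance_pos hT v))
    (fun _ hδ => exists_isDirichletSolution hT v₀ hδ) hr

theorem lintegral_exp_localField_tree (hT : T.IsTree) (hS : IsDiscreteWalk T v₀ S P)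
    (hJ : IsHoldingTimes J P) (hSJ : IndepFun (fun ω n => S n ω) (fun ω n => J n ω) P)
    {t : ℝ} (ht : 0 ≤ t) {l : V → ℝ} (hl : ∀ v, 0 ≤ l v) :
    ∫⁻ ω, ENNReal.ofReal (Real.exp (-∑ v, l v * localField T v₀ S J t ω v)) ∂P =
      ENNReal.ofReal (Real.exp (-(t * effectiveRate T v₀ l v₀))) := by
  have hd := totalConductance_pos hT
  rw [lintegral_exp_localField hS hJ hSJ hd ht
    (ae_exists_crossesAt_tree hT hS hJ hSJ (mul_nonneg ht (hd v₀).le)) hl (survival_root l)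
    (fun v => (survival_mem_Icc hl v).1) (fun v => (survival_mem_Icc hl v).2)
    (fun v hv => survival_eqn hT hl hv), effectiveRate_root hT hl]

end Laplace

/-! ### Laplace transforms determine finite measures on the positive orthant. -/

section Uniqueness

open scoped NNReal

variable {ι : Type*} [Fintype ι]

/-- The function `x ↦ exp (-∑ l i x i)` on `ℝ≥0^ι`. -/
def expNeg (l : ι → ℝ≥0) : BoundedContinuousFunction (ι → ℝ≥0) ℝ :=
  BoundedContinuousFunction.ofNormedAddCommGroup
    (fun x => Real.exp (-∑ i, (l i : ℝ) * x i)) (by fun_prop) 1 fun x => by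
      rw [Real.norm_eq_abs, abs_of_pos (Real.exp_pos _), Real.exp_le_one_iff, neg_nonpos]
      positivity

lemma expNeg_apply (l x : ι → ℝ≥0) : expNeg l x = Real.exp (-∑ i, (l i : ℝ) * x i) := rfl

/-- The functions `expNeg l` form a monoid. -/
def expNegMonoid (ι : Type*) [Fintype ι] :
    Submonoid (BoundedContinuousFunction (ι → ℝ≥0) ℝ) where
  carrier := Set.range expNeg
  one_mem' := ⟨0, by ext x; simp [expNeg_apply]⟩
  mul_mem' := by
    rintro _ _ ⟨l, rfl⟩ ⟨m, rfl⟩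
    refine ⟨l + m, ?_⟩
    ext x
    simp only [expNeg_apply, BoundedContinuousFunction.mul_apply, ← Real.exp_add, Pi.add_apply,
      NNReal.coe_add, add_mul, Finset.sum_add_distrib, neg_add]

/-- The algebra spanned by the functions `expNeg l`. -/
def expNegAlgebra (ι : Type*) [Fintype ι] :
    StarSubalgebra ℝ (BoundedContinuousFunction (ι → ℝ≥0) ℝ) :=
  { Algebra.adjoin ℝ (Set.range expNeg) with
    star_mem' := by
      intro f hf
      have : star f = f := by ext x; simp
      rwa [this] }

lemma mem_expNegAlgebra {f : BoundedContinuousFunction (ι → ℝ≥0) ℝ} (hf : f ∈ expNegAlgebra ι) :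
    f ∈ Submodule.span ℝ (Set.range (expNeg (ι := ι))) := by
  have h1 : f ∈ Subalgebra.toSubmodule (Algebra.adjoin ℝ (Set.range (expNeg (ι := ι)))) := hf
  rw [Algebra.adjoin_eq_span] at h1
  have h2 : Submonoid.closure (Set.range (expNeg (ι := ι))) = expNegMonoid ι :=
    Submonoid.closure_eq (expNegMonoid ι)
  rw [h2] at h1
  exact h1

/-- Products of exponentials are exponentials, so their linear span is an algebra. It consists of
bounded continuous functions, bounded because the space is the orthant, and it separates points;
such an algebra determines finite measures on a Polish space. -/
lemma ext_of_lintegral_expNeg {μ ν : Measure (ι → ℝ≥0)} [IsFiniteMeasure μ] [IsFiniteMeasure ν]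
    (h : ∀ l : ι → ℝ≥0, ∫⁻ x, ENNReal.ofReal (expNeg l x) ∂μ =
      ∫⁻ x, ENNReal.ofReal (expNeg l x) ∂ν) : μ = ν := by
  classical
  refine ext_of_forall_mem_subalgebra_integral_eq_of_polish (𝕜 := ℝ) (A := expNegAlgebra ι) ?_ ?_
  · intro x y hxy
    obtain ⟨i, hi⟩ := Function.ne_iff.1 hxy
    refine ⟨_, ⟨_, ⟨expNeg (Pi.single i 1), Algebra.subset_adjoin ⟨_, rfl⟩, rfl⟩, rfl⟩, ?_⟩
    have e : ∀ z : ι → ℝ≥0, expNeg (Pi.single i 1) z = Real.exp (-(z i : ℝ)) := by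
      intro z
      rw [expNeg_apply, Finset.sum_eq_single i]
      · simp
      · intro j _ hj; simp [hj]
      · simp
    change expNeg (Pi.single i 1) x ≠ expNeg (Pi.single i 1) y
    rw [e, e]
    simpa using hi
  · intro g hg
    have hspan := mem_expNegAlgebra hg
    clear hg
    induction hspan using Submodule.span_induction with
    | mem f hf =>
      obtain ⟨l, rfl⟩ := hf
      have hpos : ∀ x, 0 ≤ expNeg l x := fun x => (Real.exp_pos _).le
      rw [integral_eq_lintegral_of_nonneg_ae (Filter.Eventually.of_forall hpos)
          (expNeg l).continuous.aestronglyMeasurable,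
        integral_eq_lintegral_of_nonneg_ae (Filter.Eventually.of_forall hpos)
          (expNeg l).continuous.aestronglyMeasurable, h l]
    | zero => simp
    | add f g _ _ hf hg =>
      simp only [BoundedContinuousFunction.add_apply]
      rw [integral_add (f.integrable μ) (g.integrable μ),
        integral_add (f.integrable ν) (g.integrable ν), hf, hg]
    | smul c f _ hf =>
      simp only [BoundedContinuousFunction.smul_apply]
      rw [integral_smul, integral_smul, hf]

/-- A measure carried by the orthant is recovered from its image under coordinatewise `toNNReal`. -/
lemma ext_of_lintegral_exp_neg {μ ν : Measure (ι → ℝ)} [IsFiniteMeasure μ] [IsFiniteMeasure ν]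
    (hμ : ∀ᵐ x ∂μ, ∀ i, 0 ≤ x i) (hν : ∀ᵐ x ∂ν, ∀ i, 0 ≤ x i)
    (h : ∀ l : ι → ℝ, (∀ i, 0 ≤ l i) →
      ∫⁻ x, ENNReal.ofReal (Real.exp (-∑ i, l i * x i)) ∂μ =
        ∫⁻ x, ENNReal.ofReal (Real.exp (-∑ i, l i * x i)) ∂ν) : μ = ν := by
  set e : (ι → ℝ) → ι → ℝ≥0 := fun x i => (x i).toNNReal with he
  set e' : (ι → ℝ≥0) → ι → ℝ := fun x i => x i with he'
  have hem : Measurable e := by fun_prop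
  have hem' : Measurable e' := by fun_prop
  have key : μ.map e = ν.map e := by
    refine ext_of_lintegral_expNeg fun l => ?_
    have hm : Measurable fun x => ENNReal.ofReal (expNeg l x) :=
      (expNeg l).continuous.measurable.ennreal_ofReal
    have aux : ∀ x : ι → ℝ, (∀ i, 0 ≤ x i) → ENNReal.ofReal (expNeg l (e x)) =
        ENNReal.ofReal (Real.exp (-∑ i, (l i : ℝ) * x i)) := by
      intro x hx
      simp only [expNeg_apply, he, Real.coe_toNNReal _ (hx _)]
    rw [lintegral_map hm hem, lintegral_map hm hem, lintegral_congr_ae (hμ.mono aux),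
      lintegral_congr_ae (hν.mono aux), h (fun i => l i) fun i => (l i).2]
  have back : ∀ {ρ : Measure (ι → ℝ)}, (∀ᵐ x ∂ρ, ∀ i, 0 ≤ x i) → (ρ.map e).map e' = ρ := by
    intro ρ hρ
    rw [Measure.map_map hem' hem, Measure.map_congr (g := id), Measure.map_id]
    filter_upwards [hρ] with x hx
    ext i
    simp [he, he', hx i]
  rw [← back hμ, ← back hν, key]

end Uniqueness

/-! ### Poisson sums of exponential variables. -/

section CompoundPoisson

/-- The law of the sum of `k` independent exponential variables with mean `1`. -/
def erlang (k : ℕ) : Measure ℝ :=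
  if k = 0 then Measure.dirac 0 else gammaMeasure k 1

instance (k : ℕ) : IsProbabilityMeasure (erlang k) := by
  unfold erlang
  split_ifs with h
  · infer_instance
  · exact isProbabilityMeasure_gammaMeasure (by positivity) one_pos

lemma lintegral_gammaMeasure_one {k : ℕ} (hk : k ≠ 0) {f : ℝ → ℝ≥0∞} (hf : Measurable f) :
    ∫⁻ y, f y ∂(gammaMeasure k 1) = ∫⁻ y in Set.Ioi 0,
      ENNReal.ofReal (y ^ (k - 1) / (k - 1).factorial * Real.exp (-y)) * f y := by
  obtain ⟨m, rfl⟩ := Nat.exists_eq_succ_of_ne_zero hk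
  have hm : Measurable (gammaPDF ((m + 1 : ℕ) : ℝ) 1) :=
    (measurable_gammaPDFReal _ 1).ennreal_ofReal
  rw [Nat.succ_eq_add_one, gammaMeasure, lintegral_withDensity_eq_lintegral_mul _ hm hf,
    ← setLIntegral_congr Ioi_ae_eq_Ici.symm, ← lintegral_indicator measurableSet_Ici]
  refine lintegral_congr fun y => ?_
  by_cases hy : 0 ≤ y
  · rw [Set.indicator_of_mem (Set.mem_Ici.2 hy), Pi.mul_apply, gammaPDF_of_nonneg hy]
    congr 2
    push_cast
    rw [Real.Gamma_nat_eq_factorial, Real.one_rpow, add_sub_cancel_right, Real.rpow_natCast,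
      one_mul]
    simp
    ring
  · simp [Set.indicator, hy, gammaPDF_of_neg (not_le.1 hy)]

lemma ae_nonneg_erlang (k : ℕ) : ∀ᵐ y ∂(erlang k), 0 ≤ y := by
  unfold erlang
  split_ifs with h
  · rw [ae_dirac_eq]; simp
  · rw [ae_iff, show {y : ℝ | ¬ 0 ≤ y} = Set.Iio 0 by ext; simp,
      ← lintegral_indicator_one measurableSet_Iio,
      lintegral_gammaMeasure_one h (measurable_one.indicator measurableSet_Iio),
      setLIntegral_congr_fun (g := fun _ => 0) measurableSet_Ioi]
    · simp
    · intro y hy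
      have hy' : 0 < y := hy
      simp [Set.indicator, hy'.le]

lemma lintegral_exp_neg_erlang {l : ℝ} (hl : 0 ≤ l) (k : ℕ) :
    ∫⁻ y, ENNReal.ofReal (Real.exp (-(l * y))) ∂(erlang k) =
      ENNReal.ofReal ((1 / (1 + l)) ^ k) := by
  unfold erlang
  split_ifs with h
  · simp [h]
  · rw [lintegral_gammaMeasure_one h (by fun_prop)]
    obtain ⟨m, rfl⟩ := Nat.exists_eq_succ_of_ne_zero h
    have hf : (0 : ℝ) < m.factorial := by exact_mod_cast m.factorial_pos
    have e : ∀ y ∈ Set.Ioi (0 : ℝ), ENNReal.ofReal (y ^ (m.succ - 1) / (m.succ - 1).factorial *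
        Real.exp (-y)) * ENNReal.ofReal (Real.exp (-(l * y))) =
        ENNReal.ofReal ((1 / (m.factorial : ℝ)) *
          (y ^ (((m + 1 : ℕ) : ℝ) - 1) * Real.exp (-((1 + l) * y)))) := by
      intro y hy
      have hy' : 0 < y := hy
      rw [← ENNReal.ofReal_mul (by positivity)]
      congr 1
      push_cast
      rw [add_sub_cancel_right, Real.rpow_natCast, mul_assoc, ← Real.exp_add]
      ring_nf
    have hpos : (0 : ℝ) < ((m + 1 : ℕ) : ℝ) := by positivity
    have hint := Real.integral_rpow_mul_exp_neg_mul_Ioi hpos (by linarith : 0 < 1 + l)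
    have hintble : IntegrableOn (fun y : ℝ => y ^ (((m + 1 : ℕ) : ℝ) - 1) *
        Real.exp (-((1 + l) * y))) (Set.Ioi 0) := by
      -- A non-integrable function would have integral 0 by convention, whereas this integral is
      -- positive.
      by_contra hcon
      have := integral_undef hcon
      rw [hint] at this
      have h2 : 0 < (1 / (1 + l)) ^ ((m + 1 : ℕ) : ℝ) * Real.Gamma ((m + 1 : ℕ) : ℝ) :=
        mul_pos (by positivity) (Real.Gamma_pos_of_pos hpos)
      linarith
    rw [setLIntegral_congr_fun measurableSet_Ioi e, ← ofReal_integral_eq_lintegral_ofReal,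
      integral_const_mul, hint]
    · congr 1
      rw [Real.rpow_natCast]
      push_cast
      rw [Real.Gamma_nat_eq_factorial, Nat.succ_eq_add_one]
      field_simp
    · exact hintble.const_mul _
    · refine (ae_restrict_iff' measurableSet_Ioi).2 (Filter.Eventually.of_forall fun y hy => ?_)
      have hy' : 0 < y := hy
      positivity

/-- The Poisson weights with parameter `s`. -/
def poissonWeight (s : ℝ) (k : ℕ) : ℝ := Real.exp (-s) * s ^ k / k.factorial

lemma poissonWeight_nonneg {s : ℝ} (hs : 0 ≤ s) (k : ℕ) : 0 ≤ poissonWeight s k := by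
  unfold poissonWeight; positivity

lemma measurable_poissonWeight (k : ℕ) : Measurable fun s => poissonWeight s k := by
  unfold poissonWeight; fun_prop

lemma tsum_poissonWeight_mul_pow {s q : ℝ} (hs : 0 ≤ s) (hq : 0 ≤ q) :
    ∑' k, ENNReal.ofReal (poissonWeight s k) * ENNReal.ofReal (q ^ k) =
      ENNReal.ofReal (Real.exp (-(s * (1 - q)))) := by
  have h : HasSum (fun k : ℕ => poissonWeight s k * q ^ k) (Real.exp (-(s * (1 - q)))) := by
    have h1 := (NormedSpace.expSeries_div_hasSum_exp (s * q)).mul_left (Real.exp (-s))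
    rw [← Real.exp_eq_exp_ℝ, ← Real.exp_add, show -s + s * q = -(s * (1 - q)) by ring] at h1
    have e : (fun k : ℕ => poissonWeight s k * q ^ k) =
        fun k : ℕ => Real.exp (-s) * ((s * q) ^ k / k.factorial) := by
      ext k
      unfold poissonWeight
      rw [mul_pow]
      ring
    rw [e]
    exact h1
  simp_rw [← ENNReal.ofReal_mul (poissonWeight_nonneg hs _)]
  rw [← ENNReal.ofReal_tsum_of_nonneg _ h.summable, h.tsum_eq]
  exact fun k => mul_nonneg (poissonWeight_nonneg hs k) (pow_nonneg hq k)

/-- The average of `f` over the law of a sum of a Poisson number, with mean `s`, of independent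
exponential variables with mean `1`. -/
def compoundPoissonAverage (f : ℝ → ℝ≥0∞) (s : ℝ) : ℝ≥0∞ :=
  ∑' k, ENNReal.ofReal (poissonWeight s k) * ∫⁻ y, f y ∂(erlang k)

/-- The Poisson generating function evaluated at 1/(1+l). The exponent l/(1+l) is the contribution
of a child in `effectiveRate`, which links this law to the local times. -/
lemma compoundPoissonAverage_exp_neg {l s : ℝ} (hl : 0 ≤ l) (hs : 0 ≤ s) :
    compoundPoissonAverage (fun y => ENNReal.ofReal (Real.exp (-(l * y)))) s =
      ENNReal.ofReal (Real.exp (-(s * (l / (1 + l))))) := by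
  unfold compoundPoissonAverage
  simp_rw [lintegral_exp_neg_erlang hl]
  rw [tsum_poissonWeight_mul_pow hs (by positivity)]
  congr 4
  field_simp
  ring

end CompoundPoisson

/-! ### The Markov property of the local times along the tree. -/

section Markov

variable {V : Type*} [Fintype V] [DecidableEq V]

/-- The law of `x` with the coordinate `w` resampled from the compound Poisson law with
parameter `x u`. -/
def resample (μ : Measure (V → ℝ)) (u w : V) : Measure (V → ℝ) :=
  Measure.sum fun k => ((μ.withDensity fun x => ENNReal.ofReal (poissonWeight (x u) k)).prod
    (erlang k)).map fun q => Function.update q.1 w q.2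

lemma measurable_update_pair (w : V) :
    Measurable fun q : (V → ℝ) × ℝ => Function.update q.1 w q.2 := by
  refine measurable_pi_lambda _ fun v => ?_
  by_cases h : v = w
  · subst h; simp only [Function.update_self]; fun_prop
  · simp only [Function.update_of_ne h]; fun_prop

lemma lintegral_resample (μ : Measure (V → ℝ)) [IsFiniteMeasure μ] (u w : V)
    {f : (V → ℝ) → ℝ≥0∞} (hf : Measurable f) :
    ∫⁻ x, f x ∂(resample μ u w) =
      ∫⁻ x, compoundPoissonAverage (fun y => f (Function.update x w y)) (x u) ∂μ := by
  unfold resample compoundPoissonAverage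
  have hm := measurable_update_pair w
  have hfm : Measurable fun q : (V → ℝ) × ℝ => f (Function.update q.1 w q.2) := hf.comp hm
  have hw : ∀ k, Measurable fun x : V → ℝ => ENNReal.ofReal (poissonWeight (x u) k) := fun k =>
    ((measurable_poissonWeight k).comp (measurable_pi_apply u)).ennreal_ofReal
  have hi : ∀ k, Measurable fun x : V → ℝ => ∫⁻ y, f (Function.update x w y) ∂(erlang k) :=
    fun k => hfm.lintegral_prod_right'
  rw [lintegral_sum_measure]
  refine Eq.trans ?_ (lintegral_tsum fun k => ((hw k).mul (hi k)).aemeasurable).symm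
  refine tsum_congr fun k => ?_
  rw [lintegral_map hf hm, lintegral_prod _ hfm.aemeasurable,
    lintegral_withDensity_eq_lintegral_mul _ (hw k) (hi k)]

variable {Ω : Type*} [Nontrivial V] [MeasurableSpace V]
  [MeasurableSingletonClass V] [MeasurableSpace Ω] {T : SimpleGraph V} [DecidableRel T.Adj]
  {v₀ : V} {P : Measure Ω} [IsProbabilityMeasure P] {S : ℕ → Ω → V} {J : ℕ → Ω → ℝ}

/-- The Markov property of the local times at the inverse local time, along the tree. -/
theorem lintegral_localField_markov (hT : T.IsTree) (hS : IsDiscreteWalk T v₀ S P)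
    (hJ : IsHoldingTimes J P) (hSJ : IndepFun (fun ω n => S n ω) (fun ω n => J n ω) P)
    {t : ℝ} (ht : 0 ≤ t) {A : Finset V} {w : V}
    (hA : ∀ z ∈ A, z ≠ v₀ → parent T v₀ z ∈ A) (hv₀ : v₀ ∈ A) (hw : w ∉ A)
    (hpw : parent T v₀ w ∈ A) {F : (V → ℝ) → ℝ≥0∞} (hF : Measurable F)
    (hFA : ∀ x x' : V → ℝ, (∀ v ∈ insert w A, x v = x' v) → F x = F x') :
    ∫⁻ ω, F (localField T v₀ S J t ω) ∂P =
      ∫⁻ ω, compoundPoissonAverage (fun y => F (Function.update (localField T v₀ S J t ω) w y))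
        (localField T v₀ S J t ω (parent T v₀ w)) ∂P := by
  set u := parent T v₀ w with hu
  have huw : u ≠ w := fun h => hw (h ▸ hpw)
  set B := insert w A with hB
  -- Laplace transforms will agree only for rates supported on `B`, so coordinates outside `B` are
  -- erased before uniqueness is applied.
  set mask : (V → ℝ) → V → ℝ := fun x v => if v ∈ B then x v else 0 with hmask
  have hmm : Measurable mask := by
    refine measurable_pi_lambda _ fun v => ?_
    by_cases h : v ∈ B
    · simp only [hmask, h, if_true]; fun_prop
    · simp only [hmask, h, if_false]; fun_prop
  have hL := measurable_localField (G := T) (v₀ := v₀) hS.measurable hJ.measurable t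
  set μ := P.map (localField T v₀ S J t) with hμ
  have hμP : IsProbabilityMeasure μ := Measure.isProbabilityMeasure_map hL.aemeasurable
  have hFm : ∀ x, F (mask x) = F x := fun x => hFA _ _ fun v hv => by
    simp only [hmask, if_pos hv]
  have hexp : ∀ l : V → ℝ, Measurable fun x : V → ℝ =>
      ENNReal.ofReal (Real.exp (-∑ v, l v * x v)) := fun l => by fun_prop
  have hnn : ∀ᵐ x ∂μ, ∀ v, 0 ≤ x v := by
    rw [hμ, ae_map_iff hL.aemeasurable (by
      simp_rw [Set.ofPred_forall]
      exact MeasurableSet.iInter fun v =>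
        measurableSet_le measurable_const (measurable_pi_apply v))]
    exact Filter.Eventually.of_forall fun ω v => localField_nonneg ht ω v
  -- Averaging over the resampled coordinate `w` turns `l` into the rates of `effectiveRate_update`,
  -- which have the same effective rate at the root.
  have hlap : ∀ l : V → ℝ, (∀ v, 0 ≤ l v) → (∀ v, v ∉ B → l v = 0) →
      ∫⁻ x, ENNReal.ofReal (Real.exp (-∑ v, l v * x v)) ∂(resample μ u w) =
        ∫⁻ x, ENNReal.ofReal (Real.exp (-∑ v, l v * x v)) ∂μ := by
    intro l hl hlB
    set l' := Function.update (Function.update l u (l u + l w / (1 + l w))) w 0 with hl'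
    have hlw := hl w
    have hl'n : ∀ v, 0 ≤ l' v := by
      intro v
      by_cases h1 : v = w
      · simp [hl', h1]
      · rw [hl', Function.update_of_ne h1]
        by_cases h2 : v = u
        · rw [h2, Function.update_self]
          have := hl u
          positivity
        · rw [Function.update_of_ne h2]; exact hl v
    rw [lintegral_resample μ u w (hexp l)]
    have h1 : ∀ᵐ x ∂μ, compoundPoissonAverage (fun y =>
        ENNReal.ofReal (Real.exp (-∑ v, l v * Function.update x w y v))) (x u) =
        ENNReal.ofReal (Real.exp (-∑ v, l' v * x v)) := by
      filter_upwards [hnn] with x hx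
      have h2 : ∀ y, ENNReal.ofReal (Real.exp (-∑ v, l v * Function.update x w y v)) =
          ENNReal.ofReal (Real.exp (-∑ v ∈ Finset.univ.erase w, l v * x v)) *
            ENNReal.ofReal (Real.exp (-(l w * y))) := by
        intro y
        rw [← ENNReal.ofReal_mul (Real.exp_pos _).le, ← Real.exp_add,
          ← Finset.add_sum_erase _ _ (Finset.mem_univ w), Function.update_self, ← neg_add,
          add_comm (l w * y)]
        congr 4
        refine Finset.sum_congr rfl fun v hv => ?_
        rw [Function.update_of_ne (Finset.ne_of_mem_erase hv)]
      have h3 := compoundPoissonAverage_exp_neg hlw (hx u)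
      unfold compoundPoissonAverage at h3 ⊢
      simp_rw [h2]
      simp_rw [lintegral_const_mul' _ _ ENNReal.ofReal_ne_top, mul_left_comm _
        (ENNReal.ofReal (Real.exp (-∑ v ∈ Finset.univ.erase w, l v * x v)))]
      rw [ENNReal.tsum_mul_left, h3, ← ENNReal.ofReal_mul (Real.exp_pos _).le, ← Real.exp_add,
        ← neg_add, ← Finset.add_sum_erase _ (fun v => l' v * x v) (Finset.mem_univ w)]
      have hmem : u ∈ Finset.univ.erase w := by simp [huw]
      rw [← Finset.add_sum_erase _ _ hmem, ← Finset.add_sum_erase _ (fun v => l' v * x v) hmem]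
      have h4 : ∑ v ∈ (Finset.univ.erase w).erase u, l' v * x v =
          ∑ v ∈ (Finset.univ.erase w).erase u, l v * x v := by
        refine Finset.sum_congr rfl fun v hv => ?_
        have hv1 := Finset.ne_of_mem_erase hv
        have hv2 := Finset.ne_of_mem_erase (Finset.mem_of_mem_erase hv)
        rw [hl', Function.update_of_ne hv2, Function.update_of_ne hv1]
      rw [h4, hl', Function.update_self, Function.update_of_ne huw, Function.update_self]
      congr 3
      ring
    rw [lintegral_congr_ae h1, hμ, lintegral_map (hexp l') hL, lintegral_map (hexp l) hL,
      lintegral_exp_localField_tree hT hS hJ hSJ ht hl'n,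
      lintegral_exp_localField_tree hT hS hJ hSJ ht hl, hl', hu,
      effectiveRate_update hT hA hv₀ hw hpw hlB]
  -- The weights have total mass 1 only where `x u ≥ 0`; finiteness is read off `hlap` at rate zero.
  have hfin : IsFiniteMeasure (resample μ u w) := by
    refine ⟨?_⟩
    have h := hlap 0 (fun _ => le_rfl) (fun _ _ => rfl)
    simp only [Pi.zero_apply, zero_mul, Finset.sum_const_zero, neg_zero, Real.exp_zero,
      ENNReal.ofReal_one, lintegral_const, one_mul, measure_univ] at h
    rw [h]; exact ENNReal.one_lt_top
  have hnn' : ∀ᵐ x ∂(resample μ u w), ∀ v, 0 ≤ x v := by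
    have hms : MeasurableSet {x : V → ℝ | ∀ v, 0 ≤ x v} := by
      simp_rw [Set.ofPred_forall]
      exact MeasurableSet.iInter fun v => measurableSet_le measurable_const (measurable_pi_apply v)
    rw [ae_iff, show {x : V → ℝ | ¬ ∀ v, 0 ≤ x v} = {x : V → ℝ | ∀ v, 0 ≤ x v}ᶜ from rfl,
      ← lintegral_indicator_one hms.compl,
      lintegral_resample μ u w (measurable_one.indicator hms.compl)]
    rw [lintegral_congr_ae (g := fun _ => 0), lintegral_zero]
    filter_upwards [hnn] with x hx
    refine ENNReal.tsum_eq_zero.2 fun k => ?_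
    rw [lintegral_congr_ae (g := fun _ => 0), lintegral_zero, mul_zero]
    filter_upwards [ae_nonneg_erlang k] with y hy
    rw [Set.indicator_of_notMem]
    simp only [Set.mem_compl_iff, Set.mem_ofPred_eq, not_not]
    intro v
    by_cases h : v = w
    · rw [h, Function.update_self]; exact hy
    · rw [Function.update_of_ne h]; exact hx v
  have hmaskn : ∀ x : V → ℝ, (∀ v, 0 ≤ x v) → ∀ v, 0 ≤ mask x v := by
    intro x hx v
    simp only [hmask]
    split_ifs
    · exact hx v
    · exact le_rfl
  have hae : ∀ ρ : Measure (V → ℝ), (∀ᵐ x ∂ρ, ∀ v, 0 ≤ x v) →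
      ∀ᵐ x ∂(ρ.map mask), ∀ v, 0 ≤ x v := by
    intro ρ hρ
    rw [ae_map_iff hmm.aemeasurable (by
      simp_rw [Set.ofPred_forall]
      exact MeasurableSet.iInter fun v =>
        measurableSet_le measurable_const (measurable_pi_apply v))]
    exact hρ.mono hmaskn
  have hmaskl : ∀ (l x : V → ℝ), ∑ v, l v * mask x v = ∑ v, mask l v * x v := by
    intro l x
    refine Finset.sum_congr rfl fun v _ => ?_
    simp only [hmask]
    split_ifs <;> simp
  have heq : (resample μ u w).map mask = μ.map mask := by
    refine ext_of_lintegral_exp_neg (hae _ hnn') (hae _ hnn) fun l hl => ?_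
    rw [lintegral_map (hexp l) hmm, lintegral_map (hexp l) hmm]
    simp_rw [hmaskl]
    exact hlap (mask l) (hmaskn l hl) fun v hv => by simp only [hmask, if_neg hv]
  have h1 : ∫⁻ x, F x ∂μ = ∫⁻ x, F x ∂(resample μ u w) := by
    rw [← lintegral_congr hFm, ← lintegral_congr (μ := resample μ u w) hFm,
      ← lintegral_map hF hmm, ← lintegral_map hF hmm, heq]
  rw [lintegral_resample μ u w hF, hμ, lintegral_map hF hL, lintegral_map] at h1
  · exact h1
  · unfold compoundPoissonAverage
    refine Measurable.tsum fun k => ?_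
    exact ((measurable_poissonWeight k).comp (measurable_pi_apply u)).ennreal_ofReal.mul
      (hF.comp (measurable_update_pair w)).lintegral_prod_right'
  · exact hL

end Markov

/-! ### Poisson tails and χ laws. -/

section OneEdge

/-- The derivative of each weight is the difference of two consecutive weights, and the sum
telescopes. -/
lemma hasDerivAt_sum_poissonWeight (j : ℕ) (y : ℝ) :
    HasDerivAt (fun y => ∑ k ∈ Finset.range (j + 1), poissonWeight y k) (-poissonWeight y j) y := by
  induction j with
  | zero =>
    simp only [zero_add, Finset.range_one, Finset.sum_singleton, poissonWeight, pow_zero, mul_one,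
      Nat.factorial_zero, Nat.cast_one, div_one]
    simpa using (hasDerivAt_neg y).exp
  | succ j ih =>
    have h1 : HasDerivAt (fun y => poissonWeight y (j + 1))
        (poissonWeight y j - poissonWeight y (j + 1)) y := by
      have h2 := (((hasDerivAt_neg y).exp).mul (hasDerivAt_pow (j + 1) y)).div_const
        ((j + 1).factorial : ℝ)
      refine h2.congr_deriv ?_
      have hf : ((j + 1).factorial : ℝ) = (j + 1) * j.factorial := by
        rw [Nat.factorial_succ]; push_cast; ring
      have h0 : (j.factorial : ℝ) ≠ 0 := by exact_mod_cast j.factorial_ne_zero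
      have h3 : (j : ℝ) + 1 ≠ 0 := by positivity
      unfold poissonWeight
      rw [hf]
      simp only [Nat.add_sub_cancel]
      push_cast
      field_simp
      ring
    have h4 := ih.add h1
    refine (h4.congr_deriv (by ring)).congr_of_eventuallyEq
      (Filter.Eventually.of_forall fun x => ?_)
    simp only [Finset.sum_range_succ _ (j + 1), Pi.add_apply]

lemma tendsto_sum_poissonWeight (j : ℕ) :
    Filter.Tendsto (fun y => ∑ k ∈ Finset.range j, poissonWeight y k) Filter.atTop (nhds 0) := by
  rw [← Finset.sum_const_zero (s := Finset.range j)]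
  refine tendsto_finsetSum _ fun k _ => ?_
  have := (Real.tendsto_pow_mul_exp_neg_atTop_nhds_zero k).div_const (k.factorial : ℝ)
  rw [zero_div] at this
  refine this.congr fun y => ?_
  unfold poissonWeight
  ring

lemma hasSum_poissonWeight (s : ℝ) : HasSum (poissonWeight s) 1 := by
  have h1 := (NormedSpace.expSeries_div_hasSum_exp s).mul_left (Real.exp (-s))
  rw [← Real.exp_eq_exp_ℝ, ← Real.exp_add, neg_add_cancel, Real.exp_zero] at h1
  have e : poissonWeight s = fun k : ℕ => Real.exp (-s) * (s ^ k / k.factorial) := by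
    ext k; unfold poissonWeight; ring
  rw [e]; exact h1

/-- The k-th point of a rate-one Poisson process comes after `s` exactly when fewer than `k` points
come before. Analytically, the density is the derivative of minus a partial Poisson sum. -/
lemma erlang_Ioi {s : ℝ} (hs : 0 ≤ s) (k : ℕ) :
    erlang k (Set.Ioi s) = ∑ j ∈ Finset.range k, ENNReal.ofReal (poissonWeight s j) := by
  unfold erlang
  split_ifs with hk
  · simp [hk, hs]
  · rw [← lintegral_indicator_one measurableSet_Ioi,
      lintegral_gammaMeasure_one hk (measurable_one.indicator measurableSet_Ioi)]
    obtain ⟨m, rfl⟩ := Nat.exists_eq_succ_of_ne_zero hk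
    have e : ∀ y, ENNReal.ofReal (y ^ (m.succ - 1) / (m.succ - 1).factorial * Real.exp (-y)) *
        (Set.Ioi s).indicator 1 y =
        (Set.Ioi s).indicator (fun y => ENNReal.ofReal (poissonWeight y m)) y := by
      intro y
      by_cases hy : s < y
      · simp only [Set.indicator, Set.mem_Ioi, hy, if_true, Pi.one_apply, mul_one, poissonWeight]
        congr 1
        simp only [Nat.succ_eq_add_one, Nat.add_sub_cancel]
        ring
      · simp [hy]
    simp_rw [e]
    have hder : ∀ x ∈ Set.Ici s, HasDerivAt
        (fun y => -∑ k ∈ Finset.range (m + 1), poissonWeight y k) (poissonWeight x m) x :=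
      fun x _ => (hasDerivAt_sum_poissonWeight m x).neg.congr_deriv (neg_neg _)
    have hpos : ∀ x ∈ Set.Ioi s, 0 ≤ poissonWeight x m :=
      fun x hx => poissonWeight_nonneg (hs.trans (le_of_lt hx)) m
    have hlim := (tendsto_sum_poissonWeight (m + 1)).neg
    rw [setLIntegral_indicator measurableSet_Ioi, Set.inter_eq_left.2 (Set.Ioi_subset_Ioi hs),
      ← ofReal_integral_eq_lintegral_ofReal (integrableOn_Ioi_deriv_of_nonneg' hder hpos hlim)
        ((ae_restrict_iff' measurableSet_Ioi).2 (Filter.Eventually.of_forall hpos)),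
      integral_Ioi_of_hasDerivAt_of_nonneg' hder hpos hlim,
      ← ENNReal.ofReal_sum_of_nonneg fun k _ => poissonWeight_nonneg hs k]
    congr 1
    ring

/-- The tail of the compound Poisson law in terms of two independent Poisson variables. -/
lemma compoundPoissonAverage_Ioi {l s : ℝ} (hl : 0 ≤ l) (hs : 0 ≤ s) :
    compoundPoissonAverage ((Set.Ioi s).indicator 1) l =
      ∑' j, ENNReal.ofReal (poissonWeight s j) *
        ENNReal.ofReal (1 - ∑ k ∈ Finset.range (j + 1), poissonWeight l k) := by
  unfold compoundPoissonAverage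
  simp_rw [lintegral_indicator_one measurableSet_Ioi, erlang_Ioi hs]
  have e : ∀ k : ℕ, ∑ j ∈ Finset.range k, ENNReal.ofReal (poissonWeight s j) =
      ∑' j, if j < k then ENNReal.ofReal (poissonWeight s j) else 0 := by
    intro k
    rw [tsum_eq_sum (s := Finset.range k)]
    · exact Finset.sum_congr rfl fun j hj => by rw [if_pos (Finset.mem_range.1 hj)]
    · intro j hj
      rw [if_neg fun h => hj (Finset.mem_range.2 h)]
  simp_rw [e, ← ENNReal.tsum_mul_left]
  -- Summing first over the Poisson variable with parameter `l` leaves its tail beyond `j`.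
  rw [ENNReal.tsum_comm]
  refine tsum_congr fun j => ?_
  have e2 : ∀ k, ENNReal.ofReal (poissonWeight l k) *
      (if j < k then ENNReal.ofReal (poissonWeight s j) else 0) =
      ENNReal.ofReal (poissonWeight s j) *
        ENNReal.ofReal (if j < k then poissonWeight l k else 0) := by
    intro k
    split_ifs
    · rw [mul_comm]
    · simp
  simp_rw [e2]
  rw [ENNReal.tsum_mul_left]
  congr 1
  have h1 : HasSum (fun k => if j < k then poissonWeight l k else 0)
      (1 - ∑ k ∈ Finset.range (j + 1), poissonWeight l k) := by
    have h2 := hasSum_sum_of_ne_finset_zero (s := Finset.range (j + 1))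
      (f := fun k => if k < j + 1 then poissonWeight l k else 0) (L := .unconditional ℕ)
      (fun k hk => if_neg fun h => hk (Finset.mem_range.2 h))
    have h3 := (hasSum_poissonWeight l).sub h2
    rw [Finset.sum_congr rfl fun k hk => if_pos (Finset.mem_range.1 hk)] at h3
    have e3 : (fun k => if j < k then poissonWeight l k else 0) =
        fun k => poissonWeight l k - if k < j + 1 then poissonWeight l k else 0 := by
      ext k
      by_cases h : j < k
      · rw [if_pos h, if_neg (by omega), sub_zero]
      · rw [if_neg h, if_pos (by omega), sub_self]
    rw [e3]; exact h3
  rw [← ENNReal.ofReal_tsum_of_nonneg _ h1.summable, h1.tsum_eq]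
  intro k
  split_ifs
  · exact poissonWeight_nonneg hl k
  · exact le_rfl

/-- The normalising constant of the density `r ^ (2 j) exp (- r² / 2)` on the half line. -/
def chiConst (j : ℕ) : ℝ := √(2 / Real.pi) * (2 ^ j * j.factorial / (2 * j).factorial)

lemma chiConst_pos (j : ℕ) : 0 < chiConst j := by
  unfold chiConst
  have : (0 : ℝ) < (2 * j).factorial := by exact_mod_cast (2 * j).factorial_pos
  have : (0 : ℝ) < j.factorial := by exact_mod_cast j.factorial_pos
  have := Real.pi_pos
  positivity

lemma Gamma_nat_add_half_mul (j : ℕ) :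
    Real.Gamma (j + 1 / 2) * (4 ^ j * j.factorial) = (2 * j).factorial * √Real.pi := by
  induction j with
  | zero => simp [-one_div, Real.Gamma_one_half_eq]
  | succ j ih =>
    have h1 : ((j + 1 : ℕ) : ℝ) + 1 / 2 = (j + 1 / 2) + 1 := by push_cast; ring
    rw [h1, Real.Gamma_add_one (by positivity), show 2 * (j + 1) = 2 * j + 1 + 1 by ring,
      Nat.factorial_succ, Nat.factorial_succ, Nat.factorial_succ]
    push_cast
    linear_combination (2 * (j : ℝ) + 1 + 1) * (2 * j + 1) * ih

lemma integral_chi (j : ℕ) :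
    ∫ r in Set.Ioi (0 : ℝ), chiConst j * (r ^ (2 * j) * Real.exp (-(r ^ 2 / 2))) = 1 := by
  rw [integral_const_mul]
  have h := integral_rpow_mul_exp_neg_mul_rpow (p := 2) (q := (2 * j : ℕ)) (b := 1 / 2)
    (by norm_num) (by have : (0 : ℝ) ≤ (2 * j : ℕ) := by positivity
                      linarith) (by norm_num)
  have e : ∀ r ∈ Set.Ioi (0 : ℝ), r ^ (2 * j) * Real.exp (-(r ^ 2 / 2)) =
      r ^ (((2 * j : ℕ) : ℝ)) * Real.exp (-(1 / 2) * r ^ (2 : ℝ)) := by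
    intro r _
    rw [Real.rpow_natCast, Real.rpow_two]
    ring_nf
  rw [setIntegral_congr_fun measurableSet_Ioi e, h]
  have e1 : (((2 * j : ℕ) : ℝ) + 1) / 2 = j + 1 / 2 := by push_cast; ring
  have e2 : (1 / 2 : ℝ) ^ (-(((2 * j : ℕ) : ℝ) + 1) / 2) = 2 ^ j * √2 := by
    rw [neg_div, e1, one_div, Real.inv_rpow (by norm_num), ← Real.rpow_neg (by norm_num), neg_neg,
      Real.rpow_add (by norm_num), Real.rpow_natCast, Real.sqrt_eq_rpow, one_div]
  rw [e2, e1]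
  have hG := Gamma_nat_add_half_mul j
  have h0 : ((2 * j).factorial : ℝ) ≠ 0 := by exact_mod_cast (2 * j).factorial_ne_zero
  have hpi : √Real.pi ≠ 0 := (Real.sqrt_pos.2 Real.pi_pos).ne'
  unfold chiConst
  rw [Real.sqrt_div (by norm_num)]
  have h2 : √2 * √2 = 2 := Real.mul_self_sqrt (by norm_num)
  field_simp
  have h4 : (4 : ℝ) ^ j = 2 ^ j * 2 ^ j := by rw [← mul_pow]; norm_num
  rw [h4] at hG
  rw [show √2 ^ 2 = 2 by rw [sq, h2], show (2 * (j : ℝ) + 1) / 2 = j + 1 / 2 by ring]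
  linear_combination 2 * hG

/-- A comparison of the laws of `χ` variables with `2 j + 2` and with `2 j + 1` degrees of
freedom. -/
lemma one_sub_sum_poissonWeight_le {b : ℝ} (hb : 0 ≤ b) (j : ℕ) :
    1 - ∑ k ∈ Finset.range (j + 1), poissonWeight (b ^ 2 / 2) k ≤
      ∫ r in (0 : ℝ)..b, chiConst j * (r ^ (2 * j) * Real.exp (-(r ^ 2 / 2))) := by
  set h : ℝ → ℝ := fun r => chiConst j * (r ^ (2 * j) * Real.exp (-(r ^ 2 / 2))) with hh
  have hcont : Continuous h := by fun_prop
  -- The difference vanishes at 0 and at infinity. Its derivative changes sign once, from positive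
  -- to negative, at the point `r₀` below, so it is nonnegative throughout.
  set D : ℝ → ℝ := fun b => (∫ r in (0 : ℝ)..b, h r) -
    (1 - ∑ k ∈ Finset.range (j + 1), poissonWeight (b ^ 2 / 2) k) with hD
  have hf0 : (0 : ℝ) < j.factorial := by exact_mod_cast j.factorial_pos
  have hder : ∀ b, HasDerivAt D
      (b ^ (2 * j) * Real.exp (-(b ^ 2 / 2)) * (chiConst j - b / (2 ^ j * j.factorial))) b := by
    intro b
    have h1 := intervalIntegral.integral_hasDerivAt_right (hcont.intervalIntegrable 0 b)
      (hcont.stronglyMeasurableAtFilter _ _) hcont.continuousAt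
    have h2 : HasDerivAt (fun b : ℝ => b ^ 2 / 2) b b := by
      have := (hasDerivAt_pow 2 b).div_const 2
      simpa using this
    have h3 := (hasDerivAt_sum_poissonWeight j (b ^ 2 / 2)).comp b h2
    refine (h1.sub (h3.const_sub 1)).congr_deriv ?_
    simp only [hh, poissonWeight, div_pow]
    rw [show b ^ (2 * j) = (b ^ 2) ^ j by rw [pow_mul]]
    field_simp
  have hDc : Continuous D := continuous_iff_continuousAt.2 fun b => (hder b).continuousAt
  have hD0 : D 0 = 0 := by
    simp only [hD, intervalIntegral.integral_same]
    rw [Finset.sum_range_succ']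
    simp [poissonWeight]
  have hint : IntegrableOn h (Set.Ioi 0) := by
    by_contra hcon
    have h1 := integral_undef hcon
    rw [integral_chi j] at h1
    exact one_ne_zero h1
  have hDlim : Filter.Tendsto D Filter.atTop (nhds 0) := by
    have h1 := intervalIntegral_tendsto_integral_Ioi 0 hint Filter.tendsto_id
    rw [integral_chi j] at h1
    have h2 : Filter.Tendsto (fun b : ℝ => b ^ 2 / 2) Filter.atTop Filter.atTop :=
      (Filter.tendsto_pow_atTop two_ne_zero).atTop_div_const two_pos
    have h3 := (tendsto_sum_poissonWeight (j + 1)).comp h2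
    have h4 := h1.sub (h3.const_sub 1)
    simpa using h4
  suffices 0 ≤ D b by simp only [hD] at this; linarith
  set r₀ := chiConst j * (2 ^ j * j.factorial) with hr₀
  have hr₀pos : 0 < r₀ := mul_pos (chiConst_pos j) (by positivity)
  rcases le_total b r₀ with hbr | hbr
  · have hmono : MonotoneOn D (Set.Icc 0 r₀) := by
      refine monotoneOn_of_deriv_nonneg (convex_Icc 0 r₀) hDc.continuousOn
        (fun x _ => (hder x).differentiableAt.differentiableWithinAt) fun x hx => ?_
      rw [interior_Icc] at hx
      rw [(hder x).deriv]
      have : x / (2 ^ j * j.factorial) ≤ chiConst j := by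
        rw [div_le_iff₀ (by positivity)]; exact hx.2.le
      have hx0 := hx.1
      exact mul_nonneg (by positivity) (by linarith)
    rw [← hD0]
    exact hmono ⟨le_rfl, hr₀pos.le⟩ ⟨hb, hbr⟩ hb
  · have hanti : AntitoneOn D (Set.Ici r₀) := by
      refine antitoneOn_of_deriv_nonpos (convex_Ici r₀) hDc.continuousOn
        (fun x _ => (hder x).differentiableAt.differentiableWithinAt) fun x hx => ?_
      rw [interior_Ici] at hx
      rw [(hder x).deriv]
      have : chiConst j ≤ x / (2 ^ j * j.factorial) := by
        rw [le_div_iff₀ (by positivity)]; exact (Set.mem_Ioi.1 hx).le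
      have hx0 : 0 < x := hr₀pos.trans hx
      exact mul_nonpos_of_nonneg_of_nonpos (by positivity) (by linarith)
    refine le_of_tendsto hDlim ?_
    filter_upwards [Filter.eventually_ge_atTop b] with x hx
    exact hanti hbr (hbr.trans hx) hx

end OneEdge

/-! ### Gaussian domination along one edge. -/

section Domination

/-- For Z ~ N(a,1), |Z| is a noncentral χ variable, a Poisson(a²/2) mixture of χ variables with 2j+1
degrees of freedom. The series over j is the power series of cosh(ar). -/
lemma tsum_poissonWeight_mul_chi (a r : ℝ) :
    ∑' j, ENNReal.ofReal (poissonWeight (a ^ 2 / 2) j) *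
        ENNReal.ofReal (chiConst j * (r ^ (2 * j) * Real.exp (-(r ^ 2 / 2)))) =
      gaussianPDF a 1 r + gaussianPDF a 1 (-r) := by
  have hcst : √(2 / Real.pi) = 2 * (√(2 * Real.pi * (1 : NNReal)))⁻¹ := by
    rw [NNReal.coe_one, mul_one, Real.sqrt_div (by norm_num), Real.sqrt_mul (by norm_num)]
    have h2 : √2 * √2 = 2 := Real.mul_self_sqrt (by norm_num)
    have h3 : √2 ≠ 0 := by positivity
    have h4 : √Real.pi ≠ 0 := (Real.sqrt_pos.2 Real.pi_pos).ne'
    field_simp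
    rw [sq, h2]
  have hs : HasSum (fun j => poissonWeight (a ^ 2 / 2) j *
      (chiConst j * (r ^ (2 * j) * Real.exp (-(r ^ 2 / 2)))))
      (gaussianPDFReal a 1 r + gaussianPDFReal a 1 (-r)) := by
    have h1 := (Real.hasSum_cosh (a * r)).mul_left
      (√(2 / Real.pi) * Real.exp (-(a ^ 2 / 2) - r ^ 2 / 2))
    have e1 : √(2 / Real.pi) * Real.exp (-(a ^ 2 / 2) - r ^ 2 / 2) * Real.cosh (a * r) =
        gaussianPDFReal a 1 r + gaussianPDFReal a 1 (-r) := by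
      simp only [gaussianPDFReal]
      rw [hcst, Real.cosh_eq, NNReal.coe_one,
        show -(r - a) ^ 2 / (2 * 1) = (-(a ^ 2 / 2) - r ^ 2 / 2) + a * r by ring,
        show -(-r - a) ^ 2 / (2 * 1) = (-(a ^ 2 / 2) - r ^ 2 / 2) + -(a * r) by ring,
        Real.exp_add, Real.exp_add (-(a ^ 2 / 2) - r ^ 2 / 2) (-(a * r))]
      ring
    have e2 : (fun j => poissonWeight (a ^ 2 / 2) j *
        (chiConst j * (r ^ (2 * j) * Real.exp (-(r ^ 2 / 2))))) = fun j =>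
        √(2 / Real.pi) * Real.exp (-(a ^ 2 / 2) - r ^ 2 / 2) *
          ((a * r) ^ (2 * j) / (2 * j).factorial) := by
      ext j
      have h0 : ((2 * j).factorial : ℝ) ≠ 0 := by exact_mod_cast (2 * j).factorial_ne_zero
      have h1 : (j.factorial : ℝ) ≠ 0 := by exact_mod_cast j.factorial_ne_zero
      unfold poissonWeight chiConst
      rw [sub_eq_add_neg, Real.exp_add, mul_pow, div_pow, pow_mul a 2 j]
      field_simp
    rw [e2, ← e1]; exact h1
  have hpos : ∀ j, 0 ≤ chiConst j * (r ^ (2 * j) * Real.exp (-(r ^ 2 / 2))) := by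
    intro j
    have := (chiConst_pos j).le
    rw [pow_mul]
    positivity
  simp_rw [← ENNReal.ofReal_mul (poissonWeight_nonneg (by positivity : 0 ≤ a ^ 2 / 2) _)]
  rw [← ENNReal.ofReal_tsum_of_nonneg
    (fun j => mul_nonneg (poissonWeight_nonneg (by positivity) j) (hpos j)) hs.summable, hs.tsum_eq,
    ENNReal.ofReal_add (gaussianPDFReal_nonneg _ _ _) (gaussianPDFReal_nonneg _ _ _)]
  rfl

/-- The χ comparison, averaged over j, bounds the tail by P(|Z| < b) for Z ~ N(a,1); then the lower
constraint on Z is dropped. -/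
lemma compoundPoissonAverage_Ioi_le_gaussianReal {a b : ℝ} (hb : 0 ≤ b) :
    compoundPoissonAverage ((Set.Ioi (a ^ 2 / 2)).indicator 1) (b ^ 2 / 2) ≤
      gaussianReal a 1 (Set.Iio b) := by
  rw [compoundPoissonAverage_Ioi (by positivity) (by positivity)]
  have hm : ∀ j, Measurable fun r : ℝ =>
      ENNReal.ofReal (chiConst j * (r ^ (2 * j) * Real.exp (-(r ^ 2 / 2)))) := fun j => by fun_prop
  have h1 : ∀ j, ENNReal.ofReal
      (1 - ∑ k ∈ Finset.range (j + 1), poissonWeight (b ^ 2 / 2) k) ≤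
      ∫⁻ r in Set.Ioo 0 b,
        ENNReal.ofReal (chiConst j * (r ^ (2 * j) * Real.exp (-(r ^ 2 / 2)))) := by
    intro j
    refine (ENNReal.ofReal_le_ofReal (one_sub_sum_poissonWeight_le hb j)).trans_eq ?_
    rw [intervalIntegral.integral_of_le hb, integral_Ioc_eq_integral_Ioo,
      ofReal_integral_eq_lintegral_ofReal]
    · exact (Continuous.integrableOn_Icc (by fun_prop)).mono_set Set.Ioo_subset_Icc_self
    · refine Filter.Eventually.of_forall fun r => ?_
      have := (chiConst_pos j).le
      simp only [Pi.zero_apply]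
      rw [pow_mul]
      positivity
  calc ∑' j, ENNReal.ofReal (poissonWeight (a ^ 2 / 2) j) * ENNReal.ofReal
        (1 - ∑ k ∈ Finset.range (j + 1), poissonWeight (b ^ 2 / 2) k)
      ≤ ∑' j, ENNReal.ofReal (poissonWeight (a ^ 2 / 2) j) * ∫⁻ r in Set.Ioo 0 b,
          ENNReal.ofReal (chiConst j * (r ^ (2 * j) * Real.exp (-(r ^ 2 / 2)))) := by
        gcongr with j
        exact h1 j
    _ = ∫⁻ r in Set.Ioo 0 b, (gaussianPDF a 1 r + gaussianPDF a 1 (-r)) := by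
        simp_rw [← lintegral_const_mul _ (hm _)]
        rw [← lintegral_tsum fun j => ((hm j).const_mul _).aemeasurable]
        exact lintegral_congr fun r => tsum_poissonWeight_mul_chi a r
    _ = gaussianReal a 1 (Set.Ioo 0 b) + gaussianReal a 1 (Set.Ioo (-b) 0) := by
        rw [lintegral_add_left (measurable_gaussianPDF a 1), gaussianReal_apply _ one_ne_zero,
          gaussianReal_apply _ one_ne_zero]
        congr 1
        have := (Measure.measurePreserving_neg (volume : Measure ℝ)).setLIntegral_comp_preimage
          (measurableSet_Ioo (a := -b) (b := 0)) (measurable_gaussianPDF a 1)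
        rw [← this]
        simp
    _ = gaussianReal a 1 (Set.Ioo 0 b ∪ Set.Ioo (-b) 0) := by
        rw [measure_union _ measurableSet_Ioo]
        refine Set.disjoint_left.2 fun x hx hx' => ?_
        exact absurd hx.1 (not_lt.2 hx'.2.le)
    _ ≤ gaussianReal a 1 (Set.Iio b) := by
        refine measure_mono fun x hx => ?_
        rcases hx with hx | hx
        · exact hx.2
        · exact lt_of_lt_of_le hx.2 hb

/-- Reflection about (a+b)/2. -/
lemma gaussianReal_Iio_eq (a b : ℝ) :
    gaussianReal a 1 (Set.Iio b) = gaussianReal b 1 (Set.Ioi a) := by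
  have h : (gaussianReal b 1).map (fun z => (a + b) - z) = gaussianReal a 1 := by
    rw [gaussianReal_map_const_sub]; congr 1; ring
  rw [← h, Measure.map_apply (by fun_prop) measurableSet_Iio]
  congr 1
  ext z
  simp

/-- The compound Poisson law as a measure. -/
def compoundPoisson (s : ℝ) : Measure ℝ :=
  Measure.sum fun k => ENNReal.ofReal (poissonWeight s k) • erlang k

instance (s : ℝ) : SFinite (compoundPoisson s) := by
  have : ∀ k, SFinite (ENNReal.ofReal (poissonWeight s k) • erlang k) := fun k => inferInstance
  unfold compoundPoisson; infer_instance

lemma lintegral_compoundPoisson (f : ℝ → ℝ≥0∞) (s : ℝ) :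
    ∫⁻ y, f y ∂(compoundPoisson s) = compoundPoissonAverage f s := by
  unfold compoundPoisson compoundPoissonAverage
  rw [lintegral_sum_measure]
  simp_rw [lintegral_smul_measure, smul_eq_mul]

/-- A nonempty upper set bounded below is an open or a closed half-line. A closed one is a
decreasing intersection of open ones with end points still at least `r₀`, and finiteness of `ν` lets
the bound pass to the limit. -/
lemma measure_le_of_isUpperSet {μ ν : Measure ℝ} [IsFiniteMeasure ν] {r₀ : ℝ}
    (h : ∀ a, r₀ ≤ a → μ (Set.Ioi a) ≤ ν (Set.Ioi a)) {U : Set ℝ} (hU : IsUpperSet U)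
    (hU₀ : U ⊆ Set.Ioi r₀) : μ U ≤ ν U := by
  rcases U.eq_empty_or_nonempty with rfl | hne
  · simp
  have hbdd : BddBelow U := ⟨r₀, fun x hx => (hU₀ hx).le⟩
  set a := sInf U with ha
  have har : r₀ ≤ a := le_csInf hne fun x hx => (hU₀ hx).le
  have hsub : Set.Ioi a ⊆ U := by
    intro x hx
    obtain ⟨y, hy, hyx⟩ := exists_lt_of_csInf_lt hne hx
    exact hU hyx.le hy
  by_cases haU : a ∈ U
  · have hUa : U = Set.Ici a := by
      refine Set.Subset.antisymm (fun x hx => csInf_le hbdd hx) fun x hx => ?_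
      exact hU hx haU
    have hlt : r₀ < a := hU₀ haU
    rw [hUa]
    set f : ℕ → ℝ := fun n => a - (a - r₀) / (n + 1) with hf
    have hfa : ∀ n, f n < a := fun n => by
      have : 0 < (a - r₀) / ((n : ℝ) + 1) := div_pos (by linarith) (by positivity)
      simp only [hf]; linarith
    have hfr : ∀ n, r₀ ≤ f n := fun n => by
      have : (a - r₀) / ((n : ℝ) + 1) ≤ a - r₀ :=
        div_le_self (by linarith) (by have : (0 : ℝ) ≤ n := by positivity
                                      linarith)
      simp only [hf]; linarith
    have hanti : Antitone fun n => Set.Ioi (f n) := by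
      intro m n hmn
      refine Set.Ioi_subset_Ioi ?_
      simp only [hf]
      have : (m : ℝ) ≤ n := by exact_mod_cast hmn
      gcongr
    have hinter : ⋂ n, Set.Ioi (f n) = Set.Ici a := by
      ext x
      simp only [Set.mem_iInter, Set.mem_Ioi, Set.mem_Ici]
      refine ⟨fun hx => ?_, fun hx n => (hfa n).trans_le hx⟩
      have hlim : Filter.Tendsto f Filter.atTop (nhds (a - 0)) := by
        refine Filter.Tendsto.const_sub a ?_
        have := (tendsto_one_div_add_atTop_nhds_zero_nat (𝕜 := ℝ)).const_mul (a - r₀)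
        simpa [div_eq_mul_inv] using this
      rw [sub_zero] at hlim
      exact le_of_tendsto' hlim fun n => (hx n).le
    have hlim := tendsto_measure_iInter_atTop (μ := ν) (s := fun n => Set.Ioi (f n))
      (fun n => measurableSet_Ioi.nullMeasurableSet) hanti ⟨0, measure_ne_top _ _⟩
    rw [hinter] at hlim
    refine ge_of_tendsto' hlim fun n => ?_
    exact (measure_mono fun x hx => (hfa n).trans_le hx).trans (h _ (hfr n))
  · have hUa : U = Set.Ioi a := by
      refine Set.Subset.antisymm (fun x hx => lt_of_le_of_ne (csInf_le hbdd hx) ?_) hsub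
      rintro rfl
      exact haU hx
    rw [hUa]
    exact h a har

/-- Layer cake formula: Tonelli on the region below the graph of `g`. The measure is only s-finite
so as to cover `compoundPoisson`. -/
lemma lintegral_eq_lintegral_measure_lt {μ : Measure ℝ} [SFinite μ] {g : ℝ → ℝ≥0∞}
    (hg : Measurable g) :
    ∫⁻ x, g x ∂μ = ∫⁻ c in Set.Ioi (0 : ℝ), μ {x | ENNReal.ofReal c < g x} := by
  have hms : MeasurableSet {q : ℝ × ℝ | ENNReal.ofReal q.2 < g q.1} :=
    measurableSet_lt (by fun_prop) (by fun_prop)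
  have h1 : ∀ x, g x = ∫⁻ c in Set.Ioi (0 : ℝ),
      {q : ℝ × ℝ | ENNReal.ofReal q.2 < g q.1}.indicator 1 (x, c) := by
    intro x
    have e : ∀ c : ℝ, {q : ℝ × ℝ | ENNReal.ofReal q.2 < g q.1}.indicator (1 : ℝ × ℝ → ℝ≥0∞) (x, c) =
        {c : ℝ | ENNReal.ofReal c < g x}.indicator 1 c := fun c => rfl
    simp_rw [e]
    rw [lintegral_indicator_one (measurableSet_lt (by fun_prop) measurable_const),
      Measure.restrict_apply (measurableSet_lt (by fun_prop) measurable_const)]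
    rcases eq_or_ne (g x) ⊤ with hx | hx
    · have : {c : ℝ | ENNReal.ofReal c < g x} ∩ Set.Ioi 0 = Set.Ioi 0 := by
        ext c; simp [hx]
      rw [this, hx, Real.volume_Ioi]
    · have : {c : ℝ | ENNReal.ofReal c < g x} ∩ Set.Ioi 0 = Set.Ioo 0 (g x).toReal := by
        ext c
        simp only [Set.mem_inter_iff, Set.mem_ofPred_eq, Set.mem_Ioi, Set.mem_Ioo]
        constructor
        · rintro ⟨h1, h2⟩
          exact ⟨h2, (ENNReal.ofReal_lt_iff_lt_toReal h2.le hx).1 h1⟩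
        · rintro ⟨h1, h2⟩
          exact ⟨(ENNReal.ofReal_lt_iff_lt_toReal h1.le hx).2 h2, h1⟩
      rw [this, Real.volume_Ioo, sub_zero, ENNReal.ofReal_toReal hx]
  rw [lintegral_congr h1, lintegral_lintegral_swap]
  · refine lintegral_congr fun c => ?_
    have e : ∀ x : ℝ, {q : ℝ × ℝ | ENNReal.ofReal q.2 < g q.1}.indicator (1 : ℝ × ℝ → ℝ≥0∞) (x, c) =
        {x : ℝ | ENNReal.ofReal c < g x}.indicator 1 x := fun c => rfl
    simp_rw [e]
    exact lintegral_indicator_one (measurableSet_lt measurable_const hg)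
  · exact (measurable_one.indicator hms).aemeasurable

/-- The superlevel sets of `g` are upper sets contained in (r₀, ∞), so the comparison of tails
applies to each layer. -/
lemma lintegral_le_of_monotone {μ ν : Measure ℝ} [SFinite μ] [IsFiniteMeasure ν] {r₀ : ℝ}
    (h : ∀ a, r₀ ≤ a → μ (Set.Ioi a) ≤ ν (Set.Ioi a)) {g : ℝ → ℝ≥0∞} (hg : Monotone g)
    (hg₀ : ∀ x ≤ r₀, g x = 0) : ∫⁻ x, g x ∂μ ≤ ∫⁻ x, g x ∂ν := by
  rw [lintegral_eq_lintegral_measure_lt hg.measurable,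
    lintegral_eq_lintegral_measure_lt hg.measurable]
  refine lintegral_mono fun c => measure_le_of_isUpperSet h ?_ ?_
  · exact fun x y hxy hx => lt_of_lt_of_le hx (hg hxy)
  · intro x hx
    by_contra hcon
    have h0 := hg₀ x (not_lt.1 hcon)
    simp only [Set.mem_ofPred_eq, h0] at hx
    exact not_lt_zero hx

/-- Along one edge, the square root of the doubled local time is dominated by a Gaussian step. -/
theorem compoundPoissonAverage_le_gaussian {r₀ : ℝ} (hr₀ : 0 ≤ r₀) {g : ℝ → ℝ≥0∞}
    (hg : Monotone g) (hg₀ : ∀ x ≤ r₀, g x = 0) {l : ℝ} (hl : 0 ≤ l) :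
    compoundPoissonAverage (fun y => g √(2 * y)) l ≤
      ∫⁻ z, g (√(2 * l) + z) ∂(gaussianReal 0 1) := by
  have hsm : Measurable fun y : ℝ => √(2 * y) := by fun_prop
  have hadd : Measurable fun z : ℝ => √(2 * l) + z := by fun_prop
  have h1 : compoundPoissonAverage (fun y => g √(2 * y)) l =
      ∫⁻ x, g x ∂((compoundPoisson l).map fun y => √(2 * y)) := by
    rw [lintegral_map hg.measurable hsm, lintegral_compoundPoisson]
  have h2 : ∫⁻ z, g (√(2 * l) + z) ∂(gaussianReal 0 1) = ∫⁻ x, g x ∂(gaussianReal √(2 * l) 1) := by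
    rw [← lintegral_map hg.measurable hadd, gaussianReal_map_const_add, zero_add]
  rw [h1, h2]
  refine lintegral_le_of_monotone (fun a ha => ?_) hg hg₀
  have ha0 : 0 ≤ a := hr₀.trans ha
  -- Here `0 ≤ a` matters: for negative `a` the preimage is the whole line, while a Gaussian tail is
  -- below 1.
  have hpre : (fun y : ℝ => √(2 * y)) ⁻¹' Set.Ioi a = Set.Ioi (a ^ 2 / 2) := by
    ext y
    simp only [Set.mem_preimage, Set.mem_Ioi]
    rw [Real.lt_sqrt ha0]
    constructor <;> intro h <;> linarith
  have hsq : l = √(2 * l) ^ 2 / 2 := by rw [Real.sq_sqrt (by positivity)]; ring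
  rw [Measure.map_apply hsm measurableSet_Ioi, hpre, ← gaussianReal_Iio_eq,
    ← lintegral_indicator_one measurableSet_Ioi, lintegral_compoundPoisson]
  conv_lhs => rw [hsq]
  exact compoundPoissonAverage_Ioi_le_gaussianReal (Real.sqrt_nonneg _)

end Domination

/-! ### The free field in increment coordinates and its Markov property. -/

section FreeField

variable {V : Type*} [Fintype V] [DecidableEq V] {T : SimpleGraph V} [DecidableRel T.Adj] {v₀ : V}

@[simp] lemma extendZero_root (x : {v : V // v ≠ v₀} → ℝ) : extendZero v₀ x v₀ = 0 := by
  simp [extendZero]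

lemma extendZero_of_ne (x : {v : V // v ≠ v₀} → ℝ) {v : V} (hv : v ≠ v₀) :
    extendZero v₀ x v = x ⟨v, hv⟩ := by
  simp [extendZero, hv]

lemma measurable_extendZero : Measurable (extendZero v₀ : ({v : V // v ≠ v₀} → ℝ) → V → ℝ) := by
  refine measurable_pi_lambda _ fun v => ?_
  by_cases hv : v = v₀
  · subst hv; simp
  · simp only [extendZero_of_ne _ hv]
    exact measurable_pi_apply _

/-- The Dirichlet energy of a tree is the sum of the squares of the increments along the edges
from a vertex to its parent. -/
lemma sum_sum_conductance_mul_sq (hT : T.IsTree) (x : V → ℝ) :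
    ∑ u, ∑ v, conductance T u v * |x u - x v| ^ 2 =
      2 * ∑ v : {v : V // v ≠ v₀}, (x v - x (parent T v₀ v)) ^ 2 := by
  have h1 : ∑ v : {v : V // v ≠ v₀}, (x v - x (parent T v₀ v)) ^ 2 =
      ∑ v, if v = v₀ then 0 else (x v - x (parent T v₀ v)) ^ 2 := by
    rw [← Finset.sum_subtype (Finset.univ.filter fun v => v ≠ v₀) (by simp)
      (fun v => (x v - x (parent T v₀ v)) ^ 2), Finset.sum_filter]
    exact Finset.sum_congr rfl fun v _ => by by_cases h : v = v₀ <;> simp [h]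
  have h2 : ∑ u, ∑ z ∈ children T v₀ u, (x u - x z) ^ 2 =
      ∑ v, if v = v₀ then 0 else (x v - x (parent T v₀ v)) ^ 2 := by
    have h3 : ∀ u, ∑ z ∈ children T v₀ u, (x u - x z) ^ 2 =
        ∑ z, if z ≠ v₀ ∧ parent T v₀ z = u then (x u - x z) ^ 2 else 0 := by
      intro u
      rw [← Finset.sum_filter]
      refine Finset.sum_congr ?_ fun _ _ => rfl
      ext z
      simp [mem_children_iff_parent hT]
    simp_rw [h3]
    rw [Finset.sum_comm]
    refine Finset.sum_congr rfl fun z _ => ?_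
    by_cases h : z = v₀
    · simp [h]
    · simp only [ne_eq, h, not_false_eq_true, true_and, Finset.sum_ite_eq, Finset.mem_univ, if_true,
        if_false]
      ring
  simp_rw [sq_abs]
  -- Each edge is counted twice, from the child to the parent and from the parent to the child.
  simp_rw [sum_conductance_mul (v₀ := v₀) hT _ fun v => (x _ - x v) ^ 2]
  rw [Finset.sum_add_distrib, h1, h2]
  ring

/-- The increments of a field vanishing at the root along the edges from a vertex to its parent. -/
def increment (T : SimpleGraph V) (v₀ : V) :
    ({v : V // v ≠ v₀} → ℝ) →ₗ[ℝ] ({v : V // v ≠ v₀} → ℝ) where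
  toFun x v := extendZero v₀ x v - extendZero v₀ x (parent T v₀ v)
  map_add' x y := by
    ext v
    simp only [extendZero, Pi.add_apply]
    split_ifs <;> ring
  map_smul' c x := by
    ext v
    simp only [extendZero, Pi.smul_apply, smul_eq_mul, RingHom.id_apply]
    split_ifs <;> ring

lemma increment_apply (x : {v : V // v ≠ v₀} → ℝ) (v : {v : V // v ≠ v₀}) :
    increment T v₀ x v = extendZero v₀ x v - extendZero v₀ x (parent T v₀ v) := rfl

/-- Two fields whose increments agree on a set closed under taking parents agree on this set. -/
lemma extendZero_congr (hT : T.IsTree) {A : Finset V}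
    (hA : ∀ z ∈ A, z ≠ v₀ → parent T v₀ z ∈ A) {x x' : {v : V // v ≠ v₀} → ℝ}
    (h : ∀ v (hv : v ≠ v₀), v ∈ A → increment T v₀ x ⟨v, hv⟩ = increment T v₀ x' ⟨v, hv⟩) :
    ∀ v ∈ A, extendZero v₀ x v = extendZero v₀ x' v := by
  have key : ∀ n, ∀ v ∈ A, T.dist v₀ v ≤ n → extendZero v₀ x v = extendZero v₀ x' v := by
    intro n
    induction n with
    | zero =>
      intro v _ hd
      have : v₀ = v := (hT.connected.dist_eq_zero_iff).1 (Nat.le_zero.1 hd)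
      subst this
      simp
    | succ n ih =>
      intro v hv hd
      by_cases h0 : v = v₀
      · subst h0; simp
      · have h1 := dist_parent_lt hT h0
        have h2 := ih _ (hA v hv h0) (by omega)
        have h3 := h v h0 hv
        rw [increment_apply, increment_apply, h2] at h3
        linarith
  exact fun v hv => key _ v hv le_rfl

lemma increment_injective (hT : T.IsTree) : Function.Injective (increment T v₀) := by
  intro x x' h
  have := extendZero_congr hT (A := Finset.univ) (by simp) (x := x) (x' := x')
    fun v hv _ => by rw [h]
  ext v
  have hv := this v (Finset.mem_univ _)
  rwa [extendZero_of_ne _ v.2, extendZero_of_ne _ v.2] at hv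

/-- The field vanishing at the root with given increments. -/
def ofIncrement (hT : T.IsTree) :
    ({v : V // v ≠ v₀} → ℝ) →ₗ[ℝ] ({v : V // v ≠ v₀} → ℝ) :=
  (LinearEquiv.ofInjectiveEndo (increment T v₀) (increment_injective hT)).symm.toLinearMap

lemma increment_ofIncrement (hT : T.IsTree) (y : {v : V // v ≠ v₀} → ℝ) :
    increment T v₀ (ofIncrement hT y) = y :=
  (LinearEquiv.ofInjectiveEndo (increment T v₀) (increment_injective hT)).apply_symm_apply y

lemma ofIncrement_increment (hT : T.IsTree) (x : {v : V // v ≠ v₀} → ℝ) :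
    ofIncrement hT (increment T v₀ x) = x :=
  (LinearEquiv.ofInjectiveEndo (increment T v₀) (increment_injective hT)).symm_apply_apply x

lemma measurable_increment : Measurable (increment T v₀) :=
  (LinearMap.continuous_of_finiteDimensional _).measurable

lemma measurable_ofIncrement (hT : T.IsTree) : Measurable (ofIncrement (v₀ := v₀) hT) :=
  (LinearMap.continuous_of_finiteDimensional _).measurable

/-- The factor 1/4 and the double counting of edges give 1/2, so in increment coordinates the
density is a product of standard Gaussian weights. -/
lemma gffDensity_eq (hT : T.IsTree) (x : {v : V // v ≠ v₀} → ℝ) :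
    gffDensity T v₀ x = ∏ v, Real.exp (-(increment T v₀ x v) ^ 2 / 2) := by
  rw [gffDensity, sum_sum_conductance_mul_sq (v₀ := v₀) hT, ← Real.exp_sum]
  congr 1
  simp_rw [increment_apply]
  rw [← mul_assoc, Finset.mul_sum]
  exact Finset.sum_congr rfl fun v _ => by ring

lemma measurable_gffDensity (hT : T.IsTree) :
    Measurable (gffDensity T v₀) := by
  rw [funext (gffDensity_eq hT)]
  refine Finset.measurable_prod _ fun v _ => ?_
  have := (measurable_pi_apply v).comp (measurable_increment (T := T) (v₀ := v₀))
  exact (((this.pow_const 2).neg).div_const 2).exp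

/-- Under the Gaussian free field, the increments have density proportional to
`∏ v, exp (- y v ^ 2 / 2)`. -/
lemma exists_lintegral_gffMeasure (hT : T.IsTree) :
    ∃ c : ℝ≥0∞, ∀ f : ({v : V // v ≠ v₀} → ℝ) → ℝ≥0∞, Measurable f →
      ∫⁻ x, f x ∂gffMeasure T v₀ =
        c * ∫⁻ y, f (ofIncrement hT y) * ∏ v, ENNReal.ofReal (Real.exp (-(y v) ^ 2 / 2)) := by
  have hdet : LinearMap.det (increment T v₀) ≠ 0 := by
    have := (LinearEquiv.ofInjectiveEndo (increment T v₀) (increment_injective hT)).isUnit_det'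
    exact this.ne_zero
  have hmap := Real.map_linearMap_volume_pi_eq_smul_volume_pi hdet
  -- Normalisation and Jacobian are never evaluated: the same constant stands on both sides of the
  -- Markov property.
  refine ⟨(∫⁻ x, ENNReal.ofReal (gffDensity T v₀ x))⁻¹ *
    ENNReal.ofReal |(LinearMap.det (increment T v₀))⁻¹|, fun f hf => ?_⟩
  have hρ : Measurable fun y : {v : V // v ≠ v₀} → ℝ =>
      ∏ v, ENNReal.ofReal (Real.exp (-(y v) ^ 2 / 2)) := by fun_prop
  rw [gffMeasure, lintegral_smul_measure, lintegral_withDensity_eq_lintegral_mul _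
    (measurable_gffDensity hT).ennreal_ofReal hf, smul_eq_mul, mul_assoc]
  congr 1
  have hG : Measurable fun y => f (ofIncrement hT y) *
      ∏ v, ENNReal.ofReal (Real.exp (-(y v) ^ 2 / 2)) :=
    (hf.comp (measurable_ofIncrement hT)).mul hρ
  rw [← smul_eq_mul (a := ENNReal.ofReal _), ← lintegral_smul_measure, ← hmap,
    lintegral_map hG measurable_increment]
  refine lintegral_congr fun x => ?_
  rw [ofIncrement_increment, Pi.mul_apply, gffDensity_eq hT,
    ENNReal.ofReal_prod_of_nonneg fun _ _ => (Real.exp_pos _).le, mul_comm]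

lemma ofReal_exp_neg_sq (z : ℝ) : ENNReal.ofReal (Real.exp (-z ^ 2 / 2)) =
    ENNReal.ofReal √(2 * Real.pi) * gaussianPDF 0 1 z := by
  rw [gaussianPDF, gaussianPDFReal, ← ENNReal.ofReal_mul (by positivity)]
  congr 1
  have : √(2 * Real.pi) ≠ 0 := by positivity
  simp
  field_simp

/-- Integrating one coordinate first under a Gaussian weight. -/
lemma lintegral_mul_prod_exp_neg_sq {ι : Type*} [Fintype ι] [DecidableEq ι] (i : ι)
    {G : (ι → ℝ) → ℝ≥0∞} (hG : Measurable G) :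
    ∫⁻ y, G y * ∏ v, ENNReal.ofReal (Real.exp (-(y v) ^ 2 / 2)) =
      ∫⁻ y, (∫⁻ z, G (Function.update y i z) ∂gaussianReal 0 1) *
        ∏ v, ENNReal.ofReal (Real.exp (-(y v) ^ 2 / 2)) := by
  have hρ : Measurable fun y : ι → ℝ =>
      ∏ v, ENNReal.ofReal (Real.exp (-(y v) ^ 2 / 2)) := by fun_prop
  have hG' : Measurable fun y : ι → ℝ => ∫⁻ z, G (Function.update y i z) ∂gaussianReal 0 1 := by
    refine Measurable.lintegral_prod_right' (f := fun p : (ι → ℝ) × ℝ =>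
      G (Function.update p.1 i p.2)) ?_
    exact hG.comp measurable_update'
  -- It suffices that the two integrands agree after integration over coordinate `i`, where the
  -- weight factors and the new integrand depends on `y i` only through it.
  refine lintegral_eq_of_lmarginal_eq (μ := fun _ => volume) {i} (hG.mul hρ) (hG'.mul hρ) ?_
  ext y
  rw [lmarginal_singleton, lmarginal_singleton]
  have hu : ∀ z, ∏ v, ENNReal.ofReal (Real.exp (-(Function.update y i z v) ^ 2 / 2)) =
      ENNReal.ofReal √(2 * Real.pi) *
        (∏ v ∈ Finset.univ.erase i, ENNReal.ofReal (Real.exp (-(y v) ^ 2 / 2))) *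
        gaussianPDF 0 1 z := by
    intro z
    rw [← Finset.mul_prod_erase _ _ (Finset.mem_univ i), Function.update_self, ofReal_exp_neg_sq]
    rw [Finset.prod_congr rfl fun v hv => by
      rw [Function.update_of_ne (Finset.ne_of_mem_erase hv)]]
    ring
  simp only [hu, Function.update_idem]
  set r := ENNReal.ofReal √(2 * Real.pi) *
        (∏ v ∈ Finset.univ.erase i, ENNReal.ofReal (Real.exp (-(y v) ^ 2 / 2)))
  have hGy : Measurable fun z => G (Function.update y i z) := hG.comp (measurable_update y)
  have hpdf := measurable_gaussianPDF 0 1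
  rw [lintegral_const_mul _ (by fun_prop), lintegral_const_mul _ hpdf,
    lintegral_gaussianPDF_eq_one _ one_ne_zero, gaussianReal_of_var_ne_zero _ one_ne_zero,
    lintegral_withDensity_eq_lintegral_mul _ hpdf hGy, mul_one]
  simp_rw [← mul_assoc]
  rw [mul_comm, ← lintegral_const_mul _ (hpdf.mul hGy)]
  refine lintegral_congr fun z => ?_
  simp only [Pi.mul_apply]
  ring

/-- The spatial Markov property of the Gaussian free field on a tree: given its values on a set
closed under taking parents, its value at a child of this set is Gaussian with unit variance
around the value at the parent. -/
lemma lintegral_gffMeasure_markov (hT : T.IsTree) {A : Finset V} {w : V}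
    (hA : ∀ z ∈ A, z ≠ v₀ → parent T v₀ z ∈ A) (hv₀ : v₀ ∈ A) (hw : w ∉ A)
    (hpw : parent T v₀ w ∈ A) {F : (V → ℝ) → ℝ≥0∞} (hF : Measurable F)
    (hFA : ∀ x x' : V → ℝ, (∀ v ∈ insert w A, x v = x' v) → F x = F x') :
    ∫⁻ x, F (extendZero v₀ x) ∂gffMeasure T v₀ =
      ∫⁻ x, ∫⁻ z, F (Function.update (extendZero v₀ x) w
        (extendZero v₀ x (parent T v₀ w) + z)) ∂gaussianReal 0 1 ∂gffMeasure T v₀ := by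
  obtain ⟨c, hc⟩ := exists_lintegral_gffMeasure (v₀ := v₀) hT
  have hwv : w ≠ v₀ := fun h => hw (h ▸ hv₀)
  have hE := measurable_extendZero (v₀ := v₀)
  have hm : Measurable fun x => ∫⁻ z, F (Function.update (extendZero v₀ x) w
        (extendZero v₀ x (parent T v₀ w) + z)) ∂gaussianReal 0 1 := by
    refine Measurable.lintegral_prod_right' (f := fun p : ({v : V // v ≠ v₀} → ℝ) × ℝ =>
      F (Function.update (extendZero v₀ p.1) w (extendZero v₀ p.1 (parent T v₀ w) + p.2))) ?_
    refine hF.comp (measurable_update'.comp ((hE.comp measurable_fst).prodMk ?_))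
    exact ((measurable_pi_apply _).comp (hE.comp measurable_fst)).add measurable_snd
  have hFE : Measurable fun x => F (extendZero v₀ x) := hF.comp hE
  have hG : Measurable fun y => F (extendZero v₀ (ofIncrement hT y)) :=
    hFE.comp (measurable_ofIncrement hT)
  rw [hc _ hFE, hc _ hm]
  congr 1
  rw [lintegral_mul_prod_exp_neg_sq ⟨w, hwv⟩ hG]
  refine lintegral_congr fun y => ?_
  congr 1
  refine lintegral_congr fun z => hFA _ _ ?_
  -- Values on `A` are determined by the increments at vertices of `A`, so changing the increment at
  -- `w` does not affect them.
  have hagree : ∀ v ∈ A, extendZero v₀ (ofIncrement hT (Function.update y ⟨w, hwv⟩ z)) v =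
      extendZero v₀ (ofIncrement hT y) v := by
    refine extendZero_congr hT hA fun v hv hvA => ?_
    rw [increment_ofIncrement, increment_ofIncrement, Function.update_of_ne]
    rintro h
    obtain rfl : v = w := congrArg Subtype.val h
    exact hw hvA
  intro v hv
  rcases Finset.mem_insert.1 hv with rfl | hvA
  · rw [Function.update_self, ← hagree _ hpw]
    have h1 := congrFun (increment_ofIncrement hT (Function.update y ⟨v, hwv⟩ z)) ⟨v, hwv⟩
    rw [Function.update_self, increment_apply] at h1
    linarith
  · rw [Function.update_of_ne (by rintro rfl; exact hw hvA)]
    exact hagree v hvA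

lemma IsGFF.lintegral_eq {Ω : Type*} [MeasurableSpace Ω] {P : Measure Ω} {η : V → Ω → ℝ}
    (hη : IsGFF T v₀ η P) {F : (V → ℝ) → ℝ≥0∞} (hF : Measurable F) :
    ∫⁻ ω, F (fun v => η v ω) ∂P = ∫⁻ x, F (extendZero v₀ x) ∂gffMeasure T v₀ := by
  have hFE : Measurable fun x => F (extendZero v₀ x) := hF.comp measurable_extendZero
  rw [← hη.law.map_eq, lintegral_map' hFE.aemeasurable hη.law.aemeasurable]
  refine lintegral_congr_ae ?_
  filter_upwards [hη.root] with ω hω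
  congr 1
  ext v
  by_cases hv : v = v₀
  · subst hv; simpa using hω
  · rw [extendZero_of_ne _ hv]

/-- The spatial Markov property of the Gaussian free field on a tree. -/
lemma IsGFF.lintegral_markov (hT : T.IsTree) {Ω : Type*} [MeasurableSpace Ω] {P : Measure Ω}
    {η : V → Ω → ℝ} (hη : IsGFF T v₀ η P) {A : Finset V} {w : V}
    (hA : ∀ z ∈ A, z ≠ v₀ → parent T v₀ z ∈ A) (hv₀ : v₀ ∈ A) (hw : w ∉ A)
    (hpw : parent T v₀ w ∈ A) {F : (V → ℝ) → ℝ≥0∞} (hF : Measurable F)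
    (hFA : ∀ x x' : V → ℝ, (∀ v ∈ insert w A, x v = x' v) → F x = F x') :
    ∫⁻ ω, F (fun v => η v ω) ∂P = ∫⁻ ω, ∫⁻ z, F (Function.update (fun v => η v ω) w
        (η (parent T v₀ w) ω + z)) ∂gaussianReal 0 1 ∂P := by
  rw [hη.lintegral_eq hF, lintegral_gffMeasure_markov hT hA hv₀ hw hpw hF hFA]
  refine (hη.lintegral_eq (F := fun x => ∫⁻ z, F (Function.update x w
    (x (parent T v₀ w) + z)) ∂gaussianReal 0 1) ?_).symm
  refine Measurable.lintegral_prod_right' (f := fun p : (V → ℝ) × ℝ =>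
    F (Function.update p.1 w (p.1 (parent T v₀ w) + p.2))) ?_
  refine hF.comp (measurable_update'.comp (measurable_fst.prodMk ?_))
  exact ((measurable_pi_apply _).comp measurable_fst).add measurable_snd

end FreeField

lemma compoundPoissonAverage_const_mul (c : ℝ≥0∞) {f : ℝ → ℝ≥0∞} (hf : Measurable f) (s : ℝ) :
    compoundPoissonAverage (fun y => c * f y) s = c * compoundPoissonAverage f s := by
  unfold compoundPoissonAverage
  rw [← ENNReal.tsum_mul_left]
  refine tsum_congr fun k => ?_
  rw [lintegral_const_mul _ hf]
  ring

/-! ### The induction over the tree. -/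

section Comparison

variable {V : Type*} [Fintype V] [DecidableEq V] [Nontrivial V] [MeasurableSpace V]
  [MeasurableSingletonClass V] {T : SimpleGraph V} [DecidableRel T.Adj] {v₀ : V}
  {Ω : Type*} [MeasurableSpace Ω] {P : Measure Ω} [IsProbabilityMeasure P]
  {Ω' : Type*} [MeasurableSpace Ω'] {P' : Measure Ω'} [IsProbabilityMeasure P']
  {S : ℕ → Ω → V} {J : ℕ → Ω → ℝ} {η : V → Ω' → ℝ}

/-- The local times at the inverse local time, on the scale `√(2 L)`, are dominated by the shifted
Gaussian free field, when tested against products of increasing functions vanishing below a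
nonnegative level. -/
theorem lintegral_prod_localField_le (hT : T.IsTree) (hS : IsDiscreteWalk T v₀ S P)
    (hJ : IsHoldingTimes J P) (hSJ : IndepFun (fun ω n => S n ω) (fun ω n => J n ω) P)
    (hη : IsGFF T v₀ η P') {t r₀ : ℝ} (ht : 0 ≤ t) (hr₀ : 0 ≤ r₀) (A : Finset V) (hv₀ : v₀ ∈ A)
    (hA : ∀ z ∈ A, z ≠ v₀ → parent T v₀ z ∈ A) (g : V → ℝ → ℝ≥0∞) (hg : ∀ v, Monotone (g v))
    (hg₀ : ∀ v, ∀ x ≤ r₀, g v x = 0) :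
    ∫⁻ ω, ∏ v ∈ A, g v √(2 * localField T v₀ S J t ω v) ∂P ≤
      ∫⁻ ω, ∏ v ∈ A, g v (√(2 * t) + η v ω) ∂P' := by
  induction hn : A.card using Nat.strong_induction_on generalizing A g with
  | _ n ih =>
  by_cases hne : (A.erase v₀).Nonempty
  -- A vertex of `A` farthest from the root has no child in `A`, so its removal keeps `A` closed
  -- under parents.
  · obtain ⟨w, hwA, hmax⟩ := Finset.exists_max_image _ (T.dist v₀) hne
    have hw₀ : w ≠ v₀ := Finset.ne_of_mem_erase hwA
    replace hwA : w ∈ A := Finset.mem_of_mem_erase hwA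
    set B := A.erase w with hB
    set u := parent T v₀ w with hu
    have hwB : w ∉ B := Finset.notMem_erase _ _
    have hAB : A = insert w B := (Finset.insert_erase hwA).symm
    have hBv₀ : v₀ ∈ B := Finset.mem_erase.2 ⟨hw₀.symm, hv₀⟩
    have huw : u ≠ w := fun h => by
      have := dist_parent_lt hT hw₀
      rw [← hu, h] at this
      exact this.false
    have huB : u ∈ B := Finset.mem_erase.2 ⟨huw, hA w hwA hw₀⟩
    have hBc : ∀ z ∈ B, z ≠ v₀ → parent T v₀ z ∈ B := by
      intro z hz hz₀
      have hzA := Finset.mem_of_mem_erase hz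
      refine Finset.mem_erase.2 ⟨fun h => ?_, hA z hzA hz₀⟩
      have h1 := dist_parent_lt hT hz₀
      have h2 := hmax z (Finset.mem_erase.2 ⟨hz₀, hzA⟩)
      rw [h] at h1
      omega
    set q : ℝ → ℝ≥0∞ := fun r => ∫⁻ z, g w (r + z) ∂gaussianReal 0 1 with hq
    have hqm : Monotone q := fun a b hab => lintegral_mono fun z => hg w (by linarith)
    -- The Gaussian average `q` of the factor at `w` is absorbed into the factor at the parent. The
    -- product is still increasing, and the old factor makes it vanish below `r₀`, which `q` alone
    -- does not.
    set g' : V → ℝ → ℝ≥0∞ := fun v r => g v r * if v = u then q r else 1 with hg'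
    have hg'm : ∀ v, Monotone (g' v) := by
      intro v a b hab
      simp only [hg']
      split_ifs
      · exact mul_le_mul' (hg v hab) (hqm hab)
      · exact mul_le_mul' (hg v hab) le_rfl
    have hg'₀ : ∀ v, ∀ x ≤ r₀, g' v x = 0 := fun v x hx => by simp [hg', hg₀ v x hx]
    have hprod : ∀ f : V → ℝ, ∏ v ∈ B, g' v (f v) = (∏ v ∈ B, g v (f v)) * q (f u) := by
      intro f
      simp only [hg']
      rw [Finset.prod_mul_distrib, Finset.prod_ite_eq' B u fun v => q (f v), if_pos huB]
    have hupd : ∀ (h : V → ℝ → ℝ≥0∞) (x : V → ℝ) (y : ℝ),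
        ∏ v ∈ A, h v (Function.update x w y v) = (∏ v ∈ B, h v (x v)) * h w y := by
      intro h x y
      rw [hAB, Finset.prod_insert hwB, Function.update_self, mul_comm]
      congr 1
      refine Finset.prod_congr rfl fun v hv => ?_
      rw [Function.update_of_ne (by rintro rfl; exact hwB hv)]
    have hcongr : ∀ (h : V → ℝ → ℝ≥0∞) (x x' : V → ℝ), (∀ v ∈ insert w B, x v = x' v) →
        ∏ v ∈ A, h v (x v) = ∏ v ∈ A, h v (x' v) := by
      intro h x x' hx
      rw [hAB]
      exact Finset.prod_congr rfl fun v hv => by rw [hx v hv]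
    have hgm : ∀ v, Measurable (g v) := fun v => (hg v).measurable
    have hF₁ : Measurable fun x : V → ℝ => ∏ v ∈ A, g v √(2 * x v) :=
      Finset.measurable_prod _ fun v _ => (hgm v).comp (by fun_prop)
    have hF₂ : Measurable fun x : V → ℝ => ∏ v ∈ A, g v (√(2 * t) + x v) :=
      Finset.measurable_prod _ fun v _ => (hgm v).comp (by fun_prop)
    calc ∫⁻ ω, ∏ v ∈ A, g v √(2 * localField T v₀ S J t ω v) ∂P
        = ∫⁻ ω, (∏ v ∈ B, g v √(2 * localField T v₀ S J t ω v)) *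
            compoundPoissonAverage (fun y => g w √(2 * y)) (localField T v₀ S J t ω u) ∂P := by
          rw [lintegral_localField_markov hT hS hJ hSJ ht hBc hBv₀ hwB huB hF₁
            (hcongr fun v r => g v √(2 * r))]
          refine lintegral_congr fun ω => ?_
          simp only [hupd fun v r => g v √(2 * r)]
          exact compoundPoissonAverage_const_mul _ ((hgm w).comp (by fun_prop)) _
      _ ≤ ∫⁻ ω, ∏ v ∈ B, g' v √(2 * localField T v₀ S J t ω v) ∂P := by
          refine lintegral_mono fun ω => ?_
          simp only [hprod fun v => √(2 * localField T v₀ S J t ω v)]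
          gcongr
          exact compoundPoissonAverage_le_gaussian hr₀ (hg w) (hg₀ w) (localField_nonneg ht ω u)
      _ ≤ ∫⁻ ω, ∏ v ∈ B, g' v (√(2 * t) + η v ω) ∂P' :=
          ih B.card (hn ▸ Finset.card_erase_lt_of_mem hwA) B hBv₀ hBc g' hg'm hg'₀ rfl
      _ = ∫⁻ ω, ∏ v ∈ A, g v (√(2 * t) + η v ω) ∂P' := by
          rw [hη.lintegral_markov hT hBc hBv₀ hwB huB hF₂ (hcongr fun v r => g v (√(2 * t) + r))]
          refine lintegral_congr fun ω => ?_
          simp only [hupd fun v r => g v (√(2 * t) + r), hprod fun v => √(2 * t) + η v ω]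
          have hm : Measurable fun z => g w (√(2 * t) + (η u ω + z)) := (hgm w).comp (by fun_prop)
          rw [lintegral_const_mul _ hm]
          simp only [hq, add_assoc]
  -- At the root both sides take the deterministic value √(2t).
  · have hA₀ : A = {v₀} := by
      refine Finset.eq_singleton_iff_unique_mem.2 ⟨hv₀, fun z hz => ?_⟩
      by_contra h
      exact hne ⟨z, Finset.mem_erase.2 ⟨h, hz⟩⟩
    subst hA₀
    simp only [Finset.prod_singleton]
    have h1 : ∫⁻ ω, g v₀ √(2 * localField T v₀ S J t ω v₀) ∂P = g v₀ √(2 * t) := by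
      simp [localField]
    have h2 : ∫⁻ ω, g v₀ (√(2 * t) + η v₀ ω) ∂P' = g v₀ √(2 * t) := by
      rw [lintegral_congr_ae (g := fun _ => g v₀ √(2 * t))]
      · simp
      · filter_upwards [hη.root] with ω hω
        simp [hω]
    rw [h1, h2]

lemma lt_ciInf_iff_forall {x : ℝ} {f : V → ℝ} : x < ⨅ v, f v ↔ ∀ v, x < f v := by
  refine ⟨fun h v => h.trans_le (ciInf_le (Set.finite_range f).bddBelow v), fun h => ?_⟩
  obtain ⟨v, hv⟩ := exists_eq_ciInf_of_finite (f := f)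
  rw [← hv]
  exact h v

lemma measure_forall_lt_eq_lintegral {Ω : Type*} [MeasurableSpace Ω] {P : Measure Ω}
    {f : V → Ω → ℝ} (hf : ∀ v, Measurable (f v)) (a : ℝ) :
    P {ω | ∀ v, a < f v ω} = ∫⁻ ω, ∏ v, (Set.Ioi a).indicator (1 : ℝ → ℝ≥0∞) (f v ω) ∂P := by
  have hm : MeasurableSet {ω | ∀ v, a < f v ω} := by
    rw [Set.ofPred_forall]
    exact MeasurableSet.iInter fun v => measurableSet_lt measurable_const (hf v)
  rw [← lintegral_indicator_one hm]
  refine lintegral_congr fun ω => ?_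
  by_cases h : ∀ v, a < f v ω
  · rw [Set.indicator_of_mem (by exact h), Finset.prod_eq_one fun v _ =>
      (Set.indicator_of_mem (s := Set.Ioi a) (h v) _).trans rfl]
    rfl
  · rw [Set.indicator_of_notMem (by exact h)]
    push Not at h
    obtain ⟨v, hv⟩ := h
    have hv' : f v ω ∉ Set.Ioi a := hv.not_gt
    exact (Finset.prod_eq_zero (Finset.mem_univ v) (Set.indicator_of_notMem hv' _)).symm

lemma ae_localTime_eq_localField (hT : T.IsTree) (hS : IsDiscreteWalk T v₀ S P)
    (hJ : IsHoldingTimes J P) (hSJ : IndepFun (fun ω n => S n ω) (fun ω n => J n ω) P)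
    {X : ℝ → Ω → V} (hX : ∀ᵐ ω ∂P, ∀ (n : ℕ) (s : ℝ), jumpTime J n ω ≤ s →
      s < jumpTime J (n + 1) ω → X s ω = S n ω) {t : ℝ} (ht : 0 ≤ t) :
    ∀ᵐ ω ∂P, ∀ v, localTime T X v (inverseLocalTime T X v₀ t ω) ω =
      localField T v₀ S J t ω v := by
  have hd := totalConductance_pos hT v₀
  filter_upwards [hX, ae_pos_holdingTimes hJ,
    ae_exists_crossesAt_tree hT hS hJ hSJ (mul_nonneg ht hd.le)] with ω h1 h2 ⟨N, hN⟩ v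
  rw [localTime_inverseLocalTime_of_crossesAt h1 h2 hd hN,
    localField_of_crossesAt (fun k => (h2 k).le) hN]

/-- After scaling by √2 both events are products of indicators of (√2 x, ∞), which are increasing
and vanish up to a level that is nonnegative because `0 ≤ x`. -/
theorem measure_lt_iInf_sqrt_localField_le (hT : T.IsTree) (hS : IsDiscreteWalk T v₀ S P)
    (hJ : IsHoldingTimes J P) (hSJ : IndepFun (fun ω n => S n ω) (fun ω n => J n ω) P)
    (hη : IsGFF T v₀ η P') {t x : ℝ} (ht : 0 ≤ t) (hx : 0 ≤ x) :
    P {ω | x < ⨅ v, √(localField T v₀ S J t ω v)} ≤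
      P' {ω | √2 * x < (⨅ v, η v ω) + √(2 * t)} := by
  have hL := measurable_localField (G := T) (v₀ := v₀) hS.measurable hJ.measurable t
  have h2 : 0 < √(2 : ℝ) := by positivity
  have e1 : {ω | x < ⨅ v, √(localField T v₀ S J t ω v)} =
      {ω | ∀ v, √2 * x < √(2 * localField T v₀ S J t ω v)} := by
    ext ω
    simp only [Set.mem_ofPred_eq, lt_ciInf_iff_forall]
    refine forall_congr' fun v => ?_
    rw [Real.sqrt_mul zero_le_two, mul_lt_mul_iff_right₀ h2]
  have e2 : {ω | √2 * x < (⨅ v, η v ω) + √(2 * t)} =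
      {ω | ∀ v, √2 * x < √(2 * t) + η v ω} := by
    ext ω
    simp only [Set.mem_ofPred_eq, ← sub_lt_iff_lt_add, lt_ciInf_iff_forall]
    exact forall_congr' fun v => sub_lt_comm
  have hm : ∀ v, Measurable fun ω => √(2 * localField T v₀ S J t ω v) := fun v =>
    (((measurable_pi_apply v).comp hL).const_mul 2).sqrt
  rw [e1, e2, measure_forall_lt_eq_lintegral hm,
    measure_forall_lt_eq_lintegral fun v => (hη.measurable v).const_add _]
  refine lintegral_prod_localField_le hT hS hJ hSJ hη ht (mul_nonneg h2.le hx) Finset.univ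
    (Finset.mem_univ _) (fun _ _ _ => Finset.mem_univ _) _ (fun v a b hab => ?_)
    fun v y hy => Set.indicator_of_notMem (by simpa using hy) _
  by_cases ha : √2 * x < a
  · rw [Set.indicator_of_mem (by exact ha), Set.indicator_of_mem (by exact ha.trans_le hab)]
    rfl
  · rw [Set.indicator_of_notMem (by exact ha)]
    exact zero_le

end Comparison

end GraphWalk

end

/-! ### The domination for the walk itself. -/

theorem theorem2p3 {V : Type*} [Fintype V] [DecidableEq V] [Nontrivial V]
    [MeasurableSpace V] [MeasurableSingletonClass V]
    (T : SimpleGraph V) [DecidableRel T.Adj] (hT : T.IsTree) (v₀ : V)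
    {Ω : Type*} [MeasurableSpace Ω] (P : Measure Ω) [IsProbabilityMeasure P]
    (X : ℝ → Ω → V) (hX : GraphWalk.IsContinuousTimeWalk T v₀ X P)
    {Ω' : Type*} [MeasurableSpace Ω'] (P' : Measure Ω') [IsProbabilityMeasure P']
    (η : V → Ω' → ℝ) (hη : GraphWalk.IsGFF T v₀ η P')
    (t : ℝ) (ht : 0 < t) :
    GraphWalk.StochDominated
      (fun ω => ⨅ v, Real.sqrt
        (GraphWalk.localTime T X v (GraphWalk.inverseLocalTime T X v₀ t ω) ω)) P
      (fun ω => 1 / Real.sqrt 2 * max ((⨅ v, η v ω) + Real.sqrt (2 * t)) 0) P' := by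
  obtain ⟨S, J, hS, hJ, hSJ, hpath⟩ := hX
  have hae := GraphWalk.ae_localTime_eq_localField hT hS hJ hSJ hpath ht.le
  have hL := GraphWalk.measurable_localField (G := T) (v₀ := v₀) hS.measurable hJ.measurable t
  have h2 : 0 < Real.sqrt 2 := by positivity
  have hmin : (fun ω => ⨅ v, Real.sqrt
      (GraphWalk.localTime T X v (GraphWalk.inverseLocalTime T X v₀ t ω) ω)) =ᵐ[P]
      fun ω => ⨅ v, Real.sqrt (GraphWalk.localField T v₀ S J t ω v) := by
    filter_upwards [hae] with ω hω
    simp_rw [hω]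
  refine ⟨?_, ?_, fun x => ?_⟩
  · refine AEMeasurable.congr (Measurable.aemeasurable ?_) hmin.symm
    exact Measurable.iInf fun v => ((measurable_pi_apply v).comp hL).sqrt
  · refine Measurable.aemeasurable ?_
    exact (((Measurable.iInf hη.measurable).add_const _).max measurable_const).const_mul _
  -- For a negative level the maximum with 0 makes the right-hand probability 1, so only nonnegative
  -- levels need the comparison.
  · rcases lt_or_ge x 0 with hx | hx
    · have huniv : {ω | x < 1 / Real.sqrt 2 * max ((⨅ v, η v ω) + Real.sqrt (2 * t)) 0} =
          Set.univ :=
        Set.eq_univ_of_forall fun ω =>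
          hx.trans_le (mul_nonneg (one_div_nonneg.2 h2.le) (le_max_right _ _))
      rw [huniv, measure_univ]
      exact prob_le_one
    · have hleft : P {ω | x < ⨅ v, Real.sqrt
            (GraphWalk.localTime T X v (GraphWalk.inverseLocalTime T X v₀ t ω) ω)} =
          P {ω | x < ⨅ v, Real.sqrt (GraphWalk.localField T v₀ S J t ω v)} := by
        refine measure_congr ?_
        filter_upwards [hmin] with ω hω
        exact congrArg (x < ·) hω
      rw [hleft]
      refine (GraphWalk.measure_lt_iInf_sqrt_localField_le hT hS hJ hSJ hη ht.le hx).trans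
        (measure_mono fun ω hω => ?_)
      have hω' : Real.sqrt 2 * x < (⨅ v, η v ω) + Real.sqrt (2 * t) := hω
      change x < 1 / Real.sqrt 2 * _
      rw [one_div, lt_inv_mul_iff₀ h2]
      exact hω'.trans_le (le_max_left _ _)
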